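/- **Setting.** Let $n\ge 4$ and let $G$ be of type $D_n$. Realize the root system in $\mathbb R^n$ with standard basis $e_1,\dots,e_n$, simple roots $\alpha_1=e_1+e_2$ and $\alpha_i=e_i-e_{i-1}$ $(2\le i\le n)$, positive roots $R^+=\{e_j\pm e_i: 1\le i<j\le n\}$ and fundamental weights $\omega_1,\dots,\omega_n$, i.e. $\langle\omega_i,\check\alpha_j\rangle=\delta_{ij}$. The Weyl group $W$ is generated by $s_1=(1,-2)(-1,2)$ and $s_i=(i-1,i)(-(i-1),-i)$ for $2\le i\le n$. It consists of the signed permutations $v$ of $\{\pm1,\dots,\pm n\}$ with an even number of negative entries in the one-line notation $v=(v(1),\dots,v(n))$, and it acts by $v(e_k)=e_{v(k)}$, where $e_{-k}=-e_k$. For $1\le r\le n$ let $W^{I_r}=\{v\in W: v(\alpha_j)\in R^+ \text{ for all } j\ne r\}$. Write $x\ge 0$ if $x$ is a linear combination of simple roots with nonnegative real coefficients. Call $v$ *maximal* if it is a maximal element, for the Bruhat order, of $\{v\in W^{I_r}: v(\omega_r)\ge 0\}$. For integers $p\ge0$ and $s,t$ let $J_{p,[s,t]}$ be the set of sequences $\underline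 i=(i_1,\dots,i_p)$ of integers in $[s,t]$ with $i_{k+1}-i_k\ge 2$ for all $k$ (for $p=0$, only the empty sequence). Put $\underline i'=(i_1-1,\dots,i_p-1)$, $-\underline i=(-i_p,\dots,-i_1)$, and let $[\underline i]$ be the set of entries of $\underline i$. For a finite set $S$ of integers, $S\uparrow$ is the list of its elements in increasing order. For $s\in\{2,3,4\}$ put $C_s=[s,n]\setminus([\underline i]\cup[\underline i'])$, and let $(C_s\uparrow)^-$ be the list obtained from $C_s\uparrow$ by replacing its first entry $t=\min C_s$ by $-t$. **Proposition 5.1.** The maximal elements $v$ are the following. (i) Let $r=1$. There is exactly one maximal $v$: - $n\equiv0\ (4)$: $v=(-(n-1),-(n-3),\dots,-3,-1,2,4,\dots,n-2,n)$ and $v(4\omega_1)=2\alpha_2+2\sum_{i=2}^{n/2}\alpha_{2i}$; - $n\equiv2\ (4)$: $v=(-(n-1),-(n-3),\dots,-3,1,2,4,\dots,n-2,n)$ and $v(4\omega_1)=2\alpha_1+2\sum_{i=2}^{n/2}\alpha_{2i}$; - $n\equiv1\ (4)$: $v=(-(n-1),-(n-3),\dots,-4,-1,2,3,5,\dots,n-2,n)$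 and $v(4\omega_1)=\alpha_1+3\alpha_2+2\alpha_3+2\sum_{i=2}^{(n-1)/2}\alpha_{2i+1}$; - $n\equiv3\ (4)$: $v=(-(n-1),-(n-3),\dots,-4,1,2,3,5,\dots,n-2,n)$ and $v(4\omega_1)=3\alpha_1+\alpha_2+2\alpha_3+2\sum_{i=2}^{(n-1)/2}\alpha_{2i+1}$. (ii) Let $r=2$. There is exactly one maximal $v$ (the block from $-(n-3)$ to $-3$, resp. to $-4$, is empty for $n=4$, resp. $n=5$): - $n\equiv0\ (4)$: $v=(n-1,-(n-3),\dots,-3,1,2,4,\dots,n-2,n)$ and $v(4\omega_2)=2\alpha_1+2\sum_{i=2}^{n/2}\alpha_{2i}$; - $n\equiv2\ (4)$: $v=(n-1,-(n-3),\dots,-3,-1,2,4,\dots,n-2,n)$ and $v(4\omega_2)=2\alpha_2+2\sum_{i=2}^{n/2}\alpha_{2i}$; - $n\equiv1\ (4)$: $v=(n-1,-(n-3),\dots,-4,1,2,3,5,\dots,n-2,n)$ and $v(4\omega_2)=3\alpha_1+\alpha_2+2\alpha_3+2\sum_{i=2}^{(n-1)/2}\alpha_{2i+1}$; - $n\equiv3\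 (4)$: $v=(n-1,-(n-3),\dots,-4,-1,2,3,5,\dots,n-2,n)$ and $v(4\omega_2)=\alpha_1+3\alpha_2+2\alpha_3+2\sum_{i=2}^{(n-1)/2}\alpha_{2i+1}$. (iii) Let $3\le r\le n-1$ and $n+1-r=2m$. Let $Z$ be the set of the sequences $(1,3,i_1,\dots,i_{m-2})$ with $(i_1,\dots,i_{m-2})\in J_{m-2,[5,n]}$ (empty if $m=1$). For every $\underline i\in J_{m,[1,n]}\setminus Z$ there is a unique $v\in W^{I_r}$ with $v(\omega_r)=\sum_{k=1}^m\alpha_{i_k}$, and it is maximal. Explicitly, each of the following is the unique element of $W^{I_r}$ of the given weight, and is maximal: - (a) for $\underline i\in J_{m,[3,n]}$: $v_{\underline i}(\omega_r)=\sum_{k=1}^m\alpha_{i_k}$, with $v_{\underline i}=(\varepsilon,\,C_2\uparrow,\,-\underline i',\,\underline i)$, where $\varepsilon=-1$ if $m$ is odd and $\varepsilon=1$ if $m$ is even; - (b) for $\underline i\in J_{m-1,[4,n]}$: $v_{1,\underline i}(\omega_r)=\alpha_1+\sum_{k=1}^{m-1}\alpha_{i_k}$, with $v_{1,\underline i}=(C_3\uparrow,-\underline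 i',1,2,\underline i)$ if $m$ is odd and $((C_3\uparrow)^-,-\underline i',1,2,\underline i)$ if $m$ is even; - (c) for $\underline i\in J_{m-1,[4,n]}$: $v_{2,\underline i}(\omega_r)=\alpha_2+\sum_{k=1}^{m-1}\alpha_{i_k}$, with $v_{2,\underline i}=((C_3\uparrow)^-,-\underline i',-1,2,\underline i)$ if $m$ is odd and $(C_3\uparrow,-\underline i',-1,2,\underline i)$ if $m$ is even. Every maximal $v$ is one of the elements in (a), (b), (c). (iv) Let $3\le r\le n-1$ and $n+1-r=2m+1$. Each of the following is the unique element of $W^{I_r}$ of the given weight, and is maximal: - (a) for $\underline i\in J_{m,[4,n]}$: $v_{\underline i}(\omega_r)=\frac12\alpha_1+\frac12\alpha_2+\sum_{k=1}^m\alpha_{i_k}$, with $v_{\underline i}=(\varepsilon,\,C_3\uparrow,\,-\underline i',\,2,\,\underline i)$, where $\varepsilon=-1$ if $m$ is odd and $\varepsilon=1$ if $m$ is even; - (b) for $\underline i\in J_{m-1,[5,n]}$: $v_{\underline i,1}(\omega_r)=\frac32\alpha_1+\frac12\alpha_2+\alpha_3+\sum_{k=1}^{m-1}\alpha_{i_k}$,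 with $v_{\underline i,1}=(C_4\uparrow,-\underline i',1,2,3,\underline i)$ if $m$ is odd and $((C_4\uparrow)^-,-\underline i',1,2,3,\underline i)$ if $m$ is even; - (c) for $\underline i\in J_{m-1,[5,n]}$: $v_{\underline i,2}(\omega_r)=\frac12\alpha_1+\frac32\alpha_2+\alpha_3+\sum_{k=1}^{m-1}\alpha_{i_k}$, with $v_{\underline i,2}=((C_4\uparrow)^-,-\underline i',-1,2,3,\underline i)$ if $m$ is odd and $(C_4\uparrow,-\underline i',-1,2,3,\underline i)$ if $m$ is even. Every maximal $v$ is one of the elements in (a), (b), (c). (v) Let $r=n$. There is exactly one maximal $v$, namely $v=(1,3,4,\dots,n-1,n,2)$, and $v(\omega_n)=\frac12\alpha_1+\frac12\alpha_2$. -/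

import Mathlib

/-! The Weyl group, the root system and the fundamental weights of type `D_n`, in the standard
coordinates: `E = ℝⁿ` with standard basis `e_1, …, e_n`, simple roots `α_1 = e_1 + e_2` and
`α_i = e_i - e_{i-1}` for `2 ≤ i ≤ n`, and the Weyl group acting by signed permutations. -/

namespace TypeD

open Equiv

/-- `vec n k` is `e_k` for `1 ≤ k ≤ n`, is `-e_{-k}` for `-n ≤ k ≤ -1`, and is `0` otherwise. -/
noncomputable def vec (n : ℕ) (k : ℤ) : Fin n → ℝ :=
  fun j => if k = (j : ℤ) + 1 then 1 else if k = -((j : ℤ) + 1) then -1 else 0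

/-- The simple root `α_i`, `1 ≤ i ≤ n`. -/
noncomputable def simpleRoot (n : ℕ) (i : ℤ) : Fin n → ℝ :=
  if i = 1 then vec n 1 + vec n 2 else vec n i - vec n (i - 1)

/-- The set `R⁺` of positive roots, `e_j - e_i` and `e_j + e_i` for `1 ≤ i < j ≤ n`. -/
def posRoots (n : ℕ) : Set (Fin n → ℝ) :=
  {x | ∃ i j : ℤ, 1 ≤ i ∧ i < j ∧ j ≤ n ∧ (x = vec n j - vec n i ∨ x = vec n j + vec n i)}

/-- The fundamental weight `ω_r`, `1 ≤ r ≤ n`: `ω_1 = (e_1 + e_2 + ⋯ + e_n) / 2`,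
`ω_2 = (-e_1 + e_2 + ⋯ + e_n) / 2` and `ω_r = e_r + ⋯ + e_n` for `r ≥ 3`. The lemma
`fundWeight_pairing` below shows that this is the basis dual to the simple coroots. -/
noncomputable def fundWeight (n : ℕ) (r : ℤ) : Fin n → ℝ :=
  fun j =>
    if r = 1 then 1 / 2
    else if r = 2 then (if (j : ℕ) = 0 then -1 / 2 else 1 / 2)
    else if r ≤ (j : ℤ) + 1 then 1 else 0

/-- The pairing `⟨x, α̌⟩ = 2 (x, α) / (α, α)` with the coroot of `α`. -/
noncomputable def corootPairing {n : ℕ} (x a : Fin n → ℝ) : ℝ :=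
  2 * (x ⬝ᵥ a) / (a ⬝ᵥ a)

theorem dotProduct_vec {n : ℕ} (x : Fin n → ℝ) (k : Fin n) :
    x ⬝ᵥ vec n ((k : ℤ) + 1) = x k := by
  have h : ∀ j : Fin n, vec n ((k : ℤ) + 1) j = if j = k then 1 else 0 := by
    intro j
    unfold vec
    by_cases hjk : j = k
    · simp [hjk]
    · have : (j : ℤ) ≠ k := by
        intro h; apply hjk; ext; exact_mod_cast h
      rw [if_neg (by omega), if_neg (by omega), if_neg hjk]
  simp [dotProduct, h]

/-- `⟨ω_i, α̌_j⟩ = δ_{ij}`. -/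
theorem fundWeight_pairing {n : ℕ} (hn : 2 ≤ n) {i j : ℤ} (hi : 1 ≤ i)
    (hj : 1 ≤ j) (hjn : j ≤ n) :
    corootPairing (fundWeight n i) (simpleRoot n j) = if i = j then 1 else 0 := by
  have key : ∀ (x : Fin n → ℝ) (k : ℤ) (h1 : 1 ≤ k) (h2 : k ≤ n),
      x ⬝ᵥ vec n k = x ⟨(k - 1).toNat, by omega⟩ := by
    intro x k h1 h2
    rw [← dotProduct_vec x ⟨(k - 1).toNat, by omega⟩]
    congr 2
    simp; omega
  have key2 : ∀ (k l : ℤ) (h1 : 1 ≤ k) (h2 : k ≤ n) (h3 : 1 ≤ l),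
      vec n l ⟨(k - 1).toNat, by omega⟩ = if k = l then 1 else 0 := by
    intro k l h1 h2 h3
    unfold vec
    grind
  unfold corootPairing simpleRoot
  by_cases h1 : j = 1
  · subst h1
    rw [if_pos rfl, dotProduct_add, dotProduct_add]
    rw [key _ 1 (by omega) (by omega), key _ 2 (by omega) (by omega),
      key _ 1 (by omega) (by omega), key _ 2 (by omega) (by omega)]
    simp only [Pi.add_apply]
    rw [key2 1 1 (by omega) (by omega) (by omega), key2 1 2 (by omega) (by omega) (by omega),
      key2 2 1 (by omega) (by omega) (by omega), key2 2 2 (by omega) (by omega) (by omega)]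
    simp only [fundWeight]
    norm_num
    grind
  · rw [if_neg h1, dotProduct_sub, dotProduct_sub]
    rw [key _ j (by omega) (by omega), key _ (j - 1) (by omega) (by omega),
      key _ j (by omega) (by omega), key _ (j - 1) (by omega) (by omega)]
    simp only [Pi.sub_apply]
    rw [key2 j j (by omega) (by omega) (by omega),
      key2 j (j - 1) (by omega) (by omega) (by omega),
      key2 (j - 1) j (by omega) (by omega) (by omega),
      key2 (j - 1) (j - 1) (by omega) (by omega) (by omega)]
    rw [if_pos rfl, if_pos rfl, if_neg (by omega), if_neg (by omega)]
    simp only [fundWeight]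
    grind

/-- `x ≥ 0` for `x ∈ E`: `x` is a combination of the simple roots with coefficients `≥ 0`. -/
def NonnegWeight (n : ℕ) (x : Fin n → ℝ) : Prop :=
  ∃ c : ℤ → ℝ, (∀ i, 0 ≤ c i) ∧ x = ∑ i ∈ Finset.Icc (1 : ℤ) n, c i • simpleRoot n i

/-- The simple reflection `s_i`, `1 ≤ i ≤ n`, as a permutation of the integers (it moves only
elements of `[-n, n] \ {0}`): `s_1 = (1, -2)(-1, 2)`, and `s_i = (i - 1, i)(-(i - 1), -i)`
for `2 ≤ i ≤ n`. -/
def simpleRefl (i : ℤ) : Perm ℤ :=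
  if i = 1 then swap 1 (-2) * swap (-1) 2 else swap (i - 1) i * swap (-(i - 1)) (-i)

/-- The Weyl group `W` of type `D_n`, generated by `s_1, …, s_n`. Its elements are the
permutations `w` of `ℤ` with `w (-k) = -w k`, fixing every `k` with `|k| > n`, such that the
number of negative integers among `w 1, …, w n` is even. -/
def weylGroup (n : ℕ) : Subgroup (Perm ℤ) :=
  Subgroup.closure (simpleRefl '' Set.Icc 1 (n : ℤ))

/-- The action of `W` on `E`: the linear map with `e_k ↦ e_{w k}`, where `e_{-k} = -e_k`. -/
noncomputable def act (n : ℕ) (w : Perm ℤ) (x : Fin n → ℝ) : Fin n → ℝ :=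
  ∑ k : Fin n, x k • vec n (w ((k : ℤ) + 1))

/-- The length of `w ∈ W`: the least number of factors in an expression of `w` as a product of
simple reflections. -/
noncomputable def length (n : ℕ) (w : Perm ℤ) : ℕ :=
  sInf {k | ∃ l : List ℤ, l.length = k ∧ (∀ i ∈ l, 1 ≤ i ∧ i ≤ n) ∧
    (l.map simpleRefl).prod = w}

/-- The reflections in `W`: the conjugates of the simple reflections. -/
def IsReflection (n : ℕ) (t : Perm ℤ) : Prop :=
  ∃ w ∈ weylGroup n, ∃ i : ℤ, 1 ≤ i ∧ i ≤ n ∧ t = w * simpleRefl i * w⁻¹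

/-- The Bruhat order on `W`: the reflexive and transitive closure of the relation `u < t u`
for a reflection `t` with `ℓ(u) < ℓ(t u)`. -/
def BruhatLE (n : ℕ) : Perm ℤ → Perm ℤ → Prop :=
  Relation.ReflTransGen fun u w =>
    u ∈ weylGroup n ∧ ∃ t, IsReflection n t ∧ w = t * u ∧ length n u < length n w

/-- `W^{I_r}` for `I_r = {α_r}`: the `w ∈ W` with `w(α_j) ∈ R⁺` for every `j ≠ r`. -/
def minReps (n : ℕ) (r : ℤ) : Set (Perm ℤ) :=
  {w | w ∈ weylGroup n ∧
    ∀ j : ℤ, 1 ≤ j → j ≤ n → j ≠ r → act n w (simpleRoot n j) ∈ posRoots n}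

/-- The maximal elements, in the Bruhat order, of `{v ∈ W^{I_r} : v(ω_r) ≥ 0}`. -/
def maximalSet (n : ℕ) (r : ℤ) : Set (Perm ℤ) :=
  {v | v ∈ minReps n r ∧ NonnegWeight n (act n v (fundWeight n r)) ∧
    ∀ u ∈ minReps n r, NonnegWeight n (act n u (fundWeight n r)) → BruhatLE n v u → u = v}

/-- `v` is the unique element of `W^{I_r}` with `v(ω_r) = x`. -/
def IsUniqueOfWeight (n : ℕ) (r : ℤ) (x : Fin n → ℝ) (v : Perm ℤ) : Prop :=
  v ∈ minReps n r ∧ act n v (fundWeight n r) = x ∧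
    ∀ u ∈ minReps n r, act n u (fundWeight n r) = x → u = v

/-- The one-line notation `(v 1, v 2, …, v n)`. -/
def oneLine (n : ℕ) (v : Perm ℤ) : List ℤ :=
  (List.range n).map fun k => v ((k : ℤ) + 1)

/-- `J_{p,[s,t]}`: the sequences `(i_1, …, i_p)` in `[s, t]` with `i_{k+1} - i_k ≥ 2`. -/
def J (p : ℕ) (s t : ℤ) : Set (List ℤ) :=
  {i | i.length = p ∧ (∀ x ∈ i, s ≤ x ∧ x ≤ t) ∧ i.IsChain fun a b => b - a ≥ 2}

/-- The sequences `(1, 3, i_1, …, i_{m-2})` with `i_k ∈ {5, …, n}` and `i_{k+1} - i_k ≥ 2`. -/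
def Z (m : ℕ) (n : ℤ) : Set (List ℤ) :=
  {l | ∃ i : List ℤ, i.length + 2 = m ∧ i ∈ J i.length 5 n ∧ l = 1 :: 3 :: i}

/-- `α_{i_1} + ⋯ + α_{i_p}` for `i = (i_1, …, i_p)`. -/
noncomputable def rootSum (n : ℕ) (i : List ℤ) : Fin n → ℝ :=
  (i.map (simpleRoot n)).sum

/-- `i' = (i_1 - 1, …, i_p - 1)`. -/
def primed (i : List ℤ) : List ℤ := i.map fun x => x - 1

/-- `-i = (-i_p, …, -i_1)`. -/
def negRev (i : List ℤ) : List ℤ := (i.map fun x => -x).reverse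

/-- `[s, n] \ {[i], [i']}`. -/
noncomputable def gaps (s : ℤ) (n : ℕ) (i : List ℤ) : Finset ℤ :=
  Finset.Icc s (n : ℤ) \ (i.toFinset ∪ (primed i).toFinset)

/-- `S↑`: the elements of `S` in increasing order. -/
def up (S : Finset ℤ) : List ℤ := S.sort (· ≤ ·)

/-- The least element of `S` (with the value `0` if `S` is empty). -/
def least (S : Finset ℤ) : ℤ := S.min.untopD 0

/-- The arithmetic progression `a, a + 2, a + 4, …` with `k` terms. -/
def steps (a : ℤ) (k : ℕ) : List ℤ := (List.range k).map fun j => a + 2 * (j : ℤ)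

/-- `S↑` with its first entry `t = min S` replaced by `-t`. -/
def upNeg (S : Finset ℤ) : List ℤ := -least S :: up (S.erase (least S))

end TypeD

open TypeD

/-! For `v ∈ W^{I_r}` the weight `v(ω_r)` determines `v`, and it decreases when `v` increases in the
Bruhat order. Hence if `v` is maximal, then `v(ω_r) ≥ 0` and no simple reflection lowers `v(ω_r)` to
another weight `≥ 0`; conversely, `v` is maximal if no reflection at all does. For a weight with
coordinates in `{-1, 0, 1}`, such as those in the orbits of `ω_r` for `r ≥ 3`, of `2 ω_1` and of
`2 ω_2`, nonnegativity is a condition on the suffix sums of the coordinates. The condition on simple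
reflections then forces the weight to be `e e_1 + e_2 + ⋯ + e_t + α_{i_1} + ⋯ + α_{i_p}` with
`t ≤ 3`, `t + 2 ≤ i_1` and `i_{k+1} - i_k ≥ 2`, and such a weight satisfies the condition on all
reflections. The orbits are told apart by the number of nonzero coordinates, together with the
parity of the number of negative ones if there is no zero coordinate. The one-line notation of `v`
is read off from the weight, because `v ∈ W^{I_r}` is increasing on blocks. -/

namespace TypeD

open Equiv

variable {n : ℕ}

/-! ### Signed coordinates -/

/-- The coordinate of `x` along `e_k`, extended to an odd function of `k ∈ ℤ` that vanishes for
`|k| > n`; the Weyl group acts on weights by permuting the arguments of this function. -/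
noncomputable def coord (x : Fin n → ℝ) (k : ℤ) : ℝ := x ⬝ᵥ vec n k

/-- `k` belongs to the set `{±1, …, ±n}` of signed indices. -/
def IsIndex (n : ℕ) (k : ℤ) : Prop := k ≠ 0 ∧ -n ≤ k ∧ k ≤ n

theorem vec_neg (k : ℤ) : vec n (-k) = -vec n k := by
  funext j
  simp only [vec, Pi.neg_apply]
  grind

theorem vec_eq_zero {k : ℤ} (hk : ¬ IsIndex n k) : vec n k = 0 := by
  funext j
  have := j.2
  simp only [vec, Pi.zero_apply, IsIndex] at hk ⊢
  grind

@[simp]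
theorem coord_neg_right (x : Fin n → ℝ) (k : ℤ) : coord x (-k) = -coord x k := by
  simp [coord, vec_neg]

@[simp]
theorem coord_add (x y : Fin n → ℝ) (k : ℤ) : coord (x + y) k = coord x k + coord y k := by
  simp [coord]

@[simp]
theorem coord_sub (x y : Fin n → ℝ) (k : ℤ) : coord (x - y) k = coord x k - coord y k := by
  simp [coord]

@[simp]
theorem coord_smul (c : ℝ) (x : Fin n → ℝ) (k : ℤ) : coord (c • x) k = c * coord x k := by
  simp [coord]

@[simp]
theorem coord_sum {ι : Type*} (s : Finset ι) (f : ι → Fin n → ℝ) (k : ℤ) :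
    coord (∑ i ∈ s, f i) k = ∑ i ∈ s, coord (f i) k := by
  simp [coord, sum_dotProduct]

theorem coord_eq_zero (x : Fin n → ℝ) {k : ℤ} (hk : ¬ IsIndex n k) : coord x k = 0 := by
  simp [coord, vec_eq_zero hk]

theorem coord_fin (x : Fin n → ℝ) (j : Fin n) : coord x ((j : ℤ) + 1) = x j :=
  dotProduct_vec x j

theorem coord_apply (x : Fin n → ℝ) {k : ℤ} (h₁ : 1 ≤ k) (h₂ : k ≤ n) :
    coord x k = x ⟨(k - 1).toNat, by omega⟩ := by
  rw [← coord_fin x]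
  congr 1
  change k = ((k - 1).toNat : ℤ) + 1
  omega

theorem coord_ext {x y : Fin n → ℝ} (h : ∀ k : ℤ, 1 ≤ k → k ≤ n → coord x k = coord y k) :
    x = y := by
  funext j
  rw [← coord_fin x, ← coord_fin y]
  exact h _ (by omega) (by omega)

theorem coord_vec (k : ℤ) {l : ℤ} (hl : IsIndex n l) :
    coord (vec n k) l = if k = l then 1 else if k = -l then -1 else 0 := by
  have of_pos : ∀ l : ℤ, 1 ≤ l → l ≤ n →
      coord (vec n k) l = if k = l then 1 else if k = -l then -1 else 0 := by
    intro l h₁ h₂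
    rw [coord_apply _ h₁ h₂]
    simp only [vec]
    grind
  rcases lt_or_gt_of_ne hl.1 with hneg | hpos
  · have := of_pos (-l) (by omega) (by have := hl.2.1; omega)
    rw [coord_neg_right] at this
    grind
  · exact of_pos l (by omega) hl.2.2

theorem sum_fin_eq_sum_Icc (f : ℤ → ℝ) :
    ∑ j : Fin n, f ((j : ℤ) + 1) = ∑ k ∈ Finset.Icc (1 : ℤ) n, f k := by
  refine Finset.sum_bij (fun j _ => (j : ℤ) + 1) ?_ ?_ ?_ fun _ _ => rfl
  · intro j _
    exact Finset.mem_Icc.2 ⟨by omega, by omega⟩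
  · intro a _ b _ h
    ext
    simpa using h
  · intro k hk
    rw [Finset.mem_Icc] at hk
    exact ⟨⟨(k - 1).toNat, by omega⟩, Finset.mem_univ _, by simp; omega⟩

theorem dotProduct_eq_sum_coord (x y : Fin n → ℝ) :
    x ⬝ᵥ y = ∑ k ∈ Finset.Icc (1 : ℤ) n, coord x k * coord y k := by
  rw [← sum_fin_eq_sum_Icc fun k => coord x k * coord y k]
  simp [coord_fin, dotProduct]

theorem sum_smul_vec (x : Fin n → ℝ) : ∑ j : Fin n, x j • vec n ((j : ℤ) + 1) = x := by
  refine coord_ext fun k h₁ h₂ => ?_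
  have hk : IsIndex n k := ⟨by omega, by omega, h₂⟩
  simp only [coord_sum, coord_smul, ← coord_fin x]
  rw [sum_fin_eq_sum_Icc fun l => coord x l * coord (vec n l) k,
    Finset.sum_eq_single_of_mem k (Finset.mem_Icc.2 ⟨h₁, h₂⟩), coord_vec _ hk, if_pos rfl, mul_one]
  intro l hl hlk
  rw [Finset.mem_Icc] at hl
  rw [coord_vec _ hk, if_neg hlk, if_neg (by omega), mul_zero]

/-! ### Roots and reflections -/

/-- The vector `e_b - e_a`, for signed indices `a` and `b`; every root has this form, in exactly two
ways, the other one being `e_{-a} - e_{-b}`. -/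
noncomputable def root (n : ℕ) (a b : ℤ) : Fin n → ℝ := vec n b - vec n a

/-- The signed indices `a`, `b` define a root `e_b - e_a`; it is positive if and only if `a < b`. -/
def IsRootPair (n : ℕ) (a b : ℤ) : Prop := IsIndex n a ∧ IsIndex n b ∧ a ≠ b ∧ a ≠ -b

/-- The reflection in the root `e_b - e_a`, as a permutation of the signed indices. -/
def rootRefl (a b : ℤ) : Perm ℤ := swap a b * swap (-a) (-b)

theorem IsRootPair.symm {a b : ℤ} (h : IsRootPair n a b) : IsRootPair n b a :=
  ⟨h.2.1, h.1, h.2.2.1.symm, fun e => h.2.2.2 (by omega)⟩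

theorem root_neg_neg (a b : ℤ) : root n (-b) (-a) = root n a b := by
  simp only [root, vec_neg]
  abel

theorem root_swap (a b : ℤ) : root n b a = -root n a b := (neg_sub _ _).symm

theorem dotProduct_root (x : Fin n → ℝ) (a b : ℤ) : x ⬝ᵥ root n a b = coord x b - coord x a := by
  simp only [root, coord, dotProduct_sub]

theorem coord_root {a b k : ℤ} (hk : IsIndex n k) : coord (root n a b) k =
    (if b = k then 1 else if b = -k then -1 else 0) -
      (if a = k then 1 else if a = -k then -1 else 0) := by
  rw [root, coord_sub, coord_vec _ hk, coord_vec _ hk]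

theorem root_dotProduct_self {a b : ℤ} (h : IsRootPair n a b) : root n a b ⬝ᵥ root n a b = 2 := by
  obtain ⟨ha, hb, hab, hab'⟩ := h
  rw [dotProduct_root, coord_root hb, coord_root ha]
  unfold IsIndex at ha hb
  grind

theorem mem_posRoots_iff {x : Fin n → ℝ} :
    x ∈ posRoots n ↔ ∃ a b, IsRootPair n a b ∧ a < b ∧ x = root n a b := by
  have root_neg (i j : ℤ) : root n (-i) j = vec n j + vec n i := by
    rw [root, vec_neg, sub_neg_eq_add]
  constructor
  · rintro ⟨i, j, hi, hij, hj, rfl | rfl⟩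
    · exact ⟨i, j, by unfold IsRootPair IsIndex; omega, hij, rfl⟩
    · exact ⟨-i, j, by unfold IsRootPair IsIndex; omega, by omega, (root_neg i j).symm⟩
  · rintro ⟨a, b, ⟨⟨ha, ha₁, _⟩, ⟨hb, _, hb₂⟩, -, hab'⟩, hab, rfl⟩
    rcases lt_or_gt_of_ne ha with ha | ha
    · rcases lt_or_gt_of_ne hb with hb | hb
      · exact ⟨-b, -a, by omega, by omega, by omega, Or.inl (root_neg_neg _ _).symm⟩
      · rcases lt_or_gt_of_ne hab' with hlt | hlt
        · refine ⟨b, -a, by omega, by omega, by omega, Or.inr ?_⟩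
          rw [← root_neg, root_neg_neg]
        · refine ⟨-a, b, by omega, by omega, by omega, Or.inr ?_⟩
          rw [← root_neg, neg_neg]
    · exact ⟨a, b, by omega, by omega, by omega, Or.inl rfl⟩

theorem root_eq_root {a b c d : ℤ} (h : IsRootPair n a b) (h' : IsRootPair n c d)
    (e : root n a b = root n c d) : (a = c ∧ b = d) ∨ (a = -d ∧ b = -c) := by
  have ha := congrArg (coord · a) e
  have hb := congrArg (coord · b) e
  simp only [coord_root h.1, coord_root h.2.1] at ha hb
  unfold IsRootPair IsIndex at h h'
  grind

theorem root_mem_posRoots_iff {a b : ℤ} (h : IsRootPair n a b) :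
    root n a b ∈ posRoots n ↔ a < b := by
  refine ⟨fun hp => ?_, fun hlt => mem_posRoots_iff.2 ⟨a, b, h, hlt, rfl⟩⟩
  obtain ⟨c, d, hcd, hlt, e⟩ := mem_posRoots_iff.1 hp
  rcases root_eq_root h hcd e with h | h <;> omega

theorem rootRefl_comm (a b : ℤ) : rootRefl b a = rootRefl a b := by
  simp only [rootRefl, swap_comm]

theorem rootRefl_apply {a b : ℤ} (h : IsRootPair n a b) (k : ℤ) :
    rootRefl a b k =
      if k = a then b else if k = b then a
      else if k = -a then -b else if k = -b then -a else k := by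
  unfold IsRootPair IsIndex at h
  simp only [rootRefl, Perm.mul_apply, swap_apply_def]
  grind

theorem rootRefl_apply_neg {a b : ℤ} (h : IsRootPair n a b) (k : ℤ) :
    rootRefl a b (-k) = -rootRefl a b k := by
  simp only [rootRefl_apply h]
  unfold IsRootPair IsIndex at h
  grind

theorem rootRefl_apply_of_not_isIndex {a b : ℤ} (h : IsRootPair n a b) {k : ℤ}
    (hk : ¬ IsIndex n k) : rootRefl a b k = k := by
  rw [rootRefl_apply h]
  unfold IsRootPair IsIndex at *
  grind

theorem rootRefl_mul_self {a b : ℤ} (h : IsRootPair n a b) : rootRefl a b * rootRefl a b = 1 := by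
  ext k
  simp only [Perm.mul_apply, rootRefl_apply h, Perm.one_apply]
  unfold IsRootPair IsIndex at h
  grind

theorem rootRefl_inv {a b : ℤ} (h : IsRootPair n a b) : (rootRefl a b)⁻¹ = rootRefl a b :=
  inv_eq_of_mul_eq_one_left (rootRefl_mul_self h)

theorem rootRefl_neg_neg {a b : ℤ} (h : IsRootPair n a b) :
    rootRefl (-b) (-a) = rootRefl a b := by
  have h' : IsRootPair n (-b) (-a) := by unfold IsRootPair IsIndex at *; omega
  ext k
  rw [rootRefl_apply h', rootRefl_apply h]
  unfold IsRootPair IsIndex at h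
  grind

theorem coord_rootRefl {a b : ℤ} (h : IsRootPair n a b) (x : Fin n → ℝ) {k : ℤ}
    (hk : IsIndex n k) :
    coord x (rootRefl a b k) = coord x k - (x ⬝ᵥ root n a b) * coord (root n a b) k := by
  rw [coord_root hk, dotProduct_root, rootRefl_apply h]
  unfold IsRootPair IsIndex at *
  have ha := coord_neg_right x a
  have hb := coord_neg_right x b
  grind

/-! ### Simple reflections -/

/-- The signed index `a` in `α_i = e_b - e_a`, with `b = upperIdx i`. -/
def lowerIdx (i : ℤ) : ℤ := if i = 1 then -2 else i - 1

/-- The signed index `b` in `α_i = e_b - e_a`, with `a = lowerIdx i`. -/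
def upperIdx (i : ℤ) : ℤ := if i = 1 then 1 else i

theorem simpleRoot_eq_root (i : ℤ) : simpleRoot n i = root n (lowerIdx i) (upperIdx i) := by
  unfold simpleRoot lowerIdx upperIdx root
  split_ifs
  · rw [vec_neg]
    abel
  · rfl

theorem simpleRefl_eq_rootRefl (i : ℤ) : simpleRefl i = rootRefl (lowerIdx i) (upperIdx i) := by
  unfold simpleRefl lowerIdx upperIdx rootRefl
  split_ifs
  · rw [swap_comm, swap_comm (-1 : ℤ), neg_neg]
  · rfl

theorem lowerIdx_lt_upperIdx (i : ℤ) : lowerIdx i < upperIdx i := by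
  unfold lowerIdx upperIdx
  split_ifs <;> omega

theorem isRootPair_simple (hn : 2 ≤ n) {i : ℤ} (h₁ : 1 ≤ i) (h₂ : i ≤ n) :
    IsRootPair n (lowerIdx i) (upperIdx i) := by
  unfold lowerIdx upperIdx IsRootPair IsIndex
  split_ifs <;> omega

theorem simpleRefl_mul_self (hn : 2 ≤ n) {i : ℤ} (h₁ : 1 ≤ i) (h₂ : i ≤ n) :
    simpleRefl i * simpleRefl i = 1 := by
  rw [simpleRefl_eq_rootRefl, rootRefl_mul_self (isRootPair_simple hn h₁ h₂)]

theorem simpleRefl_inv (hn : 2 ≤ n) {i : ℤ} (h₁ : 1 ≤ i) (h₂ : i ≤ n) :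
    (simpleRefl i)⁻¹ = simpleRefl i :=
  inv_eq_of_mul_eq_one_left (simpleRefl_mul_self hn h₁ h₂)

-- A simple reflection permutes the positive roots other than its own simple root.
theorem simpleRefl_lt_simpleRefl_or (hn : 2 ≤ n) {i : ℤ} (h₁ : 1 ≤ i) (h₂ : i ≤ n) {a b : ℤ}
    (h : IsRootPair n a b) (hab : a < b) :
    simpleRefl i a < simpleRefl i b ∨ (a = lowerIdx i ∧ b = upperIdx i) ∨
      (a = -upperIdx i ∧ b = -lowerIdx i) := by
  rw [simpleRefl_eq_rootRefl]
  simp only [rootRefl_apply (isRootPair_simple hn h₁ h₂)]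
  unfold IsRootPair IsIndex at h
  unfold lowerIdx upperIdx
  grind

/-! ### The Weyl group and its action -/

theorem simpleRefl_mem_weylGroup {i : ℤ} (h₁ : 1 ≤ i) (h₂ : i ≤ n) : simpleRefl i ∈ weylGroup n :=
  Subgroup.subset_closure ⟨i, ⟨h₁, h₂⟩, rfl⟩

theorem weylGroup_induction (hn : 2 ≤ n) {p : Perm ℤ → Prop} (one : p 1)
    (simpleRefl_mul : ∀ (i : ℤ) (w : Perm ℤ), 1 ≤ i → i ≤ n → w ∈ weylGroup n → p w →
      p (simpleRefl i * w))
    {w : Perm ℤ} (hw : w ∈ weylGroup n) : p w := by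
  unfold weylGroup at hw
  induction hw using Subgroup.closure_induction_left with
  | one => exact one
  | mul_left x hx y hy ih =>
    obtain ⟨i, hi, rfl⟩ := hx
    exact simpleRefl_mul i y hi.1 hi.2 hy ih
  | inv_mul_cancel x hx y hy ih =>
    obtain ⟨i, hi, rfl⟩ := hx
    rw [simpleRefl_inv hn hi.1 hi.2]
    exact simpleRefl_mul i y hi.1 hi.2 hy ih

section Weyl

variable {w : Perm ℤ}

theorem weylGroup_apply_neg (hn : 2 ≤ n) (hw : w ∈ weylGroup n) (k : ℤ) : w (-k) = -w k := by
  refine weylGroup_induction (p := fun w => ∀ k, w (-k) = -w k) hn (fun _ => rfl) ?_ hw k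
  intro i w h₁ h₂ _ ih k
  rw [Perm.mul_apply, Perm.mul_apply, ih, simpleRefl_eq_rootRefl,
    rootRefl_apply_neg (isRootPair_simple hn h₁ h₂)]

theorem weylGroup_apply_of_not_isIndex (hn : 2 ≤ n) (hw : w ∈ weylGroup n) {k : ℤ}
    (hk : ¬ IsIndex n k) : w k = k := by
  refine weylGroup_induction (p := fun w => w k = k) hn rfl ?_ hw
  intro i w h₁ h₂ _ ih
  rw [Perm.mul_apply, ih, simpleRefl_eq_rootRefl,
    rootRefl_apply_of_not_isIndex (isRootPair_simple hn h₁ h₂) hk]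

theorem isIndex_weylGroup_apply (hn : 2 ≤ n) (hw : w ∈ weylGroup n) {k : ℤ} :
    IsIndex n (w k) ↔ IsIndex n k := by
  rw [← not_iff_not]
  constructor <;> intro hk
  · rwa [w.injective (weylGroup_apply_of_not_isIndex hn hw hk)] at hk
  · rwa [weylGroup_apply_of_not_isIndex hn hw hk]

theorem coord_vec_weylGroup (hn : 2 ≤ n) (hw : w ∈ weylGroup n) (k l : ℤ) :
    coord (vec n (w k)) l = coord (vec n k) (w⁻¹ l) := by
  by_cases hl : IsIndex n l
  · have eq_iff : w k = l ↔ k = w⁻¹ l := by rw [Perm.eq_inv_iff_eq]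
    have eq_neg_iff : w k = -l ↔ k = -w⁻¹ l := by
      rw [← weylGroup_apply_neg hn (inv_mem hw), Perm.eq_inv_iff_eq]
    rw [coord_vec _ hl, coord_vec _ ((isIndex_weylGroup_apply hn (inv_mem hw)).2 hl)]
    simp only [eq_iff, eq_neg_iff]
  · rw [coord_eq_zero _ hl, coord_eq_zero _ (mt (isIndex_weylGroup_apply hn (inv_mem hw)).1 hl)]

theorem act_eq_linearCombination (w : Perm ℤ) :
    act n w = Fintype.linearCombination ℝ fun k : Fin n => vec n (w ((k : ℤ) + 1)) :=
  rfl

theorem act_smul (w : Perm ℤ) (c : ℝ) (x : Fin n → ℝ) : act n w (c • x) = c • act n w x := by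
  rw [act_eq_linearCombination, map_smul]

theorem act_sub (w : Perm ℤ) (x y : Fin n → ℝ) : act n w (x - y) = act n w x - act n w y := by
  rw [act_eq_linearCombination, map_sub]

theorem act_sum {ι : Type*} (w : Perm ℤ) (s : Finset ι) (f : ι → Fin n → ℝ) :
    act n w (∑ i ∈ s, f i) = ∑ i ∈ s, act n w (f i) := by
  rw [act_eq_linearCombination, map_sum]

theorem coord_act (hn : 2 ≤ n) (hw : w ∈ weylGroup n) (x : Fin n → ℝ) (k : ℤ) :
    coord (act n w x) k = coord x (w⁻¹ k) := by
  conv_rhs => rw [← sum_smul_vec x]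
  simp only [act, coord_sum, coord_smul, coord_vec_weylGroup hn hw]

theorem coord_act_apply (hn : 2 ≤ n) (hw : w ∈ weylGroup n) (x : Fin n → ℝ) (k : ℤ) :
    coord (act n w x) (w k) = coord x k := by
  rw [coord_act hn hw, Perm.inv_def, symm_apply_apply]

theorem act_mul (hn : 2 ≤ n) {u : Perm ℤ} (hu : u ∈ weylGroup n) (hw : w ∈ weylGroup n)
    (x : Fin n → ℝ) : act n (u * w) x = act n u (act n w x) := by
  refine coord_ext fun k _ _ => ?_
  rw [coord_act hn (mul_mem hu hw), coord_act hn hu, coord_act hn hw, mul_inv_rev, Perm.mul_apply]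

theorem act_inv_act (hn : 2 ≤ n) (hw : w ∈ weylGroup n) (x : Fin n → ℝ) :
    act n w⁻¹ (act n w x) = x := by
  refine coord_ext fun k _ _ => ?_
  rw [coord_act hn (inv_mem hw), inv_inv, coord_act_apply hn hw]

theorem act_vec (hn : 2 ≤ n) (hw : w ∈ weylGroup n) (k : ℤ) : act n w (vec n k) = vec n (w k) :=
  coord_ext fun l _ _ => by rw [coord_act hn hw, coord_vec_weylGroup hn hw]

theorem act_dotProduct (hn : 2 ≤ n) (hw : w ∈ weylGroup n) (x y : Fin n → ℝ) :
    act n w x ⬝ᵥ y = x ⬝ᵥ act n w⁻¹ y := by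
  simp only [act, sum_dotProduct, smul_dotProduct]
  refine Finset.sum_congr rfl fun j _ => ?_
  rw [dotProduct_comm, ← coord, ← act, ← coord_fin (act n w⁻¹ y), coord_act hn (inv_mem hw),
    inv_inv, smul_eq_mul]

theorem act_dotProduct_act (hn : 2 ≤ n) (hw : w ∈ weylGroup n) (x y : Fin n → ℝ) :
    act n w x ⬝ᵥ act n w y = x ⬝ᵥ y := by
  rw [act_dotProduct hn hw, act_inv_act hn hw]

theorem IsRootPair.weylGroup (hn : 2 ≤ n) (hw : w ∈ weylGroup n) {a b : ℤ}
    (h : IsRootPair n a b) : IsRootPair n (w a) (w b) := by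
  refine ⟨(isIndex_weylGroup_apply hn hw).2 h.1, (isIndex_weylGroup_apply hn hw).2 h.2.1,
    w.injective.ne h.2.2.1, ?_⟩
  rw [← weylGroup_apply_neg hn hw]
  exact w.injective.ne h.2.2.2

theorem act_root (hn : 2 ≤ n) (hw : w ∈ weylGroup n) (a b : ℤ) :
    act n w (root n a b) = root n (w a) (w b) := by
  simp only [root, act_sub, act_vec hn hw]

theorem act_rootRefl (hn : 2 ≤ n) {a b : ℤ} (h : IsRootPair n a b)
    (hw : rootRefl a b ∈ weylGroup n) (x : Fin n → ℝ) :
    act n (rootRefl a b) x = x - (x ⬝ᵥ root n a b) • root n a b := by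
  refine coord_ext fun k h₁ h₂ => ?_
  rw [coord_act hn hw, rootRefl_inv h, coord_rootRefl h x ⟨by omega, by omega, h₂⟩, coord_sub,
    coord_smul]

theorem act_simpleRefl (hn : 2 ≤ n) {i : ℤ} (h₁ : 1 ≤ i) (h₂ : i ≤ n) (x : Fin n → ℝ) :
    act n (simpleRefl i) x = x - (x ⬝ᵥ simpleRoot n i) • simpleRoot n i := by
  have hmem := simpleRefl_mem_weylGroup h₁ h₂
  rw [simpleRefl_eq_rootRefl] at hmem
  rw [simpleRefl_eq_rootRefl, simpleRoot_eq_root, act_rootRefl hn (isRootPair_simple hn h₁ h₂) hmem]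

theorem conj_rootRefl (hn : 2 ≤ n) (hw : w ∈ weylGroup n) (a b : ℤ) :
    w * rootRefl a b * w⁻¹ = rootRefl (w a) (w b) := by
  simp only [rootRefl, ← weylGroup_apply_neg hn hw]
  rw [swap_apply_apply, swap_apply_apply]
  group

theorem IsReflection.exists_rootRefl (hn : 2 ≤ n) {t : Perm ℤ} (ht : IsReflection n t) :
    t ∈ weylGroup n ∧ ∃ a b, IsRootPair n a b ∧ a < b ∧ t = rootRefl a b := by
  obtain ⟨w, hw, i, h₁, h₂, rfl⟩ := ht
  refine ⟨mul_mem (mul_mem hw (simpleRefl_mem_weylGroup h₁ h₂)) (inv_mem hw), ?_⟩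
  have hpair := (isRootPair_simple hn h₁ h₂).weylGroup hn hw
  rw [simpleRefl_eq_rootRefl, conj_rootRefl hn hw]
  rcases lt_or_gt_of_ne hpair.2.2.1 with hlt | hlt
  · exact ⟨_, _, hpair, hlt, rfl⟩
  · exact ⟨_, _, hpair.symm, hlt, (rootRefl_comm _ _).symm⟩

/-! ### Length -/

theorem exists_reduced_word (hn : 2 ≤ n) (hw : w ∈ weylGroup n) :
    ∃ l : List ℤ, l.length = length n w ∧ (∀ i ∈ l, 1 ≤ i ∧ i ≤ n) ∧
      (l.map simpleRefl).prod = w := by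
  refine Nat.sInf_mem (s := {k | ∃ l : List ℤ, l.length = k ∧ (∀ i ∈ l, 1 ≤ i ∧ i ≤ n) ∧
    (l.map simpleRefl).prod = w}) (weylGroup_induction (p := fun w => {k | ∃ l : List ℤ,
      l.length = k ∧ (∀ i ∈ l, 1 ≤ i ∧ i ≤ n) ∧ (l.map simpleRefl).prod = w}.Nonempty) hn
    ⟨0, [], rfl, by simp, rfl⟩ ?_ hw)
  rintro i w h₁ h₂ - ⟨_, l, rfl, hl, rfl⟩
  exact ⟨_, i :: l, rfl, List.forall_mem_cons.2 ⟨⟨h₁, h₂⟩, hl⟩, List.prod_cons⟩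

theorem length_prod_le {l : List ℤ} (hl : ∀ i ∈ l, 1 ≤ i ∧ i ≤ n) :
    length n (l.map simpleRefl).prod ≤ l.length :=
  Nat.sInf_le ⟨l, rfl, hl, rfl⟩

theorem exchange (hn : 2 ≤ n) (l : List ℤ) (hl : ∀ i ∈ l, 1 ≤ i ∧ i ≤ n) {a b : ℤ}
    (h : IsRootPair n a b) (hab : a < b)
    (hinv : (l.map simpleRefl).prod⁻¹ b < (l.map simpleRefl).prod⁻¹ a) :
    ∃ l' : List ℤ, l'.length + 1 = l.length ∧ (∀ i ∈ l', 1 ≤ i ∧ i ≤ n) ∧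
      (l'.map simpleRefl).prod = rootRefl a b * (l.map simpleRefl).prod := by
  induction l generalizing a b with
  | nil => exact absurd hinv hab.not_gt
  | cons i l ih =>
    obtain ⟨⟨h₁, h₂⟩, hl⟩ := List.forall_mem_cons.1 hl
    have hmem := simpleRefl_mem_weylGroup h₁ h₂
    simp only [List.map_cons, List.prod_cons, mul_inv_rev, simpleRefl_inv hn h₁ h₂,
      Perm.mul_apply] at hinv ⊢
    rcases simpleRefl_lt_simpleRefl_or hn h₁ h₂ h hab with hlt | hsimple
    · obtain ⟨l', hlen, hl', hprod⟩ := ih hl (h.weylGroup hn hmem) hlt hinv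
      refine ⟨i :: l', by rw [List.length_cons, List.length_cons, hlen],
        List.forall_mem_cons.2 ⟨⟨h₁, h₂⟩, hl'⟩, ?_⟩
      rw [List.map_cons, List.prod_cons, hprod, ← conj_rootRefl hn hmem, simpleRefl_inv hn h₁ h₂]
      simp only [mul_assoc]
      rw [← mul_assoc (simpleRefl i) (simpleRefl i), simpleRefl_mul_self hn h₁ h₂, one_mul]
    · have hrefl : rootRefl a b = simpleRefl i := by
        rw [simpleRefl_eq_rootRefl]
        rcases hsimple with ⟨rfl, rfl⟩ | ⟨rfl, rfl⟩
        · rfl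
        · exact rootRefl_neg_neg (isRootPair_simple hn h₁ h₂)
      refine ⟨l, rfl, hl, ?_⟩
      rw [hrefl, ← mul_assoc, simpleRefl_mul_self hn h₁ h₂, one_mul]

theorem length_rootRefl_mul_lt (hn : 2 ≤ n) (hw : w ∈ weylGroup n) {a b : ℤ}
    (h : IsRootPair n a b) (hab : a < b) (hinv : w⁻¹ b < w⁻¹ a) :
    length n (rootRefl a b * w) < length n w := by
  obtain ⟨l, hlen, hl, rfl⟩ := exists_reduced_word hn hw
  obtain ⟨l', hlen', hl', hprod⟩ := exchange hn l hl h hab hinv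
  have := length_prod_le hl'
  rw [hprod] at this
  omega

theorem length_lt_simpleRefl_mul (hn : 2 ≤ n) (hw : w ∈ weylGroup n) {i : ℤ}
    (h₁ : 1 ≤ i) (h₂ : i ≤ n) (h : w⁻¹ (lowerIdx i) < w⁻¹ (upperIdx i)) :
    length n w < length n (simpleRefl i * w) := by
  have hpair := isRootPair_simple hn h₁ h₂
  have hlower : simpleRefl i (lowerIdx i) = upperIdx i := by
    rw [simpleRefl_eq_rootRefl, rootRefl_apply hpair, if_pos rfl]
  have hupper : simpleRefl i (upperIdx i) = lowerIdx i := by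
    rw [simpleRefl_eq_rootRefl, rootRefl_apply hpair, if_neg hpair.2.2.1.symm, if_pos rfl]
  have := length_rootRefl_mul_lt hn (mul_mem (simpleRefl_mem_weylGroup h₁ h₂) hw) hpair
    (lowerIdx_lt_upperIdx i) (by
      rwa [mul_inv_rev, simpleRefl_inv hn h₁ h₂, Perm.mul_apply, Perm.mul_apply, hlower, hupper])
  rwa [← simpleRefl_eq_rootRefl, ← mul_assoc, simpleRefl_mul_self hn h₁ h₂, one_mul] at this

end Weyl

/-! ### Fundamental weights and nonnegativity -/

theorem coord_fundWeight (r : ℤ) {k : ℤ} (h₁ : 1 ≤ k) (h₂ : k ≤ n) :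
    coord (fundWeight n r) k =
      if r = 1 then 1 / 2 else if r = 2 then (if k = 1 then -1 / 2 else 1 / 2)
      else if r ≤ k then 1 else 0 := by
  have toNat_eq_zero : (k - 1).toNat = 0 ↔ k = 1 := by omega
  have toNat_add_one : (((k - 1).toNat : ℕ) : ℤ) + 1 = k := by omega
  simp only [coord_apply _ h₁ h₂, fundWeight, toNat_eq_zero, toNat_add_one]

theorem fundWeight_dotProduct_simpleRoot (hn : 2 ≤ n) {i j : ℤ} (hi : 1 ≤ i) (h₁ : 1 ≤ j)
    (h₂ : j ≤ n) : fundWeight n i ⬝ᵥ simpleRoot n j = if i = j then 1 else 0 := by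
  rw [← fundWeight_pairing hn hi h₁ h₂, corootPairing, simpleRoot_eq_root,
    root_dotProduct_self (isRootPair_simple hn h₁ h₂), mul_div_cancel_left₀ _ two_ne_zero]

/-- The sum of the coordinates of `x` from the `k`-th on, which for `k ≥ 3` is the coefficient of
`α_k` in `x`. -/
noncomputable def suffixSum (x : Fin n → ℝ) (k : ℤ) : ℝ := ∑ j ∈ Finset.Icc k (n : ℤ), coord x j

theorem suffixSum_eq_add (x : Fin n → ℝ) {k : ℤ} (hk : k ≤ n) :
    suffixSum x k = coord x k + suffixSum x (k + 1) := by
  unfold suffixSum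
  rw [← Finset.insert_Icc_add_one_left_eq_Icc hk, Finset.sum_insert (by simp)]

theorem suffixSum_of_lt (x : Fin n → ℝ) {k : ℤ} (hk : n < k) : suffixSum x k = 0 := by
  rw [suffixSum, Finset.Icc_eq_empty (by omega), Finset.sum_empty]

theorem dotProduct_fundWeight_of_three_le (x : Fin n → ℝ) {k : ℤ} (hk : 3 ≤ k) :
    x ⬝ᵥ fundWeight n k = suffixSum x k := by
  rw [dotProduct_eq_sum_coord, suffixSum]
  symm
  refine Finset.sum_subset_zero_on_sdiff (Finset.Icc_subset_Icc (by omega) le_rfl) ?_ ?_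
  · intro j hj
    simp only [Finset.mem_sdiff, Finset.mem_Icc] at hj
    rw [coord_fundWeight _ (by omega) (by omega)]
    grind
  · intro j hj
    rw [Finset.mem_Icc] at hj
    rw [coord_fundWeight _ (by omega) hj.2, if_neg (by omega), if_neg (by omega), if_pos hj.1,
      mul_one]

theorem two_mul_dotProduct_fundWeight_one (hn : 2 ≤ n) (x : Fin n → ℝ) :
    2 * (x ⬝ᵥ fundWeight n 1) = suffixSum x 2 + coord x 1 := by
  have half_sum : x ⬝ᵥ fundWeight n 1 = 1 / 2 * suffixSum x 1 := by
    rw [dotProduct_eq_sum_coord, suffixSum, Finset.mul_sum]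
    refine Finset.sum_congr rfl fun j hj => ?_
    rw [Finset.mem_Icc] at hj
    rw [coord_fundWeight _ hj.1 hj.2, if_pos rfl, mul_comm]
  rw [half_sum, suffixSum_eq_add x (k := 1) (by omega), one_add_one_eq_two]
  ring

theorem two_mul_dotProduct_fundWeight_two (hn : 2 ≤ n) (x : Fin n → ℝ) :
    2 * (x ⬝ᵥ fundWeight n 2) = suffixSum x 2 - coord x 1 := by
  have hsum : ∑ j ∈ Finset.Icc 2 (n : ℤ), coord x j * coord (fundWeight n 2) j =
      1 / 2 * suffixSum x 2 := by
    rw [suffixSum, Finset.mul_sum]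
    refine Finset.sum_congr rfl fun j hj => ?_
    rw [Finset.mem_Icc] at hj
    rw [coord_fundWeight _ (by omega) hj.2, if_neg (by omega), if_pos rfl, if_neg (by omega),
      mul_comm]
  rw [dotProduct_eq_sum_coord, ← Finset.insert_Icc_add_one_left_eq_Icc (by omega : (1 : ℤ) ≤ n),
    Finset.sum_insert (by simp), one_add_one_eq_two, hsum, coord_fundWeight _ le_rfl (by omega),
    if_neg (by omega), if_pos rfl, if_pos rfl]
  ring

theorem eq_zero_of_forall_dotProduct_fundWeight (hn : 2 ≤ n) {x : Fin n → ℝ}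
    (h : ∀ k : ℤ, 1 ≤ k → k ≤ n → x ⬝ᵥ fundWeight n k = 0) : x = 0 := by
  have hsuffix : ∀ k : ℤ, 3 ≤ k → suffixSum x k = 0 := by
    intro k hk
    rcases le_or_gt k n with hkn | hkn
    · rw [← dotProduct_fundWeight_of_three_le x hk, h k (by omega) hkn]
    · exact suffixSum_of_lt x hkn
  have hone := two_mul_dotProduct_fundWeight_one hn x
  have htwo := two_mul_dotProduct_fundWeight_two hn x
  rw [h 1 le_rfl (by omega)] at hone
  rw [h 2 (by omega) (by omega)] at htwo
  refine coord_ext fun k h₁ h₂ => ?_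
  rw [coord, coord, zero_dotProduct, ← coord]
  have hk := suffixSum_eq_add x h₂
  rcases (show k = 1 ∨ k = 2 ∨ 3 ≤ k by omega) with rfl | rfl | h₃
  · linarith
  · rw [hsuffix (2 + 1) (by norm_num)] at hk
    linarith
  · rw [hsuffix k h₃, hsuffix (k + 1) (by omega)] at hk
    linarith

theorem eq_sum_dotProduct_fundWeight_smul (hn : 2 ≤ n) (x : Fin n → ℝ) :
    x = ∑ i ∈ Finset.Icc (1 : ℤ) n, (x ⬝ᵥ fundWeight n i) • simpleRoot n i := by
  refine sub_eq_zero.1 (eq_zero_of_forall_dotProduct_fundWeight hn fun k h₁ h₂ => ?_)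
  have pairing : ∀ i ∈ Finset.Icc (1 : ℤ) n,
      ((x ⬝ᵥ fundWeight n i) • simpleRoot n i) ⬝ᵥ fundWeight n k =
        if k = i then x ⬝ᵥ fundWeight n i else 0 := by
    intro i hi
    rw [Finset.mem_Icc] at hi
    rw [smul_dotProduct, dotProduct_comm (simpleRoot n i),
      fundWeight_dotProduct_simpleRoot hn h₁ hi.1 hi.2, smul_eq_mul, mul_ite, mul_one, mul_zero]
  rw [sub_dotProduct, sum_dotProduct, Finset.sum_congr rfl pairing, Finset.sum_ite_eq,
    if_pos (Finset.mem_Icc.2 ⟨h₁, h₂⟩), sub_self]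

theorem nonnegWeight_iff_dotProduct_fundWeight (hn : 2 ≤ n) {x : Fin n → ℝ} :
    NonnegWeight n x ↔ ∀ k : ℤ, 1 ≤ k → k ≤ n → 0 ≤ x ⬝ᵥ fundWeight n k := by
  constructor
  · rintro ⟨c, hc, rfl⟩ k h₁ _
    rw [sum_dotProduct]
    refine Finset.sum_nonneg fun j hj => ?_
    rw [Finset.mem_Icc] at hj
    rw [smul_dotProduct, dotProduct_comm, fundWeight_dotProduct_simpleRoot hn h₁ hj.1 hj.2]
    exact mul_nonneg (hc j) (by split_ifs <;> norm_num)
  · intro h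
    refine ⟨fun k => max 0 (x ⬝ᵥ fundWeight n k), fun _ => le_max_left _ _, ?_⟩
    conv_lhs => rw [eq_sum_dotProduct_fundWeight_smul hn x]
    refine Finset.sum_congr rfl fun k hk => ?_
    rw [Finset.mem_Icc] at hk
    exact congrArg (· • simpleRoot n k) (max_eq_right (h k hk.1 hk.2)).symm

theorem nonnegWeight_zero : NonnegWeight n (0 : Fin n → ℝ) :=
  ⟨0, fun _ => le_rfl, by simp⟩

theorem NonnegWeight.add {x y : Fin n → ℝ} (hx : NonnegWeight n x) (hy : NonnegWeight n y) :
    NonnegWeight n (x + y) := by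
  obtain ⟨c, hc, rfl⟩ := hx
  obtain ⟨d, hd, rfl⟩ := hy
  exact ⟨c + d, fun i => add_nonneg (hc i) (hd i), by simp [add_smul, Finset.sum_add_distrib]⟩

theorem NonnegWeight.smul {x : Fin n → ℝ} (hx : NonnegWeight n x) {c : ℝ} (hc : 0 ≤ c) :
    NonnegWeight n (c • x) := by
  obtain ⟨d, hd, rfl⟩ := hx
  exact ⟨c • d, fun i => mul_nonneg hc (hd i), by simp [Finset.smul_sum, smul_smul]⟩

theorem nonnegWeight_smul_iff {x : Fin n → ℝ} {c : ℝ} (hc : 0 < c) :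
    NonnegWeight n (c • x) ↔ NonnegWeight n x := by
  refine ⟨fun h => ?_, fun h => h.smul hc.le⟩
  simpa only [inv_smul_smul₀ hc.ne'] using h.smul (inv_nonneg.2 hc.le)

theorem nonnegWeight_sum {ι : Type*} {s : Finset ι} {f : ι → Fin n → ℝ}
    (h : ∀ i ∈ s, NonnegWeight n (f i)) : NonnegWeight n (∑ i ∈ s, f i) :=
  Finset.sum_induction f (NonnegWeight n) (fun _ _ => NonnegWeight.add) nonnegWeight_zero h

theorem fundWeight_dotProduct_root_nonneg (r : ℤ) {a b : ℤ} (h : IsRootPair n a b)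
    (hab : a < b) : 0 ≤ fundWeight n r ⬝ᵥ root n a b := by
  obtain ⟨i, j, h₁, hij, h₂, hroot⟩ := mem_posRoots_iff.2 ⟨a, b, h, hab, rfl⟩
  have hi := coord_fundWeight r h₁ (by omega : i ≤ n)
  have hj := coord_fundWeight r (by omega : 1 ≤ j) h₂
  rcases hroot with hroot | hroot <;> rw [hroot]
  · rw [dotProduct_sub, ← coord, ← coord, hi, hj]
    split_ifs <;> first | omega | norm_num
  · rw [dotProduct_add, ← coord, ← coord, hi, hj]
    split_ifs <;> first | omega | norm_num

theorem nonnegWeight_root (hn : 2 ≤ n) {a b : ℤ} (h : IsRootPair n a b) (hab : a < b) :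
    NonnegWeight n (root n a b) :=
  (nonnegWeight_iff_dotProduct_fundWeight hn).2 fun k _ _ => by
    rw [dotProduct_comm]
    exact fundWeight_dotProduct_root_nonneg k h hab

theorem not_nonnegWeight_neg_root (hn : 2 ≤ n) {a b : ℤ} (h : IsRootPair n a b) (hab : a < b) :
    ¬ NonnegWeight n (-root n a b) := by
  intro hneg
  have root_eq_zero : root n a b = 0 := by
    refine eq_zero_of_forall_dotProduct_fundWeight hn fun k h₁ h₂ => ?_
    have hpos := fundWeight_dotProduct_root_nonneg k h hab
    have hnonpos := (nonnegWeight_iff_dotProduct_fundWeight hn).1 hneg k h₁ h₂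
    rw [neg_dotProduct, dotProduct_comm] at hnonpos
    rw [dotProduct_comm]
    linarith
  have := root_dotProduct_self h
  rw [root_eq_zero, zero_dotProduct] at this
  norm_num at this

/-! ### Minimal coset representatives -/

theorem mem_minReps_iff (hn : 2 ≤ n) {r : ℤ} {v : Perm ℤ} : v ∈ minReps n r ↔ v ∈ weylGroup n ∧
    ∀ j : ℤ, 1 ≤ j → j ≤ n → j ≠ r → v (lowerIdx j) < v (upperIdx j) := by
  refine and_congr_right fun hv => forall_congr' fun j => forall_congr' fun h₁ =>
    forall_congr' fun h₂ => forall_congr' fun _ => ?_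
  rw [simpleRoot_eq_root, act_root hn hv,
    root_mem_posRoots_iff ((isRootPair_simple hn h₁ h₂).weylGroup hn hv)]

theorem act_dotProduct_root (hn : 2 ≤ n) {w : Perm ℤ} (hw : w ∈ weylGroup n) (x : Fin n → ℝ)
    (a b : ℤ) : act n w x ⬝ᵥ root n a b = x ⬝ᵥ root n (w⁻¹ a) (w⁻¹ b) := by
  rw [act_dotProduct hn hw, act_root hn (inv_mem hw)]

theorem act_fundWeight_dotProduct_root_nonneg (hn : 2 ≤ n) (r : ℤ) {w : Perm ℤ}
    (hw : w ∈ weylGroup n) {a b : ℤ} (h : IsRootPair n a b) (hlt : w⁻¹ a < w⁻¹ b) :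
    0 ≤ act n w (fundWeight n r) ⬝ᵥ root n a b := by
  rw [act_dotProduct_root hn hw]
  exact fundWeight_dotProduct_root_nonneg r (h.weylGroup hn (inv_mem hw)) hlt

theorem inv_apply_lt_of_act_fundWeight_dotProduct_root_pos (hn : 2 ≤ n) (r : ℤ) {w : Perm ℤ}
    (hw : w ∈ weylGroup n) {a b : ℤ} (h : IsRootPair n a b)
    (hpos : 0 < act n w (fundWeight n r) ⬝ᵥ root n a b) : w⁻¹ a < w⁻¹ b := by
  by_contra hle
  have hlt := lt_of_le_of_ne (not_lt.1 hle) (w⁻¹.injective.ne h.symm.2.2.1)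
  have := act_fundWeight_dotProduct_root_nonneg hn r hw h.symm hlt
  rw [root_swap, dotProduct_neg] at this
  linarith

theorem exists_simple_descent (hn : 2 ≤ n) {w : Perm ℤ} (hw : w ∈ weylGroup n) (hne : w ≠ 1) :
    ∃ i : ℤ, 1 ≤ i ∧ i ≤ n ∧ w (upperIdx i) < w (lowerIdx i) := by
  obtain ⟨l, hlen, hl, hprod⟩ := exists_reduced_word hn (inv_mem hw)
  cases l with
  | nil => exact absurd (inv_eq_one.1 hprod.symm) hne
  | cons i l =>
    obtain ⟨⟨h₁, h₂⟩, hl⟩ := List.forall_mem_cons.1 hl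
    refine ⟨i, h₁, h₂, ?_⟩
    by_contra hle
    have hlt := lt_of_le_of_ne (not_lt.1 hle)
      (w.injective.ne (isRootPair_simple hn h₁ h₂).2.2.1)
    have hlonger := length_lt_simpleRefl_mul hn (inv_mem hw) h₁ h₂ (by rwa [inv_inv])
    have hshorter := length_prod_le hl
    rw [List.map_cons, List.prod_cons] at hprod
    rw [← hlen, ← hprod, ← mul_assoc, simpleRefl_mul_self hn h₁ h₂, one_mul,
      List.length_cons] at hlonger
    omega

theorem nonnegWeight_act_root (hn : 2 ≤ n) {r : ℤ} {v : Perm ℤ} (hv : v ∈ minReps n r) {a b : ℤ}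
    (h : IsRootPair n a b) (hab : a < b) (horth : fundWeight n r ⬝ᵥ root n a b = 0) :
    NonnegWeight n (act n v (root n a b)) := by
  rw [eq_sum_dotProduct_fundWeight_smul hn (root n a b), act_sum]
  refine nonnegWeight_sum fun k hk => ?_
  rw [Finset.mem_Icc] at hk
  rw [act_smul, dotProduct_comm]
  by_cases hkr : k = r
  · rw [hkr, horth, zero_smul]
    exact nonnegWeight_zero
  · have hlt := ((mem_minReps_iff hn).1 hv).2 k hk.1 hk.2 hkr
    rw [simpleRoot_eq_root, act_root hn hv.1]
    exact (nonnegWeight_root hn ((isRootPair_simple hn hk.1 hk.2).weylGroup hn hv.1) hlt).smul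
      (fundWeight_dotProduct_root_nonneg k h hab)

theorem minReps_unique (hn : 2 ≤ n) {r : ℤ} (hr : 1 ≤ r) {u v : Perm ℤ}
    (hu : u ∈ minReps n r) (hv : v ∈ minReps n r)
    (h : act n u (fundWeight n r) = act n v (fundWeight n r)) : u = v := by
  have hmem : v⁻¹ * u ∈ weylGroup n := mul_mem (inv_mem hv.1) hu.1
  by_contra hne
  -- `v⁻¹ u ≠ 1` fixes `ω_r` and makes some simple root `α_i` negative. As `ω_r` is dominant, `α_i`
  -- is orthogonal to `ω_r`, so `i ≠ r` and `u(α_i)` is positive; it is also negative, being the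
  -- image under `v` of a negative root orthogonal to `ω_r`.
  obtain ⟨i, h₁, h₂, hdesc⟩ := exists_simple_descent hn hmem
    fun he => hne (inv_mul_eq_one.1 he).symm
  have hfix : act n (v⁻¹ * u) (fundWeight n r) = fundWeight n r := by
    rw [act_mul hn (inv_mem hv.1) hu.1, h, act_inv_act hn hv.1]
  have hpair := isRootPair_simple hn h₁ h₂
  have hpair' := (hpair.weylGroup hn hmem).symm
  have hdot : fundWeight n r ⬝ᵥ simpleRoot n i =
      -(fundWeight n r ⬝ᵥ root n ((v⁻¹ * u) (upperIdx i)) ((v⁻¹ * u) (lowerIdx i))) := by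
    rw [← act_dotProduct_act hn hmem, hfix, simpleRoot_eq_root, act_root hn hmem, root_swap,
      dotProduct_neg]
  have hnonneg := fundWeight_dotProduct_root_nonneg r hpair' hdesc
  rw [fundWeight_dotProduct_simpleRoot hn hr h₁ h₂] at hdot
  split_ifs at hdot with hri
  · linarith
  · have hneg := nonnegWeight_act_root hn hv hpair' hdesc (by linarith)
    have hpos := ((mem_minReps_iff hn).1 hu).2 i h₁ h₂ (Ne.symm hri)
    rw [act_root hn hv.1, ← Perm.mul_apply, ← Perm.mul_apply, mul_inv_cancel_left,
      root_swap] at hneg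
    exact not_nonnegWeight_neg_root hn (hpair.weylGroup hn hu.1) hpos hneg

theorem exists_mem_minReps (hn : 2 ≤ n) {r : ℤ} (hr : 1 ≤ r) {w : Perm ℤ}
    (hw : w ∈ weylGroup n) :
    ∃ v ∈ minReps n r, act n v (fundWeight n r) = act n w (fundWeight n r) := by
  induction hlen : length n w using Nat.strong_induction_on generalizing w with
  | _ N ih =>
    by_cases hmin : w ∈ minReps n r
    · exact ⟨w, hmin, rfl⟩
    rw [mem_minReps_iff hn] at hmin
    push Not at hmin
    obtain ⟨j, h₁, h₂, hjr, hle⟩ := hmin hw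
    have hmem := simpleRefl_mem_weylGroup h₁ h₂
    have hpair := ((isRootPair_simple hn h₁ h₂).weylGroup hn hw).symm
    have hshorter := length_rootRefl_mul_lt hn hw hpair (lt_of_le_of_ne hle hpair.2.2.1)
      (by simpa using lowerIdx_lt_upperIdx j)
    rw [rootRefl_comm, ← conj_rootRefl hn hw, ← simpleRefl_eq_rootRefl, inv_mul_cancel_right,
      hlen] at hshorter
    obtain ⟨v, hv, hact⟩ := ih _ hshorter (mul_mem hw hmem) rfl
    refine ⟨v, hv, ?_⟩
    rw [hact, act_mul hn hw hmem, act_simpleRefl hn h₁ h₂,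
      fundWeight_dotProduct_simpleRoot hn hr h₁ h₂, if_neg (Ne.symm hjr), zero_smul, sub_zero]

/-! ### Maximality -/

theorem exists_root_of_length_lt (hn : 2 ≤ n) (r : ℤ) {v t : Perm ℤ} (hv : v ∈ weylGroup n)
    (ht : IsReflection n t) (hlt : length n v < length n (t * v)) :
    ∃ a b, IsRootPair n a b ∧ a < b ∧ 0 ≤ act n v (fundWeight n r) ⬝ᵥ root n a b ∧
      act n (t * v) (fundWeight n r) = act n v (fundWeight n r) -
        (act n v (fundWeight n r) ⬝ᵥ root n a b) • root n a b := by
  obtain ⟨hmem, a, b, h, hab, rfl⟩ := ht.exists_rootRefl hn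
  refine ⟨a, b, h, hab, ?_, by rw [act_mul hn hmem hv, act_rootRefl hn h hmem]⟩
  refine act_fundWeight_dotProduct_root_nonneg hn r hv h ?_
  by_contra hle
  exact hlt.not_gt (length_rootRefl_mul_lt hn hv h hab
    (lt_of_le_of_ne (not_lt.1 hle) (v⁻¹.injective.ne h.symm.2.2.1)))

theorem nonnegWeight_sub_of_bruhatLE (hn : 2 ≤ n) (r : ℤ) {v u : Perm ℤ} (h : BruhatLE n v u) :
    NonnegWeight n (act n v (fundWeight n r) - act n u (fundWeight n r)) := by
  induction h using Relation.ReflTransGen.head_induction_on with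
  | refl =>
    rw [sub_self]
    exact nonnegWeight_zero
  | head hstep _ ih =>
    obtain ⟨hv, t, ht, rfl, hlt⟩ := hstep
    obtain ⟨a, b, h, hab, hnonneg, hact⟩ := exists_root_of_length_lt hn r hv ht hlt
    rw [hact] at ih
    convert ((nonnegWeight_root hn h hab).smul hnonneg).add ih using 1
    abel

/-- `x ≥ 0`, and no reflection in a positive root `β` with `(x, β) > 0` sends `x` to an
element `≥ 0`. For `x = v(ω_r)` this is sufficient for the maximality of `v`. -/
def IsReflMaximal (n : ℕ) (x : Fin n → ℝ) : Prop :=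
  NonnegWeight n x ∧ ∀ a b, IsRootPair n a b → a < b → 0 < x ⬝ᵥ root n a b →
    ¬ NonnegWeight n (x - (x ⬝ᵥ root n a b) • root n a b)

/-- `x ≥ 0`, and no reflection in a simple root `α` with `(x, α) > 0` sends `x` to an
element `≥ 0`. For `x = v(ω_r)` this is necessary for the maximality of `v`. -/
def IsSimpleMaximal (n : ℕ) (x : Fin n → ℝ) : Prop :=
  NonnegWeight n x ∧ ∀ i : ℤ, 1 ≤ i → i ≤ n → 0 < x ⬝ᵥ simpleRoot n i →
    ¬ NonnegWeight n (x - (x ⬝ᵥ simpleRoot n i) • simpleRoot n i)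

theorem IsReflMaximal.of_smul {x : Fin n → ℝ} {c : ℝ} (hc : 0 < c)
    (h : IsReflMaximal n (c • x)) : IsReflMaximal n x := by
  refine ⟨(nonnegWeight_smul_iff hc).1 h.1, fun a b hpair hab hpos hnonneg =>
    h.2 a b hpair hab ?_ ?_⟩
  · rw [smul_dotProduct]
    exact mul_pos hc hpos
  · rwa [smul_dotProduct, smul_assoc, ← smul_sub, nonnegWeight_smul_iff hc]

theorem IsSimpleMaximal.smul {x : Fin n → ℝ} {c : ℝ} (hc : 0 < c) (h : IsSimpleMaximal n x) :
    IsSimpleMaximal n (c • x) := by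
  refine ⟨(nonnegWeight_smul_iff hc).2 h.1, fun i h₁ h₂ hpos hnonneg => h.2 i h₁ h₂ ?_ ?_⟩
  · rw [smul_dotProduct] at hpos
    exact (mul_pos_iff_of_pos_left hc).1 hpos
  · rwa [smul_dotProduct, smul_assoc, ← smul_sub, nonnegWeight_smul_iff hc] at hnonneg

theorem mem_maximalSet_of_isReflMaximal (hn : 2 ≤ n) {r : ℤ} (hr : 1 ≤ r) {v : Perm ℤ}
    (hv : v ∈ minReps n r) (h : IsReflMaximal n (act n v (fundWeight n r))) :
    v ∈ maximalSet n r := by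
  refine ⟨hv, h.1, fun u hu hnonneg hle => minReps_unique hn hr hu hv ?_⟩
  clear hv
  -- Weights decrease along the Bruhat order, so the first step of a chain from `v` to `u` that
  -- changes the weight would already lead to a weight `≥ u(ω_r) ≥ 0`.
  induction hle using Relation.ReflTransGen.head_induction_on with
  | refl => rfl
  | head hstep hrest ih =>
    obtain ⟨hv, t, ht, rfl, hlt⟩ := hstep
    obtain ⟨a, b, hpair, hab, hdot, hact⟩ := exists_root_of_length_lt hn r hv ht hlt
    rcases hdot.eq_or_lt with hzero | hpos
    · rw [← hzero, zero_smul, sub_zero] at hact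
      rw [ih (hact ▸ h), hact]
    · refine absurd ?_ (h.2 a b hpair hab hpos)
      rw [← hact]
      simpa only [sub_add_cancel] using (nonnegWeight_sub_of_bruhatLE hn r hrest).add hnonneg

theorem simpleRefl_mul_mem_minReps (hn : 2 ≤ n) {r : ℤ} (hr : 1 ≤ r) {v : Perm ℤ}
    (hv : v ∈ minReps n r) {i : ℤ} (h₁ : 1 ≤ i) (h₂ : i ≤ n)
    (hpos : 0 < act n v (fundWeight n r) ⬝ᵥ simpleRoot n i) :
    simpleRefl i * v ∈ minReps n r := by
  refine (mem_minReps_iff hn).2 ⟨mul_mem (simpleRefl_mem_weylGroup h₁ h₂) hv.1,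
    fun j hj₁ hj₂ hjr => ?_⟩
  have hlt := ((mem_minReps_iff hn).1 hv).2 j hj₁ hj₂ hjr
  rw [Perm.mul_apply, Perm.mul_apply]
  refine (simpleRefl_lt_simpleRefl_or hn h₁ h₂
    ((isRootPair_simple hn hj₁ hj₂).weylGroup hn hv.1) hlt).resolve_right fun hsimple => ?_
  have hact : act n v (simpleRoot n j) = simpleRoot n i := by
    rw [simpleRoot_eq_root, simpleRoot_eq_root, act_root hn hv.1]
    rcases hsimple with ⟨hlower, hupper⟩ | ⟨hlower, hupper⟩
    · rw [hlower, hupper]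
    · rw [hlower, hupper, root_neg_neg]
  rw [← hact, act_dotProduct_act hn hv.1, fundWeight_dotProduct_simpleRoot hn hr hj₁ hj₂,
    if_neg hjr.symm] at hpos
  exact lt_irrefl _ hpos

theorem isSimpleMaximal_of_mem_maximalSet (hn : 2 ≤ n) {r : ℤ} (hr : 1 ≤ r) {v : Perm ℤ}
    (h : v ∈ maximalSet n r) : IsSimpleMaximal n (act n v (fundWeight n r)) := by
  obtain ⟨hv, hnonneg, hmax⟩ := h
  refine ⟨hnonneg, fun i h₁ h₂ hpos hnonneg' => ?_⟩
  rw [← act_simpleRefl hn h₁ h₂, ← act_mul hn (simpleRefl_mem_weylGroup h₁ h₂) hv.1] at hnonneg'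
  have hlen : length n v < length n (simpleRefl i * v) :=
    length_lt_simpleRefl_mul hn hv.1 h₁ h₂ (inv_apply_lt_of_act_fundWeight_dotProduct_root_pos hn r
      hv.1 (isRootPair_simple hn h₁ h₂) (by rwa [← simpleRoot_eq_root]))
  have hle : BruhatLE n v (simpleRefl i * v) :=
    .single ⟨hv.1, simpleRefl i, ⟨1, one_mem _, i, h₁, h₂, by simp⟩, rfl, hlen⟩
  rw [hmax _ (simpleRefl_mul_mem_minReps hn hr hv h₁ h₂ hpos) hnonneg' hle] at hlen
  exact lt_irrefl _ hlen

/-! ### Sums of orthogonal simple roots -/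

/-- The sequence `i` lies in `[s, t]` and has gaps at least `2`. -/
def Sparse (s t : ℤ) (i : List ℤ) : Prop :=
  (∀ x ∈ i, s ≤ x ∧ x ≤ t) ∧ i.Pairwise fun a b => a + 2 ≤ b

theorem mem_J_iff {p : ℕ} {s t : ℤ} {i : List ℤ} :
    i ∈ J p s t ↔ i.length = p ∧ Sparse s t i := by
  have : IsTrans ℤ fun a b => b - a ≥ 2 := ⟨fun a b c hab hbc => by omega⟩
  have chain_iff : (i.IsChain fun a b => b - a ≥ 2) ↔ i.Pairwise fun a b => a + 2 ≤ b := by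
    rw [List.isChain_iff_pairwise]
    exact List.Pairwise.iff fun {a b} => by omega
  simp only [J, Sparse, Set.mem_ofPred_eq, chain_iff]

theorem sparse_nil (s t : ℤ) : Sparse s t [] := ⟨by simp, List.Pairwise.nil⟩

theorem sparse_cons {s t x : ℤ} {i : List ℤ} :
    Sparse s t (x :: i) ↔ s ≤ x ∧ x ≤ t ∧ Sparse (x + 2) t i := by
  simp only [Sparse, List.forall_mem_cons, List.pairwise_cons]
  constructor
  · rintro ⟨⟨⟨hs, ht⟩, hi⟩, hx, hpair⟩
    exact ⟨hs, ht, fun y hy => ⟨hx y hy, (hi y hy).2⟩, hpair⟩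
  · rintro ⟨hs, ht, hi, hpair⟩
    exact ⟨⟨⟨hs, ht⟩, fun y hy => ⟨by have := (hi y hy).1; omega, (hi y hy).2⟩⟩,
      fun y hy => (hi y hy).1, hpair⟩

theorem Sparse.mono {s s' t : ℤ} {i : List ℤ} (h : Sparse s t i) (hs : s' ≤ s) : Sparse s' t i :=
  ⟨fun y hy => ⟨hs.trans (h.1 y hy).1, (h.1 y hy).2⟩, h.2⟩

theorem Sparse.notMem_of_lt {s t : ℤ} {i : List ℤ} (h : Sparse s t i) {k : ℤ} (hk : k < s) :
    k ∉ i := fun hm => hk.not_ge (h.1 k hm).1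

theorem Sparse.add_one_notMem {s t : ℤ} {i : List ℤ} (h : Sparse s t i) {k : ℤ} (hk : k ∈ i) :
    k + 1 ∉ i := by
  obtain ⟨-, h⟩ := h
  induction h with
  | nil => simp at hk
  | cons hx _ ih =>
    simp only [List.mem_cons] at hk ⊢
    grind

theorem Sparse.nodup {s t : ℤ} {i : List ℤ} (h : Sparse s t i) : i.Nodup :=
  h.2.imp fun h => by omega

/-- The `k`-th coordinate of `α_{i_1} + ⋯ + α_{i_p}`, if `i` has gaps at least `2` and its entries
are at least `2`. -/
def rootSumCoord (i : List ℤ) (k : ℤ) : ℤ :=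
  (if k ∈ i then 1 else 0) - (if k + 1 ∈ i then 1 else 0)

theorem coord_simpleRoot {x k : ℤ} (hx : 2 ≤ x) (h₁ : 1 ≤ k) (h₂ : k ≤ n) :
    coord (simpleRoot n x) k = (if k = x then 1 else 0) - (if k + 1 = x then 1 else 0) := by
  rw [simpleRoot_eq_root, coord_root ⟨by omega, by omega, h₂⟩]
  unfold lowerIdx upperIdx
  grind

theorem coord_rootSum {s : ℤ} (hs : 2 ≤ s) {i : List ℤ} (hi : Sparse s n i) {k : ℤ}
    (h₁ : 1 ≤ k) (h₂ : k ≤ n) : coord (rootSum n i) k = rootSumCoord i k := by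
  induction i generalizing s with
  | nil => simp [rootSum, coord, rootSumCoord]
  | cons x i ih =>
    obtain ⟨hsx, -, htail⟩ := sparse_cons.1 hi
    have hx : x ∉ i := htail.notMem_of_lt (by omega)
    have ih := ih (by omega) htail
    rw [rootSum] at ih ⊢
    rw [List.map_cons, List.sum_cons, coord_add, ih, coord_simpleRoot (by omega) h₁ h₂]
    simp only [rootSumCoord, List.mem_cons]
    push_cast
    grind

/-! ### Maximal ternary weights -/

/-- All coordinates of `x` lie in `{-1, 0, 1}`; this holds for the weights `v(ω_r)` if `3 ≤ r` and
for `2 v(ω_1)` and `2 v(ω_2)`. -/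
def IsTernary (x : Fin n → ℝ) : Prop := ∀ k : ℤ, ∃ c : ℤ, coord x k = c ∧ -1 ≤ c ∧ c ≤ 1

/-- The pairs `(t, e)` for which `e e_1 + e_2 + ⋯ + e_t` can be the leading part of the ternary
weight of a maximal element. -/
def IsHead (t e : ℤ) : Prop :=
  (t = 1 ∧ e = 0) ∨ (t = 2 ∧ (e = -1 ∨ e = 0 ∨ e = 1)) ∨ (t = 3 ∧ (e = -1 ∨ e = 1))

/-- The `k`-th coordinate of the weight `e e_1 + e_2 + ⋯ + e_t + α_{i_1} + ⋯ + α_{i_p}`. -/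
def shapeCoord (t e : ℤ) (i : List ℤ) (k : ℤ) : ℤ :=
  if k = 1 then e else if k ≤ t then 1 else rootSumCoord i k

/-- The sum of the coordinates of `e e_1 + e_2 + ⋯ + e_t + α_{i_1} + ⋯ + α_{i_p}` from the `k`-th
on, for `k ≥ 2`. -/
def shapeSum (t : ℤ) (i : List ℤ) (k : ℤ) : ℤ :=
  if k ≤ t then t + 1 - k else if k ∈ i then 1 else 0

/-- `x = e e_1 + e_2 + ⋯ + e_t + α_{i_1} + ⋯ + α_{i_p}` with `i` in `[t + 2, n]`; these turn out to
be the ternary weights of the maximal elements. -/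
structure HasShape (n : ℕ) (x : Fin n → ℝ) (t e : ℤ) (i : List ℤ) : Prop where
  isHead : IsHead t e
  le_n : t ≤ n
  sparse : Sparse (t + 2) n i
  coord_eq : ∀ k : ℤ, 1 ≤ k → k ≤ n → coord x k = shapeCoord t e i k

theorem nonnegWeight_iff_suffixSum (hn : 2 ≤ n) {x : Fin n → ℝ} :
    NonnegWeight n x ↔ (∀ k : ℤ, 3 ≤ k → k ≤ n → 0 ≤ suffixSum x k) ∧
      0 ≤ suffixSum x 2 + coord x 1 ∧ 0 ≤ suffixSum x 2 - coord x 1 := by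
  rw [nonnegWeight_iff_dotProduct_fundWeight hn, ← two_mul_dotProduct_fundWeight_one hn,
    ← two_mul_dotProduct_fundWeight_two hn]
  constructor
  · intro h
    refine ⟨fun k h₃ h₂ => ?_, ?_, ?_⟩
    · rw [← dotProduct_fundWeight_of_three_le x h₃]
      exact h k (by omega) h₂
    · exact mul_nonneg zero_le_two (h 1 le_rfl (by omega))
    · exact mul_nonneg zero_le_two (h 2 (by omega) (by omega))
  · rintro ⟨hge, hone, htwo⟩ k h₁ h₂
    rcases (show k = 1 ∨ k = 2 ∨ 3 ≤ k by omega) with rfl | rfl | h₃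
    · linarith
    · linarith
    · rw [dotProduct_fundWeight_of_three_le x h₃]
      exact hge k h₃ h₂

namespace IsSimpleMaximal

variable {x : Fin n → ℝ}

theorem dotProduct_fundWeight_lt (hn : 2 ≤ n) (h : IsSimpleMaximal n x) {i : ℤ} (h₁ : 1 ≤ i)
    (h₂ : i ≤ n) (hpos : 0 < x ⬝ᵥ simpleRoot n i) :
    x ⬝ᵥ fundWeight n i < x ⬝ᵥ simpleRoot n i := by
  by_contra hle
  refine h.2 i h₁ h₂ hpos ((nonnegWeight_iff_dotProduct_fundWeight hn).2 fun k hk₁ hk₂ => ?_)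
  have hk := (nonnegWeight_iff_dotProduct_fundWeight hn).1 h.1 k hk₁ hk₂
  rw [sub_dotProduct, smul_dotProduct, dotProduct_comm (simpleRoot n i),
    fundWeight_dotProduct_simpleRoot hn hk₁ h₁ h₂, smul_eq_mul]
  split_ifs with hki
  · subst hki
    linarith
  · linarith

theorem suffixSum_lt (hn : 2 ≤ n) (h : IsSimpleMaximal n x) {k : ℤ} (h₃ : 3 ≤ k) (h₂ : k ≤ n)
    (hlt : coord x (k - 1) < coord x k) : suffixSum x k < coord x k - coord x (k - 1) := by
  have hdot : x ⬝ᵥ simpleRoot n k = coord x k - coord x (k - 1) := by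
    rw [simpleRoot_eq_root, dotProduct_root, upperIdx, lowerIdx, if_neg (by omega),
      if_neg (by omega)]
  have := h.dotProduct_fundWeight_lt hn (by omega) h₂ (by rwa [hdot, sub_pos])
  rwa [hdot, dotProduct_fundWeight_of_three_le x h₃] at this

theorem suffixSum_two_sub_lt (hn : 2 ≤ n) (h : IsSimpleMaximal n x)
    (hlt : coord x 1 < coord x 2) :
    suffixSum x 2 - coord x 1 < 2 * (coord x 2 - coord x 1) := by
  have hdot : x ⬝ᵥ simpleRoot n 2 = coord x 2 - coord x 1 := by
    rw [simpleRoot_eq_root, dotProduct_root]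
    rfl
  have := h.dotProduct_fundWeight_lt (i := 2) hn (by omega) (by omega) (by rwa [hdot, sub_pos])
  rw [← two_mul_dotProduct_fundWeight_two hn]
  linarith

theorem suffixSum_two_add_lt (hn : 2 ≤ n) (h : IsSimpleMaximal n x)
    (hpos : 0 < coord x 1 + coord x 2) :
    suffixSum x 2 + coord x 1 < 2 * (coord x 1 + coord x 2) := by
  have hdot : x ⬝ᵥ simpleRoot n 1 = coord x 1 + coord x 2 := by
    rw [simpleRoot_eq_root, dotProduct_root, upperIdx, lowerIdx, if_pos rfl, if_pos rfl,
      coord_neg_right, sub_neg_eq_add]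
  have := h.dotProduct_fundWeight_lt (i := 1) hn le_rfl (by omega) (by rwa [hdot])
  rw [← two_mul_dotProduct_fundWeight_one hn]
  linarith

end IsSimpleMaximal

/-- Beyond position `k`, the sequence `f` on `[1, N]` has a run of ones up to position `t`,
followed by adjacent pairs `(-1, 1)` and zeros, the ones of the pairs being in the positions `i`. -/
structure IsRunThenPairs (N : ℤ) (f : ℤ → ℤ) (k t : ℤ) (i : List ℤ) : Prop where
  le_run : k ≤ t
  run_le : t ≤ N
  sparse : Sparse (t + 2) N i
  run : ∀ j, k < j → j ≤ t → f j = 1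
  pairs : ∀ j, t < j → j ≤ N → f j = rootSumCoord i j

namespace IsRunThenPairs

variable {N : ℤ} {f : ℤ → ℤ} {k t : ℤ} {i : List ℤ}

theorem prepend_one (h : IsRunThenPairs N f (k + 1) t i) (hk : f (k + 1) = 1) :
    IsRunThenPairs N f k t i where
  le_run := by have := h.le_run; omega
  run_le := h.run_le
  sparse := h.sparse
  run j hj hjt := by
    rcases (show j = k + 1 ∨ k + 1 < j by omega) with rfl | hlt
    · exact hk
    · exact h.run j hlt hjt
  pairs := h.pairs

theorem prepend_zero (h : IsRunThenPairs N f (k + 1) (k + 1) i) (hk : f (k + 1) = 0) :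
    IsRunThenPairs N f k k i where
  le_run := le_rfl
  run_le := by have := h.run_le; omega
  sparse := h.sparse.mono (by omega)
  run j hj hjk := by omega
  pairs j hj hjN := by
    rcases (show j = k + 1 ∨ k + 1 < j by omega) with rfl | hlt
    · rw [hk, rootSumCoord, if_neg (h.sparse.notMem_of_lt (by omega)),
        if_neg (h.sparse.notMem_of_lt (by omega)), sub_zero]
    · exact h.pairs j hlt hjN

theorem prepend_pair (h : IsRunThenPairs N f (k + 1) (k + 2) i) (hk : f (k + 1) = -1) :
    IsRunThenPairs N f k k ((k + 2) :: i) where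
  le_run := le_rfl
  run_le := by have := h.run_le; omega
  sparse := sparse_cons.2 ⟨le_rfl, h.run_le, h.sparse⟩
  run j hj hjk := by omega
  pairs j hj hjN := by
    have hone : k + 1 ∉ i := h.sparse.notMem_of_lt (by omega)
    have htwo : k + 2 ∉ i := h.sparse.notMem_of_lt (by omega)
    have hthree : k + 3 ∉ i := h.sparse.notMem_of_lt (by omega)
    have hrun := h.run (k + 2) (by omega) le_rfl
    have hpairs := h.pairs j
    simp only [rootSumCoord, List.mem_cons] at hpairs ⊢
    grind

end IsRunThenPairs

-- Here `F k` is the sum of the `f j` with `k ≤ j ≤ N`; scanning `f` from the right, a run of ones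
-- can only be interrupted by a zero if it is empty and by `-1` if it has length one.
theorem exists_isRunThenPairs {N : ℤ} {f F : ℤ → ℤ} (hf : ∀ k, -1 ≤ f k ∧ f k ≤ 1)
    (hF : ∀ k ≤ N, F k = f k + F (k + 1)) (hF_top : F (N + 1) = 0)
    (hnonneg : ∀ k, 2 ≤ k → k ≤ N → 0 ≤ F k)
    (hascent : ∀ k, 3 ≤ k → k ≤ N → f (k - 1) < f k → F k < f k - f (k - 1))
    {k : ℤ} (hk : 1 ≤ k) (hkN : k ≤ N) :
    ∃ t i, IsRunThenPairs N f k t i ∧ F (k + 1) = t - k := by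
  induction k, hkN using Int.leInductionDown with
  | base =>
    exact ⟨N, [], ⟨le_rfl, le_rfl, sparse_nil _ _, fun _ _ _ => by omega, fun _ _ _ => by omega⟩,
      by omega⟩
  | pred k hkN ih =>
    obtain ⟨k, rfl⟩ : ∃ l, k = l + 1 := ⟨k - 1, by omega⟩
    rw [add_sub_cancel_right] at hk ⊢
    obtain ⟨t, i, h, hsum⟩ := ih (by omega)
    have hsum' := hF (k + 1) hkN
    have := hnonneg (k + 1) (by omega) hkN
    have := hf (k + 1)
    by_cases hone : f (k + 1) = 1
    · exact ⟨t, i, h.prepend_one hone, by omega⟩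
    rcases h.le_run.eq_or_lt with rfl | hlt
    · exact ⟨k, i, h.prepend_zero (by omega), by omega⟩
    · have hrun := h.run (k + 1 + 1) (by omega) (by omega)
      have hlt' := hascent (k + 1 + 1) (by omega) (by have := h.run_le; omega)
      rw [add_sub_cancel_right, hrun, hsum] at hlt'
      obtain rfl : t = k + 2 := by omega
      exact ⟨k, (k + 2) :: i, h.prepend_pair (by omega), by omega⟩

theorem IsSimpleMaximal.exists_hasShape (hn : 3 ≤ n) {x : Fin n → ℝ} (hx : IsTernary x)
    (h : IsSimpleMaximal n x) : ∃ t e i, HasShape n x t e i := by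
  choose f hf hge hle using hx
  set F : ℤ → ℤ := fun k => ∑ j ∈ Finset.Icc k (n : ℤ), f j with hF
  have hsuffix (k : ℤ) : suffixSum x k = F k := by
    rw [hF, suffixSum, Int.cast_sum]
    exact Finset.sum_congr rfl fun j _ => hf j
  have hF_add (k : ℤ) (hk : k ≤ n) : F k = f k + F (k + 1) := by
    have := suffixSum_eq_add x hk
    rw [hsuffix, hsuffix, hf] at this
    exact_mod_cast this
  have hF_top : F (n + 1) = 0 := by
    have := suffixSum_of_lt x (lt_add_one (n : ℤ))
    rw [hsuffix] at this
    exact_mod_cast this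
  have hnonneg := (nonnegWeight_iff_suffixSum (by omega)).1 h.1
  have hascent := fun k (h₃ : 3 ≤ k) h₂ => h.suffixSum_lt (by omega) h₃ h₂
  have hsub := h.suffixSum_two_sub_lt (by omega)
  have hadd := h.suffixSum_two_add_lt (by omega)
  simp only [hsuffix, hf] at hnonneg hascent hsub hadd
  norm_cast at hnonneg hascent hsub hadd
  have hF_nonneg (k : ℤ) (h₂ : 2 ≤ k) (hk : k ≤ n) : 0 ≤ F k := by
    rcases h₂.eq_or_lt with rfl | h₃
    · omega
    · exact hnonneg.1 k h₃ hk
  obtain ⟨t, i, hrun, hF_two⟩ := exists_isRunThenPairs (fun k => ⟨hge k, hle k⟩) hF_add hF_top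
    hF_nonneg hascent le_rfl (by omega)
  rw [one_add_one_eq_two] at hF_two
  refine ⟨t, f 1, i, ?_, hrun.run_le, hrun.sparse, fun k h₁ h₂ => ?_⟩
  · have := hge 1
    have := hle 1
    have := hrun.le_run
    have := hrun.run 2
    unfold IsHead
    omega
  · rw [hf, shapeCoord]
    split_ifs with hk hkt
    · rw [hk]
    · rw [hrun.run k (by omega) hkt]
    · rw [hrun.pairs k (by omega) h₂]

theorem IsHead.one_le {t e : ℤ} (h : IsHead t e) : 1 ≤ t := by
  unfold IsHead at h
  omega

theorem IsHead.bounds {t e : ℤ} (h : IsHead t e) : -1 ≤ e ∧ e ≤ 1 := by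
  unfold IsHead at h
  omega

theorem shapeSum_eq_add {N t e : ℤ} {i : List ℤ} (hi : Sparse (t + 2) N i) {k : ℤ} (h₂ : 2 ≤ k) :
    shapeSum t i k = shapeCoord t e i k + shapeSum t i (k + 1) := by
  have := hi.notMem_of_lt (by omega : t + 1 < t + 2)
  unfold shapeSum shapeCoord rootSumCoord
  grind

namespace HasShape

variable {x : Fin n → ℝ} {t e : ℤ} {i : List ℤ}

theorem coord_one (hn : 1 ≤ n) (h : HasShape n x t e i) : coord x 1 = e := by
  rw [h.coord_eq 1 le_rfl (by omega), shapeCoord, if_pos rfl]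

theorem suffixSum_eq (h : HasShape n x t e i) {k : ℤ} (h₂ : 2 ≤ k) (hk : k ≤ n) :
    suffixSum x k = shapeSum t i k := by
  suffices ∀ k ≤ (n + 1 : ℤ), 2 ≤ k → suffixSum x k = shapeSum t i k from this k (by omega) h₂
  intro k hk h₂
  induction k, hk using Int.leInductionDown with
  | base =>
    have := h.le_n
    rw [suffixSum_of_lt x (lt_add_one _), shapeSum, if_neg (by omega),
      if_neg fun hm => by have := (h.sparse.1 _ hm).2; omega, Int.cast_zero]
  | pred k hk ih =>
    rw [suffixSum_eq_add x (by omega), h.coord_eq _ (by omega) (by omega), sub_add_cancel,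
      ih (by omega), shapeSum_eq_add (e := e) h.sparse h₂, sub_add_cancel, Int.cast_add]

theorem nonnegWeight (hn : 2 ≤ n) (h : HasShape n x t e i) : NonnegWeight n x := by
  have hnonneg (k : ℤ) : 0 ≤ shapeSum t i k := by
    unfold shapeSum
    split_ifs <;> omega
  have htwo : -shapeSum t i 2 ≤ e ∧ e ≤ shapeSum t i 2 := by
    have := h.isHead
    unfold shapeSum IsHead at *
    grind
  rw [nonnegWeight_iff_suffixSum hn, h.suffixSum_eq le_rfl (by omega), h.coord_one (by omega)]
  refine ⟨fun k h₃ h₂ => ?_, ?_, ?_⟩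
  · rw [h.suffixSum_eq (by omega) h₂]
    exact_mod_cast hnonneg k
  · exact_mod_cast (by omega : 0 ≤ shapeSum t i 2 + e)
  · exact_mod_cast (by omega : 0 ≤ shapeSum t i 2 - e)

end HasShape

theorem exists_root_eq_vec_sub_smul_vec {a b : ℤ} (h : IsRootPair n a b) (hab : a < b) :
    ∃ j k s : ℤ, 1 ≤ j ∧ j < k ∧ k ≤ n ∧ (s = 1 ∨ s = -1) ∧
      root n a b = vec n k - (s : ℝ) • vec n j := by
  obtain ⟨j, k, h₁, hjk, h₂, hroot | hroot⟩ := (root_mem_posRoots_iff h).2 hab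
  · exact ⟨j, k, 1, h₁, hjk, h₂, Or.inl rfl, by rw [hroot]; simp⟩
  · exact ⟨j, k, -1, h₁, hjk, h₂, Or.inr rfl, by rw [hroot]; simp⟩

theorem suffixSum_vec {b k : ℤ} (hb : 1 ≤ b) (hbn : b ≤ n) (hk : 1 ≤ k) :
    suffixSum (vec n b) k = if k ≤ b then 1 else 0 := by
  have coord_eq : ∀ j ∈ Finset.Icc k (n : ℤ), coord (vec n b) j = if b = j then 1 else 0 := by
    intro j hj
    rw [Finset.mem_Icc] at hj
    rw [coord_vec _ ⟨by omega, by omega, hj.2⟩, if_neg (by omega : b ≠ -j)]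
  rw [suffixSum, Finset.sum_congr rfl coord_eq, Finset.sum_ite_eq]
  simp only [Finset.mem_Icc, hbn, and_true]

theorem suffixSum_sub (x y : Fin n → ℝ) (k : ℤ) :
    suffixSum (x - y) k = suffixSum x k - suffixSum y k := by
  simp only [suffixSum, coord_sub, Finset.sum_sub_distrib]

theorem suffixSum_smul (c : ℝ) (x : Fin n → ℝ) (k : ℤ) :
    suffixSum (c • x) k = c * suffixSum x k := by
  simp only [suffixSum, coord_smul, Finset.mul_sum]

theorem HasShape.le_shapeSum (hn : 2 ≤ n) {x : Fin n → ℝ} {t e : ℤ} {i : List ℤ}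
    (h : HasShape n x t e i) {a b s c : ℤ} (h₁ : 1 ≤ a) (hab : a < b) (h₂ : b ≤ n)
    (hnonneg : NonnegWeight n (x - (c : ℝ) • (vec n b - (s : ℝ) • vec n a))) :
    (∀ k, 3 ≤ k → a < k → k ≤ b → c ≤ shapeSum t i k) ∧
      c * (1 - s) ≤ shapeSum t i 2 + e ∧
      c * (1 - if a = 1 then -s else s) ≤ shapeSum t i 2 - e := by
  obtain ⟨hge, hone, htwo⟩ := (nonnegWeight_iff_suffixSum hn).1 hnonneg
  have hsuffix (k : ℤ) (hk₁ : 2 ≤ k) (hk₂ : k ≤ b) :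
      suffixSum (x - (c : ℝ) • (vec n b - (s : ℝ) • vec n a)) k =
        ((shapeSum t i k - c * (1 - if k ≤ a then s else 0) : ℤ) : ℝ) := by
    rw [suffixSum_sub, suffixSum_smul, suffixSum_sub, suffixSum_smul,
      suffixSum_vec (by omega) h₂ (by omega), suffixSum_vec h₁ (by omega) (by omega),
      h.suffixSum_eq hk₁ (by omega), if_pos hk₂]
    split_ifs <;> push_cast <;> ring
  have hcoord : coord (x - (c : ℝ) • (vec n b - (s : ℝ) • vec n a)) 1 =
      ((e + if a = 1 then c * s else 0 : ℤ) : ℝ) := by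
    have hidx : IsIndex n 1 := ⟨one_ne_zero, by omega, by omega⟩
    rw [coord_sub, coord_smul, coord_sub, coord_smul, coord_vec _ hidx, coord_vec _ hidx,
      h.coord_one (by omega), if_neg (by omega), if_neg (by omega), if_neg (by omega : a ≠ -1)]
    split_ifs <;> push_cast <;> ring
  rw [hsuffix 2 le_rfl (by omega), hcoord] at hone htwo
  norm_cast at hone htwo
  refine ⟨fun k hk₁ hk₂ hk₃ => ?_, ?_⟩
  · have := hge k hk₁ (by omega)
    rw [hsuffix k (by omega) hk₃, if_neg (by omega), sub_zero, mul_one] at this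
    norm_cast at this
    exact sub_nonneg.1 this
  · rcases h₁.eq_or_lt with rfl | ha
    · rw [if_neg (by omega), if_pos rfl] at hone htwo
      rw [if_pos rfl]
      constructor <;> linarith
    · rw [if_pos (by omega), if_neg (by omega)] at hone htwo
      rw [if_neg (by omega)]
      constructor <;> linarith

theorem shapeCoord_of_mem {N t e : ℤ} {i : List ℤ} (hi : Sparse (t + 2) N i) (ht : 1 ≤ t) {b : ℤ}
    (hb : b ∈ i) : shapeCoord t e i b = 1 := by
  have := (hi.1 b hb).1
  rw [shapeCoord, if_neg (by omega), if_neg (by omega), rootSumCoord, if_pos hb,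
    if_neg (hi.add_one_notMem hb), sub_zero]

theorem shapeCoord_sub_one_of_mem {N t e : ℤ} {i : List ℤ} (hi : Sparse (t + 2) N i) (ht : 1 ≤ t)
    {b : ℤ} (hb : b ∈ i) : shapeCoord t e i (b - 1) = -1 := by
  have := (hi.1 b hb).1
  have hnotMem : b - 1 ∉ i := fun hm => by
    have := hi.add_one_notMem hm
    rw [sub_add_cancel] at this
    exact this hb
  rw [shapeCoord, if_neg (by omega), if_neg (by omega), rootSumCoord, if_neg hnotMem,
    sub_add_cancel, if_pos hb, zero_sub]

-- No reflection in `e_b - s e_a` can raise a vector of the given shape: according as `b` lies in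
-- the head or not, the fundamental weights `ω_1`, `ω_2`, or `ω_b` and `ω_{b-1}` show that the
-- difference `c` of the coordinates would be too large.
theorem shapeCoord_sub_le_zero {N t e : ℤ} {i : List ℤ} (hhead : IsHead t e)
    (hi : Sparse (t + 2) N i) {a b s : ℤ} (h₁ : 1 ≤ a) (hab : a < b) (hs : s = 1 ∨ s = -1) {c : ℤ}
    (hc : c = shapeCoord t e i b - s * shapeCoord t e i a)
    (hle : ∀ k, 3 ≤ k → a < k → k ≤ b → c ≤ shapeSum t i k)
    (hone : c * (1 - s) ≤ shapeSum t i 2 + e)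
    (htwo : c * (1 - if a = 1 then -s else s) ≤ shapeSum t i 2 - e) : c ≤ 0 := by
  have ht := hhead.one_le
  by_contra! hpos
  rcases le_or_gt b t with hbt | hbt
  · have hSb := hle b
    rw [shapeSum, if_pos (by omega : 2 ≤ t)] at hone htwo
    rw [shapeSum, if_pos hbt] at hSb
    have ha : shapeCoord t e i a = if a = 1 then e else 1 := by
      rw [shapeCoord, if_pos (by omega : a ≤ t)]
    rw [ha, shapeCoord, if_neg (by omega), if_pos hbt] at hc
    unfold IsHead at hhead
    rcases hs with rfl | rfl <;> split_ifs at hc htwo <;> omega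
  by_cases htop : t = 1 ∧ a = 1
  · obtain ⟨rfl, rfl⟩ := htop
    have he : e = 0 := by
      unfold IsHead at hhead
      omega
    have hS : shapeSum 1 i 2 = 0 := by
      rw [shapeSum, if_neg (by omega), if_neg (hi.notMem_of_lt (by omega))]
    rw [hS, he] at hone htwo
    rw [if_pos rfl] at htwo
    rcases hs with rfl | rfl <;> omega
  · have hSb := hle b (by omega) hab le_rfl
    rw [shapeSum, if_neg (by omega)] at hSb
    have hb : b ∈ i := by
      by_contra hm
      rw [if_neg hm] at hSb
      omega
    have := (hi.1 b hb).1
    rw [if_pos hb] at hSb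
    rw [shapeCoord_of_mem hi ht hb] at hc
    rcases (show a = b - 1 ∨ a < b - 1 by omega) with rfl | ha
    · rw [shapeCoord_sub_one_of_mem hi ht hb] at hc
      rcases hs with rfl | rfl <;> omega
    · have hnotMem : b - 1 ∉ i := fun hm => hi.add_one_notMem hm (by rwa [sub_add_cancel])
      have := hle (b - 1) (by omega) ha (by omega)
      rw [shapeSum, if_neg (by omega), if_neg hnotMem] at this
      omega

theorem HasShape.isReflMaximal (hn : 2 ≤ n) {x : Fin n → ℝ} {t e : ℤ} {i : List ℤ}
    (h : HasShape n x t e i) : IsReflMaximal n x := by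
  refine ⟨h.nonnegWeight hn, fun a' b' hroot hab' hpos hnonneg => ?_⟩
  obtain ⟨a, b, s, h₁, hab, h₂, hs, heq⟩ := exists_root_eq_vec_sub_smul_vec hroot hab'
  have hdot : x ⬝ᵥ root n a' b' =
      ((shapeCoord t e i b - s * shapeCoord t e i a : ℤ) : ℝ) := by
    rw [heq, dotProduct_sub, dotProduct_smul]
    change coord x b - s * coord x a = _
    rw [h.coord_eq b (by omega) h₂, h.coord_eq a h₁ (by omega)]
    push_cast
    rfl
  rw [hdot, heq] at hnonneg
  obtain ⟨hle, hone, htwo⟩ := h.le_shapeSum hn h₁ hab h₂ hnonneg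
  have := shapeCoord_sub_le_zero h.isHead h.sparse h₁ hab hs rfl hle hone htwo
  rw [hdot] at hpos
  exact hpos.not_ge (by exact_mod_cast this)

theorem sum_indicator_mem {s N : ℤ} {i : List ℤ} (hnodup : i.Nodup)
    (h : ∀ x ∈ i, s ≤ x ∧ x ≤ N) :
    ∑ k ∈ Finset.Icc s N, (if k ∈ i then (1 : ℤ) else 0) = i.length := by
  have hsub : i.toFinset ⊆ Finset.Icc s N := fun x hx =>
    Finset.mem_Icc.2 (h x (List.mem_toFinset.1 hx))
  simp only [← List.mem_toFinset]
  rw [Finset.sum_ite_mem, Finset.inter_eq_right.2 hsub, Finset.sum_const, nsmul_one,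
    List.toFinset_card_of_nodup hnodup]

theorem mem_primed {i : List ℤ} {k : ℤ} : k ∈ primed i ↔ k + 1 ∈ i := by
  simp only [primed, List.mem_map]
  exact ⟨fun ⟨x, hx, hxk⟩ => by rwa [← hxk, sub_add_cancel],
    fun h => ⟨k + 1, h, add_sub_cancel_right k 1⟩⟩

theorem Sparse.primed {s t : ℤ} {i : List ℤ} (h : Sparse s t i) :
    Sparse (s - 1) (t - 1) (primed i) := by
  refine ⟨fun k hk => ?_, List.pairwise_map.2 (h.2.imp fun hab => by omega)⟩
  have := h.1 _ (mem_primed.1 hk)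
  omega

theorem sq_shapeCoord {N t e : ℤ} {i : List ℤ} (hi : Sparse (t + 2) N i) (ht : 1 ≤ t) {k : ℤ}
    (hk : 1 ≤ k) :
    shapeCoord t e i k ^ 2 =
      (if k = 1 then e ^ 2 else 0) + (if k ∈ Finset.Icc 2 t then 1 else 0) +
        ((if k ∈ i then 1 else 0) + (if k ∈ primed i then 1 else 0)) := by
  simp only [shapeCoord, mem_primed, Finset.mem_Icc]
  rcases le_or_gt k t with hkt | hkt
  · rw [if_pos hkt, if_neg (hi.notMem_of_lt (by omega)), if_neg (hi.notMem_of_lt (by omega))]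
    split_ifs <;> first | ring1 | omega
  · have := fun hm : k ∈ i => hi.add_one_notMem hm
    rw [if_neg (by omega), if_neg (by omega), if_neg (by omega), if_neg (by omega), rootSumCoord]
    split_ifs <;> first | ring1 | tauto

theorem HasShape.dotProduct_self {x : Fin n → ℝ} {t e : ℤ} {i : List ℤ} (h : HasShape n x t e i) :
    x ⬝ᵥ x = ((t - 1 + e ^ 2 + 2 * i.length : ℤ) : ℝ) := by
  have ht := h.isHead.one_le
  have htn := h.le_n
  have hprimed := h.sparse.primed
  have hsum : ∑ k ∈ Finset.Icc (1 : ℤ) n, shapeCoord t e i k ^ 2 =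
      t - 1 + e ^ 2 + 2 * i.length := by
    rw [Finset.sum_congr rfl fun k hk => sq_shapeCoord h.sparse ht (Finset.mem_Icc.1 hk).1,
      Finset.sum_add_distrib, Finset.sum_add_distrib, Finset.sum_add_distrib,
      sum_indicator_mem h.sparse.nodup fun k hk => by have := h.sparse.1 k hk; omega,
      sum_indicator_mem hprimed.nodup fun k hk => by have := hprimed.1 k hk; omega,
      Finset.sum_ite_eq', if_pos (Finset.mem_Icc.2 ⟨le_rfl, by omega⟩), Finset.sum_ite_mem,
      Finset.inter_eq_right.2 (Finset.Icc_subset_Icc one_le_two htn), Finset.sum_const,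
      Int.card_Icc, primed, List.length_map, nsmul_one, Int.ofNat_toNat]
    omega
  rw [← hsum, dotProduct_eq_sum_coord, Int.cast_sum]
  refine Finset.sum_congr rfl fun k hk => ?_
  rw [Finset.mem_Icc] at hk
  rw [h.coord_eq k hk.1 hk.2, Int.cast_pow, sq]

theorem isTernary_of_pos {x : Fin n → ℝ}
    (h : ∀ k : ℤ, 1 ≤ k → k ≤ n → ∃ c : ℤ, coord x k = c ∧ -1 ≤ c ∧ c ≤ 1) : IsTernary x := by
  intro k
  by_cases hk : IsIndex n k
  · obtain ⟨hzero, hge, hle⟩ := hk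
    rcases lt_or_gt_of_ne hzero with hneg | hpos
    · obtain ⟨c, hc, hge, hle⟩ := h (-k) (by omega) (by omega)
      refine ⟨-c, ?_, by omega, by omega⟩
      rw [coord_neg_right] at hc
      rw [Int.cast_neg, ← hc, neg_neg]
    · exact h k (by omega) hle
  · exact ⟨0, by rw [coord_eq_zero x hk, Int.cast_zero], by omega, by omega⟩

theorem HasShape.isTernary {x : Fin n → ℝ} {t e : ℤ} {i : List ℤ} (h : HasShape n x t e i) :
    IsTernary x :=
  isTernary_of_pos fun k h₁ h₂ => ⟨_, h.coord_eq k h₁ h₂, by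
    have := h.isHead.bounds
    unfold shapeCoord rootSumCoord
    split_ifs <;> omega⟩

theorem IsTernary.act (hn : 2 ≤ n) {x : Fin n → ℝ} (hx : IsTernary x) {w : Perm ℤ}
    (hw : w ∈ weylGroup n) : IsTernary (act n w x) := fun k => by
  rw [coord_act hn hw]
  exact hx _

/-! ### Orbits of ternary vectors -/

/-- `x` lies in the closed dominant Weyl chamber. -/
def IsDominant (n : ℕ) (x : Fin n → ℝ) : Prop :=
  ∀ i : ℤ, 1 ≤ i → i ≤ n → 0 ≤ x ⬝ᵥ simpleRoot n i

theorem finite_orbit (hn : 2 ≤ n) (x : Fin n → ℝ) :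
    {y | ∃ w ∈ weylGroup n, act n w x = y}.Finite := by
  refine (Set.Finite.pi' (t := fun _ : Fin n => coord x '' Set.Icc (-n) n) fun _ =>
    (Set.finite_Icc _ _).image _).subset ?_
  rintro _ ⟨w, hw, rfl⟩ j
  have hidx : IsIndex n (w⁻¹ (j + 1)) :=
    (isIndex_weylGroup_apply hn (inv_mem hw)).2 ⟨by omega, by omega, by omega⟩
  exact ⟨_, hidx.2, by rw [← coord_act hn hw, coord_fin]⟩

-- A point of the orbit whose pairing with the half sum `ρ` of the positive roots is maximal is
-- dominant.
theorem exists_isDominant_act (hn : 2 ≤ n) (x : Fin n → ℝ) :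
    ∃ w ∈ weylGroup n, IsDominant n (act n w x) := by
  set ρ : Fin n → ℝ := ∑ k ∈ Finset.Icc (1 : ℤ) n, fundWeight n k with hρ
  have simpleRoot_dotProduct_rho {i : ℤ} (h₁ : 1 ≤ i) (h₂ : i ≤ n) : simpleRoot n i ⬝ᵥ ρ = 1 := by
    rw [hρ, dotProduct_sum, Finset.sum_eq_single_of_mem i (Finset.mem_Icc.2 ⟨h₁, h₂⟩)]
    · rw [dotProduct_comm, fundWeight_dotProduct_simpleRoot hn h₁ h₁ h₂, if_pos rfl]
    · intro k hk hki
      rw [dotProduct_comm, fundWeight_dotProduct_simpleRoot hn (Finset.mem_Icc.1 hk).1 h₁ h₂,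
        if_neg hki]
  obtain ⟨_, ⟨w, hw, rfl⟩, hmax⟩ := (finite_orbit hn x).exists_maximalFor (fun y => y ⬝ᵥ ρ) _
    ⟨_, 1, one_mem _, rfl⟩
  refine ⟨w, hw, fun i h₁ h₂ => ?_⟩
  by_contra! hneg
  have hs := simpleRefl_mem_weylGroup h₁ h₂
  have hle := hmax ⟨simpleRefl i * w, mul_mem hs hw, rfl⟩
  simp only [act_mul hn hs hw, act_simpleRefl hn h₁ h₂, sub_dotProduct, smul_dotProduct,
    simpleRoot_dotProduct_rho h₁ h₂, smul_eq_mul] at hle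
  linarith [hle (by linarith)]

namespace IsDominant

variable {x : Fin n → ℝ}

theorem coord_one_add_coord_two (hn : 2 ≤ n) (h : IsDominant n x) :
    0 ≤ coord x 1 + coord x 2 := by
  have := h 1 le_rfl (by omega)
  rw [simpleRoot_eq_root, dotProduct_root, lowerIdx, upperIdx, if_pos rfl, if_pos rfl,
    coord_neg_right] at this
  linarith

theorem coord_le (h : IsDominant n x) {k l : ℤ} (hk : 1 ≤ k) (hkl : k ≤ l) (hl : l ≤ n) :
    coord x k ≤ coord x l := by
  induction l, hkl using Int.leInduction with
  | base => rfl
  | succ l hkl ih =>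
    have := h (l + 1) (by omega) hl
    rw [simpleRoot_eq_root, dotProduct_root, lowerIdx, upperIdx, if_neg (by omega),
      if_neg (by omega), add_sub_cancel_right] at this
    linarith [ih (by omega)]

theorem exists_coord_eq (hn : 2 ≤ n) (h : IsDominant n x) (hx : IsTernary x) :
    ∃ e t : ℤ, -1 ≤ e ∧ e ≤ 1 ∧ 2 ≤ t ∧ t ≤ n + 1 ∧ (e ≠ 0 → t = 2) ∧
      ∀ k : ℤ, 1 ≤ k → k ≤ n →
        coord x k = ((if k = 1 then e else if t ≤ k then 1 else 0 : ℤ) : ℝ) := by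
  choose f hf hge hle using hx
  have hmono (k l : ℤ) (hk : 1 ≤ k) (hkl : k ≤ l) (hl : l ≤ n) : f k ≤ f l := by
    have := h.coord_le hk hkl hl
    rw [hf, hf] at this
    exact_mod_cast this
  have honetwo : 0 ≤ f 1 + f 2 := by
    have := h.coord_one_add_coord_two hn
    rw [hf, hf] at this
    exact_mod_cast this
  obtain ⟨t, ⟨ht₂, htone⟩, hleast⟩ := Int.exists_least_of_bdd
    (P := fun z => 2 ≤ z ∧ (z ≤ n → f z = 1)) ⟨2, fun _ hz => hz.1⟩
    ⟨n + 1, by omega, fun _ => by omega⟩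
  have htn := hleast (n + 1) ⟨by omega, fun _ => by omega⟩
  have hone := hmono 1 2 le_rfl one_le_two (by omega)
  have := hge 1
  have := hle 2
  refine ⟨f 1, t, hge 1, hle 1, ht₂, htn, fun he => ?_, fun k h₁ h₂ => ?_⟩
  · have := hleast 2 ⟨le_rfl, fun _ => by omega⟩
    omega
  · rw [hf, Int.cast_inj]
    have := hle k
    split_ifs with hk hkt
    · rw [hk]
    · have := hmono t k (by omega) hkt h₂
      have := htone (by omega)
      omega
    · have := hmono 2 k (by omega) (by omega) h₂
      have := mt (hleast k) hkt
      omega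

theorem eq_fundWeight (hn : 2 ≤ n) (h : IsDominant n x) (hx : IsTernary x) {r : ℤ} (hr : 3 ≤ r)
    (hrn : r ≤ n) (hdot : x ⬝ᵥ x = ((n + 1 - r : ℤ) : ℝ)) : x = fundWeight n r := by
  obtain ⟨e, t, -, -, ht₂, htn, he, hcoord⟩ := h.exists_coord_eq hn hx
  have hsq : ∀ k ∈ Finset.Icc (1 : ℤ) n, coord x k * coord x k =
      (((if k = 1 then e ^ 2 else 0) + if k ∈ Finset.Icc t n then 1 else 0 : ℤ) : ℝ) := by
    intro k hk
    rw [Finset.mem_Icc] at hk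
    rw [hcoord k hk.1 hk.2, ← Int.cast_mul, Int.cast_inj, ← sq]
    simp only [Finset.mem_Icc]
    split_ifs <;> first | ring1 | omega
  have hsum : e ^ 2 + (n + 1 - t) = n + 1 - r := by
    rw [dotProduct_eq_sum_coord, Finset.sum_congr rfl hsq, ← Int.cast_sum, Int.cast_inj,
      Finset.sum_add_distrib, Finset.sum_ite_eq', if_pos (Finset.mem_Icc.2 ⟨le_rfl, by omega⟩),
      Finset.sum_ite_mem, Finset.inter_eq_right.2 (Finset.Icc_subset_Icc (by omega) le_rfl),
      Finset.sum_const, Int.card_Icc, nsmul_one, Int.ofNat_toNat] at hdot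
    omega
  obtain rfl : e = 0 := by
    by_contra hne
    have := he hne
    have := sq_nonneg e
    omega
  obtain rfl : t = r := by omega
  refine coord_ext fun k h₁ h₂ => ?_
  rw [hcoord k h₁ h₂, coord_fundWeight _ h₁ h₂, if_neg (by omega : t ≠ 1),
    if_neg (by omega : t ≠ 2)]
  split_ifs <;> first | omega | simp

end IsDominant

theorem coord_two_smul_fundWeight_one {k : ℤ} (h₁ : 1 ≤ k) (h₂ : k ≤ n) :
    coord ((2 : ℝ) • fundWeight n 1) k = 1 := by
  rw [coord_smul, coord_fundWeight _ h₁ h₂, if_pos rfl]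
  norm_num

theorem coord_two_smul_fundWeight_two {k : ℤ} (h₁ : 1 ≤ k) (h₂ : k ≤ n) :
    coord ((2 : ℝ) • fundWeight n 2) k = if k = 1 then -1 else 1 := by
  rw [coord_smul, coord_fundWeight _ h₁ h₂, if_neg (by norm_num), if_pos rfl]
  split_ifs <;> norm_num

theorem IsDominant.eq_two_smul_fundWeight (hn : 2 ≤ n) {x : Fin n → ℝ} (h : IsDominant n x)
    (hx : IsTernary x) (hne : ∀ k : ℤ, 1 ≤ k → k ≤ n → coord x k ≠ 0) :
    x = (2 : ℝ) • fundWeight n 1 ∨ x = (2 : ℝ) • fundWeight n 2 := by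
  obtain ⟨e, t, hge, hle, -, -, he, hcoord⟩ := h.exists_coord_eq hn hx
  have hone : e ≠ 0 := by
    have := hne 1 le_rfl (by omega)
    rwa [hcoord 1 le_rfl (by omega), if_pos rfl, Int.cast_ne_zero] at this
  obtain rfl := he hone
  rcases (show e = 1 ∨ e = -1 by omega) with rfl | rfl
  · refine Or.inl (coord_ext fun k h₁ h₂ => ?_)
    rw [hcoord k h₁ h₂, coord_two_smul_fundWeight_one h₁ h₂]
    split_ifs <;> first | omega | simp
  · refine Or.inr (coord_ext fun k h₁ h₂ => ?_)
    rw [hcoord k h₁ h₂, coord_two_smul_fundWeight_two h₁ h₂]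
    split_ifs <;> first | omega | simp

theorem IsTernary.exists_mem_minReps (hn : 2 ≤ n) {x : Fin n → ℝ} (hx : IsTernary x) {r : ℤ}
    (hr : 3 ≤ r) (hrn : r ≤ n) (hdot : x ⬝ᵥ x = ((n + 1 - r : ℤ) : ℝ)) :
    ∃ v ∈ minReps n r, TypeD.act n v (fundWeight n r) = x := by
  obtain ⟨w, hw, hdom⟩ := exists_isDominant_act hn x
  have heq := hdom.eq_fundWeight hn (hx.act hn hw) hr hrn (by rw [act_dotProduct_act hn hw, hdot])
  obtain ⟨v, hv, hvw⟩ := TypeD.exists_mem_minReps hn (r := r) (by omega) (inv_mem hw)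
  exact ⟨v, hv, by rw [hvw, ← heq, act_inv_act hn hw]⟩

theorem IsTernary.exists_mem_minReps_spin (hn : 2 ≤ n) {x : Fin n → ℝ} (hx : IsTernary x)
    (hne : ∀ k : ℤ, 1 ≤ k → k ≤ n → coord x k ≠ 0) :
    (∃ v ∈ minReps n 1, TypeD.act n v ((2 : ℝ) • fundWeight n 1) = x) ∨
      ∃ v ∈ minReps n 2, TypeD.act n v ((2 : ℝ) • fundWeight n 2) = x := by
  obtain ⟨w, hw, hdom⟩ := exists_isDominant_act hn x
  have hne' (k : ℤ) (h₁ : 1 ≤ k) (h₂ : k ≤ n) : coord (TypeD.act n w x) k ≠ 0 := fun hzero => by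
    rw [coord_act hn hw] at hzero
    obtain ⟨hidx, hge, hle⟩ :=
      (isIndex_weylGroup_apply hn (inv_mem hw)).2 (⟨by omega, by omega, h₂⟩ : IsIndex n k)
    rcases lt_or_gt_of_ne hidx with hneg | hpos
    · refine hne (-w⁻¹ k) (by omega) (by omega) ?_
      rw [coord_neg_right, hzero, neg_zero]
    · exact hne _ hpos hle hzero
  have exists_of_eq (r : ℤ) (hr : 1 ≤ r) (heq : TypeD.act n w x = (2 : ℝ) • fundWeight n r) :
      ∃ v ∈ minReps n r, TypeD.act n v ((2 : ℝ) • fundWeight n r) = x := by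
    obtain ⟨v, hv, hvw⟩ := TypeD.exists_mem_minReps hn hr (inv_mem hw)
    exact ⟨v, hv, by rw [act_smul, hvw, ← act_smul, ← heq, act_inv_act hn hw]⟩
  exact (hdom.eq_two_smul_fundWeight hn (hx.act hn hw) hne').imp (exists_of_eq 1 le_rfl)
    (exists_of_eq 2 one_le_two)

theorem prod_weylGroup_apply {R : Type*} [CommRing R] (hn : 2 ≤ n) {w : Perm ℤ}
    (hw : w ∈ weylGroup n) {f : ℤ → R} (hf : f.Odd) :
    ∏ k ∈ Finset.Icc (1 : ℤ) n, f (w k) = ∏ k ∈ Finset.Icc (1 : ℤ) n, f k := by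
  suffices ∀ f : ℤ → R, f.Odd →
    ∏ k ∈ Finset.Icc (1 : ℤ) n, f (w k) = ∏ k ∈ Finset.Icc (1 : ℤ) n, f k from this f hf
  refine weylGroup_induction (p := fun w => ∀ f : ℤ → R, f.Odd →
    ∏ k ∈ Finset.Icc (1 : ℤ) n, f (w k) = ∏ k ∈ Finset.Icc (1 : ℤ) n, f k) hn
    (fun _ _ => rfl) (fun i w h₁ h₂ _ ih f hf => ?_) hw
  have hodd (k : ℤ) : simpleRefl i (-k) = -simpleRefl i k :=
    weylGroup_apply_neg hn (simpleRefl_mem_weylGroup h₁ h₂) k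
  simp only [Perm.mul_apply]
  rw [ih (fun k => f (simpleRefl i k)) fun k => (congrArg f (hodd k)).trans (hf _)]
  rcases h₁.eq_or_lt with rfl | hi
  · have split (g : ℤ → R) : ∏ k ∈ Finset.Icc (1 : ℤ) n, g k =
        g 1 * (g 2 * ∏ k ∈ Finset.Icc (3 : ℤ) n, g k) := by
      rw [← Finset.insert_Icc_add_one_left_eq_Icc (show (1 : ℤ) ≤ n by omega),
        Finset.prod_insert (by simp), one_add_one_eq_two,
        ← Finset.insert_Icc_add_one_left_eq_Icc (show (2 : ℤ) ≤ n by omega),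
        Finset.prod_insert (by simp), two_add_one_eq_three]
    have hrest : ∀ k ∈ Finset.Icc (3 : ℤ) n, f (simpleRefl 1 k) = f k := by
      intro k hk
      rw [Finset.mem_Icc] at hk
      congr 1
      simp only [simpleRefl, if_pos, Perm.mul_apply, swap_apply_def]
      grind
    have hone : simpleRefl 1 1 = -2 := by simp [simpleRefl, swap_apply_def]
    have htwo : simpleRefl 1 2 = -1 := by simp [simpleRefl, swap_apply_def]
    rw [split, split f, Finset.prod_congr rfl hrest, hone, htwo, hf, hf]
    ring
  · have hmem : ∀ k ∈ Finset.Icc (1 : ℤ) n, simpleRefl i k ∈ Finset.Icc (1 : ℤ) n := by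
      intro k hk
      rw [Finset.mem_Icc] at hk ⊢
      simp only [simpleRefl, if_neg hi.ne', Perm.mul_apply, swap_apply_def]
      grind
    have hinv (k : ℤ) : simpleRefl i (simpleRefl i k) = k := by
      rw [← Perm.mul_apply, simpleRefl_mul_self hn h₁ h₂, Perm.one_apply]
    exact Finset.prod_nbij' _ _ hmem hmem (fun k _ => hinv k) (fun k _ => hinv k) fun _ _ => rfl

/-! ### One-line notation -/

theorem eq_of_pairwise_lt {l₁ l₂ : List ℤ} (h₁ : l₁.Pairwise (· < ·)) (h₂ : l₂.Pairwise (· < ·))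
    (h : ∀ x, x ∈ l₁ ↔ x ∈ l₂) : l₁ = l₂ :=
  List.Perm.eq_of_pairwise (le := (· < ·)) (fun _ _ _ _ hab hba => absurd hba hab.asymm) h₁ h₂
    ((List.perm_ext_iff_of_nodup (h₁.imp ne_of_lt) (h₂.imp ne_of_lt)).2 h)

theorem mem_up {S : Finset ℤ} {x : ℤ} : x ∈ up S ↔ x ∈ S := by simp [up]

theorem pairwise_up (S : Finset ℤ) : (up S).Pairwise (· < ·) := S.sortedLT_sort.pairwise

theorem least_eq {S : Finset ℤ} {a : ℤ} (ha : a ∈ S) (h : ∀ b ∈ S, a ≤ b) : least S = a := by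
  have hmin : S.min = a :=
    le_antisymm (Finset.min_le ha) (Finset.le_min fun b hb => by exact_mod_cast h b hb)
  rw [least, hmin]
  rfl

theorem upNeg_eq_cons {S : Finset ℤ} {a : ℤ} {l : List ℤ} (h : up S = a :: l) :
    upNeg S = -a :: l := by
  have hsorted := pairwise_up S
  rw [h, List.pairwise_cons] at hsorted
  have mem_iff (x : ℤ) : x ∈ S ↔ x = a ∨ x ∈ l := by rw [← mem_up, h, List.mem_cons]
  have hleast : least S = a := least_eq ((mem_iff a).2 (Or.inl rfl)) fun b hb => by
    rcases (mem_iff b).1 hb with rfl | hb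
    · rfl
    · exact (hsorted.1 b hb).le
  rw [upNeg, hleast, eq_of_pairwise_lt (pairwise_up (S.erase a)) hsorted.2 fun x => ?_]
  rw [mem_up, Finset.mem_erase, mem_iff]
  exact ⟨fun ⟨hne, hx⟩ => hx.resolve_left hne, fun hx => ⟨(hsorted.1 x hx).ne', Or.inr hx⟩⟩

/-- The list `(v(a), v(a + 1), …, v(a + m - 1))`, a segment of the one-line notation of `v`. -/
def segment (v : Perm ℤ) (a : ℤ) (m : ℕ) : List ℤ := (List.range m).map fun k : ℕ => v (a + k)

theorem oneLine_eq_segment (v : Perm ℤ) : oneLine n v = segment v 1 n := by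
  simp [oneLine, segment, List.map_eq_flatMap, List.flatMap_assoc, add_comm]

theorem segment_add (v : Perm ℤ) (a : ℤ) (p q : ℕ) :
    segment v a (p + q) = segment v a p ++ segment v (a + p) q := by
  simp [segment, List.range_add, add_assoc]

theorem segment_succ (v : Perm ℤ) (a : ℤ) (m : ℕ) :
    segment v a (m + 1) = v a :: segment v (a + 1) m := by
  rw [add_comm m, segment_add]
  simp [segment]

theorem mem_segment {v : Perm ℤ} {a x : ℤ} {m : ℕ} :
    x ∈ segment v a m ↔ a ≤ v⁻¹ x ∧ v⁻¹ x < a + m := by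
  simp only [segment, List.mem_map, List.mem_range]
  constructor
  · rintro ⟨k, hk, rfl⟩
    rw [Perm.coe_inv, Equiv.symm_apply_apply]
    omega
  · rintro ⟨hge, hlt⟩
    refine ⟨(v⁻¹ x - a).toNat, by omega, ?_⟩
    rw [Int.toNat_of_nonneg (by omega), add_sub_cancel, Perm.coe_inv, Equiv.apply_symm_apply]

theorem pairwise_segment {v : Perm ℤ} {a : ℤ} {m : ℕ}
    (h : ∀ k, a ≤ k → k + 1 < a + m → v k < v (k + 1)) : (segment v a m).Pairwise (· < ·) := by
  induction m generalizing a with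
  | zero => exact List.Pairwise.nil
  | succ m ih =>
    cases m with
    | zero => simp [segment]
    | succ m =>
      have htail := ih (a := a + 1) fun k hk hkm => h k (by omega) (by push_cast at *; omega)
      rw [segment_succ, List.pairwise_cons]
      refine ⟨fun x hx => ?_, htail⟩
      have hhead := h a le_rfl (by push_cast; omega)
      rw [segment_succ] at htail hx
      rcases List.mem_cons.1 hx with rfl | hx
      · exact hhead
      · exact hhead.trans ((List.pairwise_cons.1 htail).1 x hx)

theorem prod_map_sign {l : List ℤ} (h : ∀ x ∈ l, x ≠ 0) :
    (l.map Int.sign).prod = (-1) ^ l.countP (· < 0) := by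
  induction l with
  | nil => rfl
  | cons a l ih =>
    rw [List.forall_mem_cons] at h
    rw [List.map_cons, List.prod_cons, ih h.2, List.countP_cons]
    rcases lt_or_gt_of_ne h.1 with hneg | hpos
    · simp [Int.sign_eq_neg_one_of_neg hneg, hneg, pow_succ]
    · simp [Int.sign_eq_one_of_pos hpos, hpos.not_gt]

theorem even_countP_neg_oneLine (hn : 2 ≤ n) {v : Perm ℤ} (hv : v ∈ weylGroup n) :
    Even ((oneLine n v).countP (· < 0)) := by
  have hne : ∀ x ∈ oneLine n v, x ≠ 0 := by
    intro x hx
    rw [oneLine_eq_segment, mem_segment] at hx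
    exact ((isIndex_weylGroup_apply hn (inv_mem hv)).1 ⟨by omega, by omega, by omega⟩).1
  have hprod : ((oneLine n v).map Int.sign).prod = ∏ k ∈ Finset.Icc (1 : ℤ) n, (v k).sign := by
    rw [oneLine_eq_segment, segment, List.map_map]
    exact Finset.prod_bij' (s := Finset.range n) (fun k _ => 1 + (k : ℤ)) (fun k _ => (k - 1).toNat)
      (fun k hk => by rw [Finset.mem_range] at hk; rw [Finset.mem_Icc]; omega)
      (fun k hk => by rw [Finset.mem_Icc] at hk; rw [Finset.mem_range]; omega)
      (fun k _ => by omega) (fun k hk => by rw [Finset.mem_Icc] at hk; omega) fun _ _ => rfl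
  have hone : ∏ k ∈ Finset.Icc (1 : ℤ) n, (v k).sign = 1 := by
    rw [prod_weylGroup_apply hn hv Int.sign_neg]
    exact Finset.prod_eq_one fun k hk =>
      Int.sign_eq_one_of_pos (one_pos.trans_le (Finset.mem_Icc.1 hk).1)
  rw [prod_map_sign hne, hone] at hprod
  exact (neg_one_pow_eq_one_iff_even (by norm_num)).1 hprod

theorem lt_add_one_of_mem_minReps (hn : 2 ≤ n) {r : ℤ} {v : Perm ℤ} (hv : v ∈ minReps n r) {k : ℤ}
    (h₁ : 1 ≤ k) (h₂ : k + 1 ≤ n) (hk : k + 1 ≠ r) : v k < v (k + 1) := by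
  have := ((mem_minReps_iff hn).1 hv).2 (k + 1) (by omega) h₂ hk
  rwa [lowerIdx, upperIdx, if_neg (by omega), if_neg (by omega), add_sub_cancel_right] at this

theorem neg_lt_of_mem_minReps (hn : 2 ≤ n) {r : ℤ} {v : Perm ℤ} (hv : v ∈ minReps n r)
    (hr : r ≠ 1) : -v 1 < v 2 := by
  have := ((mem_minReps_iff hn).1 hv).2 1 le_rfl (by omega) hr.symm
  rw [lowerIdx, upperIdx, if_pos rfl, if_pos rfl, weylGroup_apply_neg hn hv.1] at this
  omega

theorem coord_eq_iff_of_pos (x : Fin n → ℝ) {p : ℤ → Prop} {c : ℝ} (hc : c ≠ 0)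
    (hpos : ∀ k : ℤ, 1 ≤ k → k ≤ n → (coord x k = c ↔ p k))
    (hneg : ∀ k : ℤ, 1 ≤ k → k ≤ n → (coord x k = -c ↔ p (-k)))
    (hidx : ∀ k, p k → IsIndex n k) (k : ℤ) : coord x k = c ↔ p k := by
  by_cases hk : IsIndex n k
  · obtain ⟨hzero, hge, hle⟩ := hk
    rcases lt_or_gt_of_ne hzero with hlt | hgt
    · have := hneg (-k) (by omega) (by omega)
      rwa [coord_neg_right, neg_inj, neg_neg] at this
    · exact hpos k hgt hle
  · rw [coord_eq_zero x hk]
    exact ⟨fun h => absurd h.symm hc, fun h => absurd (hidx k h) hk⟩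

theorem coord_fundWeight_eq_one_iff {r : ℤ} (hr : 3 ≤ r) {k : ℤ} :
    coord (fundWeight n r) k = 1 ↔ r ≤ k ∧ k ≤ n := by
  refine coord_eq_iff_of_pos (p := fun k => r ≤ k ∧ k ≤ n) _ one_ne_zero (fun k h₁ h₂ => ?_)
    (fun k h₁ h₂ => ?_) (fun k hk => ⟨by omega, by omega, hk.2⟩) k
  all_goals
    rw [coord_fundWeight r h₁ h₂, if_neg (by omega), if_neg (by omega)]
    split_ifs with hrk
  · simp [hrk, h₂]
  · simp [hrk]
  · norm_num
    omega
  · norm_num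
    omega

theorem coord_two_smul_fundWeight_one_eq_one_iff {k : ℤ} :
    coord ((2 : ℝ) • fundWeight n 1) k = 1 ↔ 1 ≤ k ∧ k ≤ n := by
  refine coord_eq_iff_of_pos (p := fun k => 1 ≤ k ∧ k ≤ n) _ one_ne_zero (fun k h₁ h₂ => ?_)
    (fun k h₁ h₂ => ?_) (fun k hk => ⟨by omega, by omega, hk.2⟩) k
  all_goals rw [coord_two_smul_fundWeight_one h₁ h₂]
  · simp [h₁, h₂]
  · norm_num
    omega

theorem coord_two_smul_fundWeight_two_eq_one_iff (hn : 1 ≤ n) {k : ℤ} :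
    coord ((2 : ℝ) • fundWeight n 2) k = 1 ↔ k = -1 ∨ 2 ≤ k ∧ k ≤ n := by
  refine coord_eq_iff_of_pos (p := fun k => k = -1 ∨ 2 ≤ k ∧ k ≤ n) _ one_ne_zero
    (fun k h₁ h₂ => ?_) (fun k h₁ h₂ => ?_) (fun k hk => ⟨by omega, by omega, by omega⟩) k
  all_goals
    rw [coord_two_smul_fundWeight_two h₁ h₂]
    split_ifs with hk
    all_goals norm_num
    all_goals omega

theorem oneLine_eq_of_minReps_one (hn : 2 ≤ n) {v : Perm ℤ} (hv : v ∈ minReps n 1) {T : List ℤ}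
    (hT : T.Pairwise (· < ·))
    (hmem : ∀ j, j ∈ T ↔ coord (act n v ((2 : ℝ) • fundWeight n 1)) j = 1) :
    oneLine n v = T := by
  rw [oneLine_eq_segment]
  refine eq_of_pairwise_lt (pairwise_segment fun k h₁ h₂ =>
    lt_add_one_of_mem_minReps hn hv h₁ (by omega) (by omega)) hT fun x => ?_
  rw [hmem, coord_act hn hv.1, coord_two_smul_fundWeight_one_eq_one_iff, mem_segment]
  omega

theorem pairwise_cons_segment {v : Perm ℤ} {a b : ℤ} {m : ℕ} (hb : b < v a)
    (h : ∀ k, a ≤ k → k + 1 < a + m → v k < v (k + 1)) :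
    (b :: segment v a m).Pairwise (· < ·) := by
  refine List.pairwise_cons.2 ⟨fun x hx => ?_, pairwise_segment h⟩
  have hsorted := pairwise_segment h
  cases m with
  | zero => simp [segment] at hx
  | succ m =>
    rw [segment_succ] at hsorted hx
    rcases List.mem_cons.1 hx with rfl | hx
    · exact hb
    · exact hb.trans ((List.pairwise_cons.1 hsorted).1 x hx)

theorem oneLine_eq_of_minReps_two (hn : 2 ≤ n) {v : Perm ℤ} (hv : v ∈ minReps n 2) {a : ℤ}
    {T : List ℤ} (hT : (a :: T).Pairwise (· < ·))
    (hmem : ∀ j, j ∈ a :: T ↔ coord (act n v ((2 : ℝ) • fundWeight n 2)) j = 1) :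
    oneLine n v = -a :: T := by
  obtain ⟨m, rfl⟩ : ∃ m, n = m + 1 := ⟨n - 1, by omega⟩
  have hsorted : (-v 1 :: segment v 2 m).Pairwise (· < ·) :=
    pairwise_cons_segment (neg_lt_of_mem_minReps hn hv (by norm_num)) fun k h₁ h₂ =>
      lt_add_one_of_mem_minReps hn hv (by omega) (by omega) (by omega)
  have hlist : -v 1 :: segment v 2 m = a :: T := eq_of_pairwise_lt hsorted hT fun x => by
    rw [hmem, coord_act hn hv.1, coord_two_smul_fundWeight_two_eq_one_iff (by omega),
      List.mem_cons, mem_segment, Perm.inv_eq_iff_eq, weylGroup_apply_neg hn hv.1]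
    omega
  rw [List.cons.injEq] at hlist
  rw [oneLine_eq_segment, segment_succ, one_add_one_eq_two, hlist.2, ← hlist.1, neg_neg]

theorem abs_apply_one_lt (hn : 2 ≤ n) {r : ℤ} (hr : 3 ≤ r) {v : Perm ℤ} (hv : v ∈ minReps n r) :
    |v 1| < v 2 := by
  have hlt : v 1 < v (1 + 1) := lt_add_one_of_mem_minReps hn hv le_rfl (by omega) (by omega)
  have hneg := neg_lt_of_mem_minReps hn hv (by omega)
  exact abs_lt.2 ⟨by omega, hlt⟩

theorem mem_abs_cons_segment (hn : 2 ≤ n) {v : Perm ℤ} (hv : v ∈ weylGroup n) {m : ℕ}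
    (hsorted : (|v 1| :: segment v 2 m).Pairwise (· < ·)) {x : ℤ} :
    x ∈ |v 1| :: segment v 2 m ↔ 1 ≤ x ∧ |v⁻¹ x| < 2 + m := by
  have hne : v 1 ≠ 0 := ((isIndex_weylGroup_apply hn hv).2 ⟨by omega, by omega, by omega⟩).1
  have hpos : ∀ k : ℤ, 2 ≤ k → k < 2 + m → 1 ≤ v k := fun k h₁ h₂ => by
    have := (List.pairwise_cons.1 hsorted).1 (v k) (mem_segment.2 (by simp [h₁, h₂]))
    linarith [abs_nonneg (v 1)]
  have hinv : ∀ k, v⁻¹ x = k ↔ x = v k := fun k => Perm.inv_eq_iff_eq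
  have hneg := weylGroup_apply_neg hn hv
  have habs : x = |v 1| ↔ 1 ≤ x ∧ |v⁻¹ x| = 1 := by
    rw [abs_eq zero_le_one, hinv, hinv, hneg]
    rcases abs_cases (v 1) with ⟨h, _⟩ | ⟨h, _⟩ <;> omega
  rw [List.mem_cons, habs, mem_segment]
  have hx : v (v⁻¹ x) = x := by simp
  have hxneg := hneg (v⁻¹ x)
  have hupper := hpos (v⁻¹ x)
  have hlower := hpos (-v⁻¹ x)
  have hzero : v 0 = 0 := weylGroup_apply_of_not_isIndex hn hv fun h => h.1 rfl
  have hinvzero : v⁻¹ x = 0 → x = 0 := fun h => by rw [← hx, h, hzero]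
  rcases abs_cases (v⁻¹ x) with ⟨h, _⟩ | ⟨h, _⟩ <;> rw [h] <;> omega

theorem coord_fundWeight_eq_zero_iff {r : ℤ} (hr : 3 ≤ r) {k : ℤ} (hk : IsIndex n k) :
    coord (fundWeight n r) k = 0 ↔ |k| < r := by
  obtain ⟨hne, hge, hle⟩ := hk
  rcases abs_cases k with ⟨habs, hsign⟩ | ⟨habs, hsign⟩
  · rw [habs, coord_fundWeight r (by omega) hle, if_neg (by omega), if_neg (by omega)]
    simp
  · rw [habs, ← neg_eq_zero, ← coord_neg_right, coord_fundWeight r (by omega) (by omega),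
      if_neg (by omega), if_neg (by omega)]
    simp

theorem pairwise_abs_cons_segment (hn : 2 ≤ n) {p : ℕ} (hp : p ≠ 0) (hpn : 2 + (p : ℤ) ≤ n)
    {v : Perm ℤ} (hv : v ∈ minReps n (2 + p)) : (|v 1| :: segment v 2 p).Pairwise (· < ·) :=
  pairwise_cons_segment (abs_apply_one_lt hn (by omega) hv) fun _ _ _ =>
    lt_add_one_of_mem_minReps hn hv (by omega) (by omega) (by omega)

theorem up_eq_abs_cons_segment (hn : 2 ≤ n) {p : ℕ} (hp : p ≠ 0) (hpn : 2 + (p : ℤ) ≤ n)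
    {v : Perm ℤ} (hv : v ∈ minReps n (2 + p)) {C : Finset ℤ}
    (hC : ∀ j : ℤ, j ∈ C ↔ 1 ≤ j ∧ j ≤ n ∧ coord (act n v (fundWeight n (2 + p))) j = 0) :
    up C = |v 1| :: segment v 2 p := by
  have hsorted := pairwise_abs_cons_segment hn hp hpn hv
  refine eq_of_pairwise_lt (pairwise_up C) hsorted fun x => ?_
  rw [mem_up, hC, mem_abs_cons_segment hn hv.1 hsorted, coord_act hn hv.1]
  have hidx : IsIndex n (v⁻¹ x) ↔ _ := isIndex_weylGroup_apply hn (inv_mem hv.1)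
  have hzero : ∀ {k}, IsIndex n k → (coord (fundWeight n (2 + p)) k = 0 ↔ |k| < 2 + p) :=
    coord_fundWeight_eq_zero_iff (by omega)
  constructor
  · rintro ⟨h₁, h₂, hx⟩
    exact ⟨h₁, (hzero (hidx.2 ⟨by omega, by omega, h₂⟩)).1 hx⟩
  · rintro ⟨h₁, habs⟩
    have hx : IsIndex n x := by
      by_contra hx
      rw [weylGroup_apply_of_not_isIndex hn (inv_mem hv.1) hx, abs_lt] at habs
      exact hx ⟨by omega, by omega, by omega⟩
    exact ⟨h₁, hx.2.2, (hzero (hidx.2 hx)).2 habs⟩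

theorem countP_neg_eq_zero {l : List ℤ} (h : ∀ x ∈ l, 0 ≤ x) : l.countP (· < 0) = 0 :=
  List.countP_eq_zero.2 fun x hx => by simpa using h x hx

theorem oneLine_eq_of_minReps_of_three_le (hn : 2 ≤ n) {r : ℤ} (hr : 3 ≤ r) (hrn : r ≤ n)
    {v : Perm ℤ} (hv : v ∈ minReps n r) {T : List ℤ} (hT : T.Pairwise (· < ·))
    (hmem : ∀ j, j ∈ T ↔ coord (act n v (fundWeight n r)) j = 1) {C : Finset ℤ}
    (hC : ∀ j : ℤ, j ∈ C ↔ 1 ≤ j ∧ j ≤ n ∧ coord (act n v (fundWeight n r)) j = 0) :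
    oneLine n v = (if Even (T.countP (· < 0)) then up C else upNeg C) ++ T := by
  obtain ⟨p, rfl⟩ : ∃ p : ℕ, r = 2 + p := ⟨(r - 2).toNat, by omega⟩
  obtain ⟨q, rfl⟩ : ∃ q : ℕ, n = 1 + p + q := ⟨n - (1 + p), by omega⟩
  have htail : segment v (2 + p) q = T := by
    refine eq_of_pairwise_lt (pairwise_segment fun k h₁ h₂ =>
      lt_add_one_of_mem_minReps hn hv (by omega) (by omega) (by omega)) hT fun x => ?_
    rw [hmem, coord_act hn hv.1, coord_fundWeight_eq_one_iff hr, mem_segment]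
    omega
  have hsplit : oneLine (1 + p + q) v = v 1 :: segment v 2 p ++ T := by
    rw [oneLine_eq_segment, segment_add, add_comm 1 p, segment_succ, ← htail]
    norm_num [add_comm, add_left_comm]
  have hsorted := pairwise_abs_cons_segment hn (by omega) hrn hv
  have hparity := even_countP_neg_oneLine hn hv.1
  rw [hsplit, List.countP_append, List.countP_cons, countP_neg_eq_zero fun x hx =>
    (abs_nonneg _).trans ((List.pairwise_cons.1 hsorted).1 x hx).le] at hparity
  rw [hsplit]
  congr 1
  have hhead := up_eq_abs_cons_segment hn (by omega) hrn hv hC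
  rcases lt_or_ge (v 1) 0 with hneg | hnonneg
  · rw [if_neg fun heven => ?_, upNeg_eq_cons hhead, abs_of_neg hneg, neg_neg]
    simp [hneg, Nat.even_add, heven] at hparity
  · rw [if_pos, hhead, abs_of_nonneg hnonneg]
    simpa [hnonneg.not_gt] using hparity

/-! ### The maximal elements with a given weight -/

/-- The signed indices between `-t` and `t` at which the weight `e e_1 + e_2 + ⋯ + e_t` has
coordinate `1`, in increasing order. -/
noncomputable def headList (t e : ℤ) : List ℤ := (if e = 0 then [] else [e]) ++ up (Finset.Icc 2 t)

/-- The signed indices at which a weight `x` with `HasShape n x t e i` has coordinate `1`, in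
increasing order. -/
noncomputable def shapeList (t e : ℤ) (i : List ℤ) : List ℤ :=
  negRev (primed i) ++ headList t e ++ i

/-- The positive indices at which a weight `x` with `HasShape n x t e i` has coordinate `0`. -/
noncomputable def shapeZeros (n : ℕ) (t e : ℤ) (i : List ℤ) : Finset ℤ :=
  if e = 0 then insert 1 (gaps (t + 1) n i) else gaps (t + 1) n i

theorem mem_headList {t e k : ℤ} :
    k ∈ headList t e ↔ (e ≠ 0 ∧ k = e) ∨ (2 ≤ k ∧ k ≤ t) := by
  rw [headList, List.mem_append, mem_up, Finset.mem_Icc]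
  split_ifs with he <;> simp [he]

theorem mem_negRev_primed {i : List ℤ} {k : ℤ} : k ∈ negRev (primed i) ↔ -k + 1 ∈ i := by
  simp only [negRev, List.mem_reverse, List.mem_map, mem_primed]
  exact ⟨fun ⟨x, hx, hxk⟩ => by rwa [← hxk, neg_neg], fun h => ⟨-k, h, neg_neg k⟩⟩

theorem mem_shapeList {t e k : ℤ} {i : List ℤ} :
    k ∈ shapeList t e i ↔ -k + 1 ∈ i ∨ ((e ≠ 0 ∧ k = e) ∨ (2 ≤ k ∧ k ≤ t)) ∨ k ∈ i := by
  rw [shapeList, List.append_assoc, List.mem_append, List.mem_append, mem_negRev_primed,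
    mem_headList]

theorem mem_gaps {s k : ℤ} {i : List ℤ} :
    k ∈ gaps s n i ↔ s ≤ k ∧ k ≤ n ∧ k ∉ i ∧ k + 1 ∉ i := by
  simp only [gaps, Finset.mem_sdiff, Finset.mem_Icc, Finset.mem_union, List.mem_toFinset,
    mem_primed, not_or, and_assoc]

theorem mem_shapeZeros {t e k : ℤ} {i : List ℤ} :
    k ∈ shapeZeros n t e i ↔ (e = 0 ∧ k = 1) ∨ (t + 1 ≤ k ∧ k ≤ n ∧ k ∉ i ∧ k + 1 ∉ i) := by
  rw [shapeZeros]
  split_ifs with he <;> simp [he, mem_gaps]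

theorem pairwise_headList {t e : ℤ} (he : e < 2) : (headList t e).Pairwise (· < ·) := by
  refine List.pairwise_append.2 ⟨by split_ifs <;> simp, pairwise_up _, fun a ha b hb => ?_⟩
  rw [mem_up, Finset.mem_Icc] at hb
  split_ifs at ha
  · simp at ha
  · rw [List.mem_singleton] at ha
    omega

namespace HasShape

variable {x : Fin n → ℝ} {t e : ℤ} {i : List ℤ}

theorem ext {y : Fin n → ℝ} (hx : HasShape n x t e i) (hy : HasShape n y t e i) : x = y :=
  coord_ext fun k h₁ h₂ => by rw [hx.coord_eq k h₁ h₂, hy.coord_eq k h₁ h₂]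

theorem pairwise_shapeList (h : HasShape n x t e i) : (shapeList t e i).Pairwise (· < ·) := by
  have ht := h.isHead.one_le
  have he := h.isHead.bounds
  have hge (k : ℤ) (hk : k ∈ i) : t + 2 ≤ k := (h.sparse.1 k hk).1
  have hlt : i.Pairwise (· < ·) := h.sparse.2.imp fun hab => by omega
  have hneg : (negRev (primed i)).Pairwise (· < ·) := by
    rw [negRev, List.pairwise_reverse, primed, List.pairwise_map, List.pairwise_map]
    exact hlt.imp fun hab => by omega
  refine List.pairwise_append.2 ⟨List.pairwise_append.2
    ⟨hneg, pairwise_headList (by omega), fun a ha b hb => ?_⟩, hlt, fun a ha b hb => ?_⟩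
  · have := hge _ (mem_negRev_primed.1 ha)
    rw [mem_headList] at hb
    omega
  · have := hge b hb
    rw [List.mem_append, mem_negRev_primed, mem_headList] at ha
    rcases ha with ha | ha
    · have := hge _ ha
      omega
    · omega

theorem mem_shapeList_iff (h : HasShape n x t e i) (k : ℤ) :
    k ∈ shapeList t e i ↔ coord x k = 1 := by
  have hhead := h.isHead
  unfold IsHead at hhead
  have htn := h.le_n
  have hbounds := h.sparse.1
  have hsucc {k : ℤ} (hk : k ∈ i) : k + 1 ∉ i := h.sparse.add_one_notMem hk
  refine (coord_eq_iff_of_pos x (p := (· ∈ shapeList t e i)) one_ne_zero (fun k h₁ h₂ => ?_)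
    (fun k h₁ h₂ => ?_) (fun k hk => ?_) k).symm
  · rw [h.coord_eq k h₁ h₂, Int.cast_eq_one, mem_shapeList]
    unfold shapeCoord rootSumCoord
    grind
  · rw [h.coord_eq k h₁ h₂, mem_shapeList]
    norm_cast
    unfold shapeCoord rootSumCoord
    grind
  · rw [mem_shapeList] at hk
    unfold IsIndex
    grind

theorem mem_shapeZeros_iff (h : HasShape n x t e i) (k : ℤ) :
    k ∈ shapeZeros n t e i ↔ 1 ≤ k ∧ k ≤ n ∧ coord x k = 0 := by
  have ht := h.isHead.one_le
  have htn := h.le_n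
  have hsucc {k : ℤ} (hk : k ∈ i) : k + 1 ∉ i := h.sparse.add_one_notMem hk
  rw [mem_shapeZeros]
  by_cases hk : 1 ≤ k ∧ k ≤ n
  · rw [h.coord_eq k hk.1 hk.2, Int.cast_eq_zero]
    unfold shapeCoord rootSumCoord
    grind
  · omega

theorem countP_shapeList (h : HasShape n x t e i) :
    (shapeList t e i).countP (· < 0) = i.length + if e = -1 then 1 else 0 := by
  have ht := h.isHead.one_le
  have he := h.isHead.bounds
  have hge (k : ℤ) (hk : k ∈ i) : t + 2 ≤ k := (h.sparse.1 k hk).1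
  have hneg : (negRev (primed i)).countP (· < 0) = i.length := by
    rw [List.countP_eq_length.2 fun k hk => ?_]
    · simp [negRev, primed]
    · have := hge _ (mem_negRev_primed.1 hk)
      rw [decide_eq_true_eq]
      omega
  have hhead : (headList t e).countP (· < 0) = if e = -1 then 1 else 0 := by
    rw [headList, List.countP_append, countP_neg_eq_zero (l := up _) fun k hk => ?_, add_zero]
    · rcases (show e = -1 ∨ e = 0 ∨ e = 1 by omega) with rfl | rfl | rfl <;> rfl
    · rw [mem_up, Finset.mem_Icc] at hk
      omega
  rw [shapeList, List.countP_append, List.countP_append, hneg, hhead,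
    countP_neg_eq_zero fun k hk => by have := hge k hk; omega, add_zero]

theorem mem_maximalSet (hn : 2 ≤ n) {r : ℤ} (hr : 1 ≤ r) {v : Perm ℤ} (hv : v ∈ minReps n r)
    (h : HasShape n (act n v (fundWeight n r)) t e i) : v ∈ maximalSet n r :=
  mem_maximalSet_of_isReflMaximal hn hr hv (h.isReflMaximal hn)

theorem exists_isUniqueOfWeight (hn : 2 ≤ n) (h : HasShape n x t e i) {r : ℤ} (hr : 3 ≤ r)
    (hrn : r ≤ n) (hsize : t - 1 + e ^ 2 + 2 * i.length = n + 1 - r) :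
    ∃ v, IsUniqueOfWeight n r x v ∧ v ∈ maximalSet n r ∧
      oneLine n v = (if Even (i.length + if e = -1 then 1 else 0) then up (shapeZeros n t e i)
        else upNeg (shapeZeros n t e i)) ++ shapeList t e i := by
  obtain ⟨v, hv, rfl⟩ :=
    h.isTernary.exists_mem_minReps hn hr hrn (by rw [h.dotProduct_self, hsize])
  refine ⟨v, ⟨hv, rfl, fun u hu heq => minReps_unique hn (by omega) hu hv heq⟩,
    h.mem_maximalSet hn (by omega) hv, ?_⟩
  rw [← h.countP_shapeList]
  exact oneLine_eq_of_minReps_of_three_le hn hr hrn hv h.pairwise_shapeList h.mem_shapeList_iff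
    h.mem_shapeZeros_iff

end HasShape

theorem isTernary_fundWeight {r : ℤ} (hr : 3 ≤ r) : IsTernary (fundWeight n r) :=
  isTernary_of_pos fun k h₁ h₂ => by
    rw [coord_fundWeight r h₁ h₂, if_neg (by omega), if_neg (by omega)]
    split_ifs
    · exact ⟨1, by simp⟩
    · exact ⟨0, by simp⟩

theorem fundWeight_dotProduct_self {r : ℤ} (hr : 3 ≤ r) (hrn : r ≤ n) :
    fundWeight n r ⬝ᵥ fundWeight n r = ((n + 1 - r : ℤ) : ℝ) := by
  have hone : ∀ k ∈ Finset.Icc r (n : ℤ), coord (fundWeight n r) k = 1 := fun k hk =>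
    (coord_fundWeight_eq_one_iff hr).2 (Finset.mem_Icc.1 hk)
  rw [dotProduct_fundWeight_of_three_le _ hr, suffixSum, Finset.sum_congr rfl hone,
    Finset.sum_const, nsmul_one, Int.card_Icc, ← Int.cast_natCast, Int.toNat_of_nonneg (by omega)]

theorem mem_maximalSet_iff_exists_hasShape (hn : 3 ≤ n) {r : ℤ} (hr : 3 ≤ r) (hrn : r ≤ n)
    {v : Perm ℤ} :
    v ∈ maximalSet n r ↔ v ∈ minReps n r ∧ ∃ t e i,
      HasShape n (act n v (fundWeight n r)) t e i ∧
        t - 1 + e ^ 2 + 2 * (i.length : ℤ) = n + 1 - r := by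
  have hn₂ : 2 ≤ n := by omega
  refine ⟨fun hv => ⟨hv.1, ?_⟩, fun ⟨hv, t, e, i, h, _⟩ => h.mem_maximalSet hn₂ (by omega) hv⟩
  obtain ⟨t, e, i, h⟩ := (isSimpleMaximal_of_mem_maximalSet hn₂ (by omega) hv).exists_hasShape hn
    ((isTernary_fundWeight hr).act hn₂ hv.1.1)
  refine ⟨t, e, i, h, ?_⟩
  have hself := h.dotProduct_self
  rw [act_dotProduct_act hn₂ hv.1.1, fundWeight_dotProduct_self hr hrn] at hself
  exact_mod_cast hself.symm

/-! ### The weights in the proposition -/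

theorem hasShape_add_rootSum {t e : ℤ} (hhead : IsHead t e) (htn : t ≤ n) {b : Fin n → ℝ}
    (hb : ∀ k : ℤ, 1 ≤ k → k ≤ n →
      coord b k = ((if k = 1 then e else if k ≤ t then 1 else 0 : ℤ) : ℝ))
    {i : List ℤ} (hi : Sparse (t + 2) n i) : HasShape n (b + rootSum n i) t e i := by
  have ht := hhead.one_le
  refine ⟨hhead, htn, hi, fun k h₁ h₂ => ?_⟩
  have hzero (hk : k ≤ t) : rootSumCoord i k = 0 := by
    rw [rootSumCoord, if_neg (hi.notMem_of_lt (by omega)), if_neg (hi.notMem_of_lt (by omega)),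
      sub_zero]
  rw [coord_add, hb k h₁ h₂, coord_rootSum (by omega) hi h₁ h₂, ← Int.cast_add, Int.cast_inj,
    shapeCoord]
  split_ifs with hone hkt
  · rw [hzero (by omega), add_zero]
  · rw [hzero hkt, add_zero]
  · rw [zero_add]

theorem hasShape_rootSum (hn : 1 ≤ n) {i : List ℤ} (hi : Sparse 3 n i) :
    HasShape n (rootSum n i) 1 0 i := by
  rw [← zero_add (rootSum n i)]
  refine hasShape_add_rootSum (Or.inl ⟨rfl, rfl⟩) (by omega) (fun k h₁ _ => ?_) hi
  rw [show (0 : Fin n → ℝ) = (0 : ℝ) • 0 by simp, coord_smul]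
  split_ifs
  · simp
  · omega
  · simp

theorem coord_simpleRoot_one {k : ℤ} (h₁ : 1 ≤ k) (h₂ : k ≤ n) :
    coord (simpleRoot n 1) k = if k ≤ 2 then 1 else 0 := by
  rw [simpleRoot_eq_root, coord_root ⟨by omega, by omega, h₂⟩]
  unfold lowerIdx upperIdx
  grind

theorem hasShape_two (hn : 2 ≤ n) {e : ℤ} (he : e = -1 ∨ e = 0 ∨ e = 1) {i : List ℤ}
    (hi : Sparse 4 n i) :
    HasShape n (((1 + e) / 2 : ℝ) • simpleRoot n 1 + ((1 - e) / 2 : ℝ) • simpleRoot n 2 +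
      rootSum n i) 2 e i := by
  refine hasShape_add_rootSum (Or.inr (Or.inl ⟨rfl, he⟩)) (by omega) (fun k h₁ h₂ => ?_) hi
  rw [coord_add, coord_smul, coord_smul, coord_simpleRoot_one h₁ h₂,
    coord_simpleRoot le_rfl h₁ h₂]
  split_ifs <;> first | omega | (push_cast; ring)

theorem hasShape_three (hn : 3 ≤ n) {e : ℤ} (he : e = -1 ∨ e = 1) {i : List ℤ}
    (hi : Sparse 5 n i) :
    HasShape n ((1 + e / 2 : ℝ) • simpleRoot n 1 + (1 - e / 2 : ℝ) • simpleRoot n 2 +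
      simpleRoot n 3 + rootSum n i) 3 e i := by
  refine hasShape_add_rootSum (Or.inr (Or.inr ⟨rfl, he⟩)) (by omega) (fun k h₁ h₂ => ?_) hi
  rw [coord_add, coord_add, coord_smul, coord_smul, coord_simpleRoot_one h₁ h₂,
    coord_simpleRoot le_rfl h₁ h₂, coord_simpleRoot (by norm_num) h₁ h₂]
  split_ifs <;> first | omega | (push_cast; ring)

theorem hasShape_simpleRoot_one_add (hn : 2 ≤ n) {i : List ℤ} (hi : Sparse 4 n i) :
    HasShape n (simpleRoot n 1 + rootSum n i) 2 1 i := by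
  simpa using hasShape_two hn (Or.inr (Or.inr rfl)) hi

theorem hasShape_simpleRoot_two_add (hn : 2 ≤ n) {i : List ℤ} (hi : Sparse 4 n i) :
    HasShape n (simpleRoot n 2 + rootSum n i) 2 (-1) i := by
  simpa [one_add_one_eq_two] using hasShape_two hn (Or.inl rfl) hi

theorem hasShape_half_half (hn : 2 ≤ n) {i : List ℤ} (hi : Sparse 4 n i) :
    HasShape n ((1 / 2 : ℝ) • simpleRoot n 1 + (1 / 2 : ℝ) • simpleRoot n 2 +
      rootSum n i) 2 0 i := by
  simpa using hasShape_two hn (Or.inr (Or.inl rfl)) hi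

theorem hasShape_threeHalves_half (hn : 3 ≤ n) {i : List ℤ} (hi : Sparse 5 n i) :
    HasShape n ((3 / 2 : ℝ) • simpleRoot n 1 + (1 / 2 : ℝ) • simpleRoot n 2 + simpleRoot n 3 +
      rootSum n i) 3 1 i := by
  convert hasShape_three hn (Or.inr rfl) hi using 5 <;> norm_num

theorem hasShape_half_threeHalves (hn : 3 ≤ n) {i : List ℤ} (hi : Sparse 5 n i) :
    HasShape n ((1 / 2 : ℝ) • simpleRoot n 1 + (3 / 2 : ℝ) • simpleRoot n 2 + simpleRoot n 3 +
      rootSum n i) 3 (-1) i := by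
  convert hasShape_three hn (Or.inl rfl) hi using 5 <;> norm_num

/-! ### The cases `3 ≤ r ≤ n` -/

theorem up_insert_of_lt {S : Finset ℤ} {a : ℤ} (h : ∀ b ∈ S, a < b) :
    up (insert a S) = a :: up S :=
  Finset.sort_insert _ (fun b hb => (h b hb).le) fun ha => (h a ha).false

theorem up_Icc_two_three : up (Finset.Icc 2 3) = [2, 3] := by
  rw [show Finset.Icc (2 : ℤ) 3 = {2, 3} from rfl, up_insert_of_lt (by simp)]
  simp [up]

theorem ite_even_up_insert_one {S : Finset ℤ} (h : ∀ b ∈ S, 1 < b) (m : ℕ) :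
    (if Even m then up (insert 1 S) else upNeg (insert 1 S)) =
      [if Odd m then -1 else 1] ++ up S := by
  have hup := up_insert_of_lt h
  rw [hup, upNeg_eq_cons hup]
  by_cases hm : Even m
  · rw [if_pos hm, if_neg (Nat.not_odd_iff_even.2 hm), List.singleton_append]
  · rw [if_neg hm, if_pos (Nat.not_even_iff_odd.1 hm), List.singleton_append]

section

variable {r : ℤ} {x : Fin n → ℝ} {t : ℤ} {i : List ℤ}

theorem HasShape.exists_isUniqueOfWeight_zero (hn : 2 ≤ n) (h : HasShape n x t 0 i)
    (hr : 3 ≤ r) (hrn : r ≤ n) (hsize : t - 1 + 2 * i.length = n + 1 - r) :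
    ∃ v, IsUniqueOfWeight n r x v ∧ v ∈ maximalSet n r ∧
      oneLine n v = [if Odd i.length then -1 else 1] ++ up (gaps (t + 1) n i) ++
        negRev (primed i) ++ up (Finset.Icc 2 t) ++ i := by
  have hgaps : ∀ b ∈ gaps (t + 1) n i, 1 < b := fun b hb => by
    have := h.isHead.one_le
    have := (mem_gaps.1 hb).1
    omega
  obtain ⟨v, hv, hmax, hone⟩ := h.exists_isUniqueOfWeight hn hr hrn (by omega)
  refine ⟨v, hv, hmax, ?_⟩
  rw [hone, if_neg (show ¬(0 : ℤ) = -1 by norm_num), add_zero, shapeZeros, if_pos rfl,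
    ite_even_up_insert_one hgaps, shapeList, headList, if_pos rfl]
  simp only [List.nil_append, List.append_assoc]

theorem HasShape.exists_isUniqueOfWeight_one (hn : 2 ≤ n) (h : HasShape n x t 1 i)
    (hr : 3 ≤ r) (hrn : r ≤ n) (hsize : t + 2 * i.length = n + 1 - r) :
    ∃ v, IsUniqueOfWeight n r x v ∧ v ∈ maximalSet n r ∧
      oneLine n v = (if Odd (i.length + 1) then up (gaps (t + 1) n i)
        else upNeg (gaps (t + 1) n i)) ++
        negRev (primed i) ++ (1 :: up (Finset.Icc 2 t)) ++ i := by
  obtain ⟨v, hv, hmax, hone⟩ := h.exists_isUniqueOfWeight hn hr hrn (by omega)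
  refine ⟨v, hv, hmax, ?_⟩
  rw [hone, if_neg (show ¬(1 : ℤ) = -1 by norm_num), add_zero, shapeZeros, if_neg one_ne_zero,
    shapeList, headList, if_neg one_ne_zero]
  simp only [Nat.odd_add_one, Nat.not_odd_iff_even, List.singleton_append, List.append_assoc]

theorem HasShape.exists_isUniqueOfWeight_neg_one (hn : 2 ≤ n) (h : HasShape n x t (-1) i)
    (hr : 3 ≤ r) (hrn : r ≤ n) (hsize : t + 2 * i.length = n + 1 - r) :
    ∃ v, IsUniqueOfWeight n r x v ∧ v ∈ maximalSet n r ∧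
      oneLine n v = (if Odd (i.length + 1) then upNeg (gaps (t + 1) n i)
        else up (gaps (t + 1) n i)) ++
        negRev (primed i) ++ (-1 :: up (Finset.Icc 2 t)) ++ i := by
  have hne : (-1 : ℤ) ≠ 0 := by norm_num
  obtain ⟨v, hv, hmax, hone⟩ := h.exists_isUniqueOfWeight hn hr hrn (by omega)
  refine ⟨v, hv, hmax, ?_⟩
  rw [hone, if_pos rfl, shapeZeros, if_neg hne, shapeList, headList, if_neg hne]
  simp only [← Nat.not_even_iff_odd, ite_not, List.singleton_append, List.append_assoc]

end

theorem rootSum_cons (x : ℤ) (i : List ℤ) : rootSum n (x :: i) = simpleRoot n x + rootSum n i := by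
  rw [rootSum, List.map_cons, List.sum_cons, rootSum]

section

variable {r : ℤ} {m : ℕ} {i : List ℤ}

theorem exists_maximal_rootSum (hn : 3 ≤ n) (hr : 3 ≤ r) (hrn : r ≤ n)
    (hm : (n : ℤ) + 1 - r = 2 * m) (hi : i ∈ J m 3 n) :
    ∃ v, IsUniqueOfWeight n r (rootSum n i) v ∧ v ∈ maximalSet n r ∧
      oneLine n v = [if Odd m then -1 else 1] ++ up (gaps 2 n i) ++ negRev (primed i) ++ i := by
  obtain ⟨rfl, hsparse⟩ := mem_J_iff.1 hi
  simpa [up] using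
    (hasShape_rootSum (by omega) hsparse).exists_isUniqueOfWeight_zero (by omega) hr hrn (by omega)

theorem exists_maximal_simpleRoot_one_add (hn : 3 ≤ n) (hr : 3 ≤ r) (hrn : r ≤ n)
    (hm : (n : ℤ) + 1 - r = 2 * m) (hi : i ∈ J (m - 1) 4 n) :
    ∃ v, IsUniqueOfWeight n r (simpleRoot n 1 + rootSum n i) v ∧ v ∈ maximalSet n r ∧
      oneLine n v = (if Odd m then up (gaps 3 n i) else upNeg (gaps 3 n i)) ++
        negRev (primed i) ++ [1, 2] ++ i := by
  obtain ⟨k, rfl⟩ : ∃ k, m = k + 1 := ⟨m - 1, by omega⟩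
  obtain ⟨rfl, hsparse⟩ := mem_J_iff.1 hi
  simpa [up] using (hasShape_simpleRoot_one_add (by omega) hsparse).exists_isUniqueOfWeight_one
    (by omega) hr hrn (by omega)

theorem exists_maximal_simpleRoot_two_add (hn : 3 ≤ n) (hr : 3 ≤ r) (hrn : r ≤ n)
    (hm : (n : ℤ) + 1 - r = 2 * m) (hi : i ∈ J (m - 1) 4 n) :
    ∃ v, IsUniqueOfWeight n r (simpleRoot n 2 + rootSum n i) v ∧ v ∈ maximalSet n r ∧
      oneLine n v = (if Odd m then upNeg (gaps 3 n i) else up (gaps 3 n i)) ++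
        negRev (primed i) ++ [-1, 2] ++ i := by
  obtain ⟨k, rfl⟩ : ∃ k, m = k + 1 := ⟨m - 1, by omega⟩
  obtain ⟨rfl, hsparse⟩ := mem_J_iff.1 hi
  simpa [up] using (hasShape_simpleRoot_two_add (by omega) hsparse).exists_isUniqueOfWeight_neg_one
    (by omega) hr hrn (by omega)

theorem exists_maximal_of_mem_J_diff_Z (hn : 3 ≤ n) (hr : 3 ≤ r) (hrn : r ≤ n)
    (hm : (n : ℤ) + 1 - r = 2 * m) (hi : i ∈ J m 1 n \ Z m n) :
    ∃ v, IsUniqueOfWeight n r (rootSum n i) v ∧ v ∈ maximalSet n r := by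
  obtain ⟨⟨hlen, hsparse⟩, hZ⟩ := And.imp_left mem_J_iff.1 hi
  match i with
  | [] => simp at hlen; omega
  | x :: i =>
    have hlen' : i.length = m - 1 := by simp at hlen; omega
    obtain ⟨hx, hxn, htail⟩ := sparse_cons.1 hsparse
    rw [rootSum_cons]
    rcases (show x = 1 ∨ x = 2 ∨ 3 ≤ x by omega) with rfl | rfl | hx₃
    · have hi₄ : Sparse 4 n i := by
        match i with
        | [] => exact sparse_nil _ _
        | y :: i =>
          obtain ⟨hy, hyn, htail⟩ := sparse_cons.1 htail
          have hy₃ : y ≠ 3 := by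
            rintro rfl
            exact hZ ⟨i, by simpa using hlen, mem_J_iff.2 ⟨rfl, htail⟩, rfl⟩
          exact sparse_cons.2 ⟨by omega, hyn, htail⟩
      obtain ⟨v, hv, hmax, -⟩ :=
        exists_maximal_simpleRoot_one_add hn hr hrn hm (mem_J_iff.2 ⟨hlen', hi₄⟩)
      exact ⟨v, hv, hmax⟩
    · obtain ⟨v, hv, hmax, -⟩ :=
        exists_maximal_simpleRoot_two_add hn hr hrn hm (mem_J_iff.2 ⟨hlen', htail⟩)
      exact ⟨v, hv, hmax⟩
    · obtain ⟨v, hv, hmax, -⟩ := exists_maximal_rootSum hn hr hrn hm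
        (mem_J_iff.2 ⟨hlen, sparse_cons.2 ⟨hx₃, hxn, htail⟩⟩)
      exact ⟨v, rootSum_cons x i ▸ hv, hmax⟩

theorem mem_maximalSet_iff_of_even (hn : 3 ≤ n) (hr : 3 ≤ r) (hrn : r ≤ n)
    (hm : (n : ℤ) + 1 - r = 2 * m) (v : Perm ℤ) :
    v ∈ maximalSet n r ↔ v ∈ minReps n r ∧
      ((∃ i ∈ J m 3 n, act n v (fundWeight n r) = rootSum n i) ∨
      (∃ i ∈ J (m - 1) 4 n, act n v (fundWeight n r) = simpleRoot n 1 + rootSum n i) ∨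
      (∃ i ∈ J (m - 1) 4 n, act n v (fundWeight n r) = simpleRoot n 2 + rootSum n i)) := by
  have hn₁ : 1 ≤ n := by omega
  have hn₂ : 2 ≤ n := by omega
  rw [mem_maximalSet_iff_exists_hasShape hn hr hrn, hm]
  refine and_congr_right fun _ => ⟨?_, ?_⟩
  · rintro ⟨t, e, i, h, hsize⟩
    have hi := h.sparse
    rcases h.isHead with ⟨rfl, rfl⟩ | ⟨rfl, rfl | rfl | rfl⟩ | ⟨rfl, rfl | rfl⟩
    · exact Or.inl ⟨i, mem_J_iff.2 ⟨by omega, hi⟩, h.ext (hasShape_rootSum hn₁ hi)⟩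
    · exact Or.inr (Or.inr ⟨i, mem_J_iff.2 ⟨by omega, hi⟩,
        h.ext (hasShape_simpleRoot_two_add hn₂ hi)⟩)
    · omega
    · exact Or.inr (Or.inl ⟨i, mem_J_iff.2 ⟨by omega, hi⟩,
        h.ext (hasShape_simpleRoot_one_add hn₂ hi)⟩)
    · omega
    · omega
  · rintro (⟨i, hi, hweight⟩ | ⟨i, hi, hweight⟩ | ⟨i, hi, hweight⟩) <;>
      obtain ⟨hlen, hsparse⟩ := mem_J_iff.1 hi <;> rw [hweight]
    · exact ⟨1, 0, i, hasShape_rootSum hn₁ hsparse, by omega⟩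
    · exact ⟨2, 1, i, hasShape_simpleRoot_one_add hn₂ hsparse, by omega⟩
    · exact ⟨2, -1, i, hasShape_simpleRoot_two_add hn₂ hsparse, by omega⟩

theorem exists_maximal_half_half (hn : 3 ≤ n) (hr : 3 ≤ r) (hrn : r ≤ n)
    (hm : (n : ℤ) + 1 - r = 2 * m + 1) (hi : i ∈ J m 4 n) :
    ∃ v, IsUniqueOfWeight n r ((1 / 2 : ℝ) • simpleRoot n 1 + (1 / 2 : ℝ) • simpleRoot n 2 +
        rootSum n i) v ∧ v ∈ maximalSet n r ∧
      oneLine n v = [if Odd m then -1 else 1] ++ up (gaps 3 n i) ++ negRev (primed i) ++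
        [2] ++ i := by
  obtain ⟨rfl, hsparse⟩ := mem_J_iff.1 hi
  simpa [up] using (hasShape_half_half (by omega) hsparse).exists_isUniqueOfWeight_zero
    (by omega) hr hrn (by omega)

theorem exists_maximal_threeHalves_half (hn : 3 ≤ n) (hr : 3 ≤ r) (hrn : r ≤ n)
    (hm : (n : ℤ) + 1 - r = 2 * m + 1) (hpos : 1 ≤ m) (hi : i ∈ J (m - 1) 5 n) :
    ∃ v, IsUniqueOfWeight n r ((3 / 2 : ℝ) • simpleRoot n 1 + (1 / 2 : ℝ) • simpleRoot n 2 +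
        simpleRoot n 3 + rootSum n i) v ∧ v ∈ maximalSet n r ∧
      oneLine n v = (if Odd m then up (gaps 4 n i) else upNeg (gaps 4 n i)) ++
        negRev (primed i) ++ [1, 2, 3] ++ i := by
  obtain ⟨k, rfl⟩ : ∃ k, m = k + 1 := ⟨m - 1, by omega⟩
  obtain ⟨rfl, hsparse⟩ := mem_J_iff.1 hi
  simpa [up_Icc_two_three] using (hasShape_threeHalves_half hn hsparse).exists_isUniqueOfWeight_one
    (by omega) hr hrn (by omega)

theorem exists_maximal_half_threeHalves (hn : 3 ≤ n) (hr : 3 ≤ r) (hrn : r ≤ n)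
    (hm : (n : ℤ) + 1 - r = 2 * m + 1) (hpos : 1 ≤ m) (hi : i ∈ J (m - 1) 5 n) :
    ∃ v, IsUniqueOfWeight n r ((1 / 2 : ℝ) • simpleRoot n 1 + (3 / 2 : ℝ) • simpleRoot n 2 +
        simpleRoot n 3 + rootSum n i) v ∧ v ∈ maximalSet n r ∧
      oneLine n v = (if Odd m then upNeg (gaps 4 n i) else up (gaps 4 n i)) ++
        negRev (primed i) ++ [-1, 2, 3] ++ i := by
  obtain ⟨k, rfl⟩ : ∃ k, m = k + 1 := ⟨m - 1, by omega⟩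
  obtain ⟨rfl, hsparse⟩ := mem_J_iff.1 hi
  simpa [up_Icc_two_three] using
    (hasShape_half_threeHalves hn hsparse).exists_isUniqueOfWeight_neg_one (by omega) hr hrn
      (by omega)

theorem mem_maximalSet_iff_of_odd (hn : 3 ≤ n) (hr : 3 ≤ r) (hrn : r ≤ n)
    (hm : (n : ℤ) + 1 - r = 2 * m + 1) (hpos : 1 ≤ m) (v : Perm ℤ) :
    v ∈ maximalSet n r ↔ v ∈ minReps n r ∧
      ((∃ i ∈ J m 4 n, act n v (fundWeight n r) =
        (1 / 2 : ℝ) • simpleRoot n 1 + (1 / 2 : ℝ) • simpleRoot n 2 + rootSum n i) ∨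
      (∃ i ∈ J (m - 1) 5 n, act n v (fundWeight n r) =
        (3 / 2 : ℝ) • simpleRoot n 1 + (1 / 2 : ℝ) • simpleRoot n 2 + simpleRoot n 3 +
          rootSum n i) ∨
      (∃ i ∈ J (m - 1) 5 n, act n v (fundWeight n r) =
        (1 / 2 : ℝ) • simpleRoot n 1 + (3 / 2 : ℝ) • simpleRoot n 2 + simpleRoot n 3 +
          rootSum n i)) := by
  have hn₂ : 2 ≤ n := by omega
  rw [mem_maximalSet_iff_exists_hasShape hn hr hrn, hm]
  refine and_congr_right fun _ => ⟨?_, ?_⟩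
  · rintro ⟨t, e, i, h, hsize⟩
    have hi := h.sparse
    rcases h.isHead with ⟨rfl, rfl⟩ | ⟨rfl, rfl | rfl | rfl⟩ | ⟨rfl, rfl | rfl⟩
    · omega
    · omega
    · exact Or.inl ⟨i, mem_J_iff.2 ⟨by omega, hi⟩, h.ext (hasShape_half_half hn₂ hi)⟩
    · omega
    · exact Or.inr (Or.inr ⟨i, mem_J_iff.2 ⟨by omega, hi⟩,
        h.ext (hasShape_half_threeHalves hn hi)⟩)
    · exact Or.inr (Or.inl ⟨i, mem_J_iff.2 ⟨by omega, hi⟩,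
        h.ext (hasShape_threeHalves_half hn hi)⟩)
  · rintro (⟨i, hi, hweight⟩ | ⟨i, hi, hweight⟩ | ⟨i, hi, hweight⟩) <;>
      obtain ⟨hlen, hsparse⟩ := mem_J_iff.1 hi <;> rw [hweight]
    · exact ⟨2, 0, i, hasShape_half_half hn₂ hsparse, by omega⟩
    · exact ⟨3, 1, i, hasShape_threeHalves_half hn hsparse, by omega⟩
    · exact ⟨3, -1, i, hasShape_half_threeHalves hn hsparse, by omega⟩

end

theorem exists_maximalSet_self_eq_singleton (hn : 3 ≤ n) :
    ∃ v, maximalSet n n = {v} ∧ oneLine n v = [1] ++ up (Finset.Icc 3 (n : ℤ)) ++ [2] ∧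
      act n v (fundWeight n n) =
        (1 / 2 : ℝ) • simpleRoot n 1 + (1 / 2 : ℝ) • simpleRoot n 2 := by
  have hr : (3 : ℤ) ≤ n := by omega
  obtain ⟨v, ⟨-, hweight, hunique⟩, hmax, hone⟩ := exists_maximal_half_half (m := 0) hn hr le_rfl
    (by simp) (mem_J_iff.2 ⟨rfl, sparse_nil 4 n⟩)
  refine ⟨v, Set.eq_singleton_iff_unique_mem.2 ⟨hmax, fun u hu => hunique u hu.1 ?_⟩, ?_, ?_⟩
  · obtain ⟨-, t, e, i, h, hsize⟩ := (mem_maximalSet_iff_exists_hasShape hn hr le_rfl).1 hu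
    obtain ⟨rfl, rfl, hlen⟩ : t = 2 ∧ e = 0 ∧ i.length = 0 := by
      rcases h.isHead with ⟨rfl, rfl⟩ | ⟨rfl, rfl | rfl | rfl⟩ | ⟨rfl, rfl | rfl⟩ <;> omega
    rw [List.length_eq_zero_iff] at hlen
    subst hlen
    exact h.ext (hasShape_half_half (by omega) (sparse_nil 4 n))
  · simpa [gaps, negRev, primed] using hone
  · simpa [rootSum] using hweight

/-! ### The cases `r = 1` and `r = 2` -/

theorem steps_eq_map (a : ℤ) (k : ℕ) :
    steps a k = (List.range k).map fun j : ℕ => a + 2 * (j : ℤ) := by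
  simp [steps, List.map_eq_flatMap, List.flatMap_assoc]

theorem steps_zero (a : ℤ) : steps a 0 = [] := by
  rw [steps_eq_map, List.range_zero, List.map_nil]

theorem steps_succ (a : ℤ) (k : ℕ) : steps a (k + 1) = a :: steps (a + 2) k := by
  rw [steps_eq_map, steps_eq_map, List.range_succ_eq_map, List.map_cons, List.map_map,
    Nat.cast_zero, mul_zero, add_zero]
  congr 2 with j
  rw [Function.comp_apply, Nat.cast_succ]
  ring

theorem steps_succ_last (a : ℤ) (k : ℕ) : steps a (k + 1) = steps a k ++ [a + 2 * k] := by
  rw [steps_eq_map, steps_eq_map, List.range_succ, List.map_append, List.map_singleton]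

theorem length_steps (a : ℤ) (k : ℕ) : (steps a k).length = k := by
  rw [steps_eq_map, List.length_map, List.length_range]

theorem sparse_steps {a t : ℤ} {k : ℕ} (h : a + 2 * k ≤ t + 2) : Sparse a t (steps a k) := by
  induction k generalizing a with
  | zero => exact steps_zero a ▸ sparse_nil a t
  | succ k ih => exact steps_succ a k ▸ sparse_cons.2 ⟨le_rfl, by omega, ih (by omega)⟩

theorem Sparse.le_of_cons {a t x : ℤ} {i : List ℤ} (h : Sparse a t (x :: i)) :
    x + 2 * i.length ≤ t := by
  induction i generalizing a x with
  | nil => simpa using (sparse_cons.1 h).2.1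
  | cons y i ih =>
    obtain ⟨-, -, htail⟩ := sparse_cons.1 h
    have := (sparse_cons.1 htail).1
    have := ih htail
    rw [List.length_cons]
    omega

theorem Sparse.eq_steps {a t : ℤ} {i : List ℤ} (h : Sparse a t i) (ht : t + 1 < a + 2 * i.length) :
    i = steps a i.length := by
  induction i generalizing a with
  | nil => exact (steps_zero a).symm
  | cons x i ih =>
    obtain ⟨hx, -, htail⟩ := sparse_cons.1 h
    have hle := h.le_of_cons
    rw [List.length_cons] at ht ⊢
    obtain rfl : x = a := by omega
    rw [steps_succ, ← ih htail (by omega)]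

theorem negRev_primed_steps (a : ℤ) (k : ℕ) :
    negRev (primed (steps a k)) = steps (-(a + 2 * k - 3)) k := by
  induction k generalizing a with
  | zero => rw [steps_zero, steps_zero]; rfl
  | succ k ih =>
    have hcons : negRev (primed (a :: steps (a + 2) k)) =
        negRev (primed (steps (a + 2) k)) ++ [-(a - 1)] := by simp [negRev, primed]
    rw [steps_succ, hcons, ih, steps_succ_last, Nat.cast_succ]
    congr 2 <;> ring

theorem rootSum_append_singleton (i : List ℤ) (x : ℤ) :
    rootSum n (i ++ [x]) = rootSum n i + simpleRoot n x := by
  simp [rootSum]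

theorem rootSum_steps (a : ℤ) (q : ℕ) :
    rootSum n (steps a q) = ∑ i ∈ Finset.Icc 2 (q + 1), simpleRoot n (2 * (i : ℤ) + (a - 4)) := by
  induction q with
  | zero => simp [steps_zero, rootSum]
  | succ q ih =>
    rw [steps_succ_last, rootSum_append_singleton, ih,
      Finset.sum_Icc_succ_top (b := q + 1) (by omega)]
    congr 2
    push_cast
    ring

theorem coord_two_smul_fundWeight_mul_self {r : ℤ} (hr : r = 1 ∨ r = 2) {k : ℤ} (h₁ : 1 ≤ k)
    (h₂ : k ≤ n) :
    coord ((2 : ℝ) • fundWeight n r) k * coord ((2 : ℝ) • fundWeight n r) k = 1 := by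
  rcases hr with rfl | rfl
  · rw [coord_two_smul_fundWeight_one h₁ h₂, one_mul]
  · rw [coord_two_smul_fundWeight_two h₁ h₂]
    split_ifs <;> norm_num

theorem isTernary_two_smul_fundWeight {r : ℤ} (hr : r = 1 ∨ r = 2) :
    IsTernary ((2 : ℝ) • fundWeight n r) :=
  isTernary_of_pos fun k h₁ h₂ => by
    rcases mul_self_eq_one_iff.1 (coord_two_smul_fundWeight_mul_self hr h₁ h₂) with hk | hk
    · exact ⟨1, by simp [hk]⟩
    · exact ⟨-1, by simp [hk]⟩

theorem two_smul_fundWeight_dotProduct_self {r : ℤ} (hr : r = 1 ∨ r = 2) :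
    ((2 : ℝ) • fundWeight n r) ⬝ᵥ ((2 : ℝ) • fundWeight n r) = n := by
  rw [dotProduct_eq_sum_coord, Finset.sum_congr rfl fun k hk => ?_, Finset.sum_const (1 : ℝ)]
  · simp
  · rw [Finset.mem_Icc] at hk
    exact coord_two_smul_fundWeight_mul_self hr hk.1 hk.2

theorem IsTernary.coord_ne_zero {x : Fin n → ℝ} (hx : IsTernary x) (hdot : x ⬝ᵥ x = n)
    {k : ℤ} (h₁ : 1 ≤ k) (h₂ : k ≤ n) : coord x k ≠ 0 := by
  intro hzero
  have hsum : ∑ k ∈ Finset.Icc (1 : ℤ) n, (1 - coord x k * coord x k) = 0 := by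
    rw [Finset.sum_sub_distrib, ← dotProduct_eq_sum_coord, hdot]
    simp
  have hnonneg : ∀ k ∈ Finset.Icc (1 : ℤ) n, 0 ≤ 1 - coord x k * coord x k := by
    intro k _
    obtain ⟨c, hc, hge, hle⟩ := hx k
    rw [hc]
    rcases (show c = -1 ∨ c = 0 ∨ c = 1 by omega) with rfl | rfl | rfl <;> norm_num
  have := (Finset.sum_eq_zero_iff_of_nonneg hnonneg).1 hsum k (Finset.mem_Icc.2 ⟨h₁, h₂⟩)
  simp [hzero] at this

namespace HasShape

variable {x : Fin n → ℝ} {t e : ℤ} {i : List ℤ}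

theorem oneLine_of_minReps_one (hn : 2 ≤ n) {v : Perm ℤ} (hv : v ∈ minReps n 1)
    (h : HasShape n (act n v ((2 : ℝ) • fundWeight n 1)) t e i) : oneLine n v = shapeList t e i :=
  oneLine_eq_of_minReps_one hn hv h.pairwise_shapeList h.mem_shapeList_iff

theorem oneLine_of_minReps_two (hn : 2 ≤ n) {v : Perm ℤ} (hv : v ∈ minReps n 2)
    (h : HasShape n (act n v ((2 : ℝ) • fundWeight n 2)) t e i) :
    ∃ a l, shapeList t e i = a :: l ∧ oneLine n v = -a :: l := by
  have hmem : v 2 ∈ shapeList t e i := by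
    rw [h.mem_shapeList_iff, coord_act_apply hn hv.1,
      coord_two_smul_fundWeight_two (by norm_num) (by omega), if_neg (by norm_num)]
  obtain ⟨a, l, hl⟩ := List.exists_cons_of_ne_nil (List.ne_nil_of_mem hmem)
  exact ⟨a, l, hl, oneLine_eq_of_minReps_two hn hv (hl ▸ h.pairwise_shapeList)
    (hl ▸ h.mem_shapeList_iff)⟩

theorem zero_notMem_shapeList (h : HasShape n x t e i) : 0 ∉ shapeList t e i := by
  rw [h.mem_shapeList_iff, coord_eq_zero x (by simp [IsIndex])]
  exact zero_ne_one

theorem eq_one_iff_even (hn : 2 ≤ n) {r : ℤ} (hr : r = 1 ∨ r = 2) {v : Perm ℤ}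
    (hv : v ∈ minReps n r) (h : HasShape n (act n v ((2 : ℝ) • fundWeight n r)) t e i) :
    r = 1 ↔ Even (i.length + if e = -1 then 1 else 0) := by
  have hpar := even_countP_neg_oneLine hn hv.1
  rw [← h.countP_shapeList]
  rcases hr with rfl | rfl
  · rw [h.oneLine_of_minReps_one hn hv] at hpar
    exact iff_of_true rfl hpar
  · obtain ⟨a, l, hl, hone⟩ := h.oneLine_of_minReps_two hn hv
    refine iff_of_false (by norm_num) ?_
    have ha : a ≠ 0 := fun ha => h.zero_notMem_shapeList (hl ▸ ha ▸ List.mem_cons_self)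
    rw [hone] at hpar
    rw [hl]
    rcases ha.lt_or_gt with ha | ha <;> simpa [ha, ha.le, Nat.even_add_one] using hpar

theorem eq_of_dotProduct_self (h : HasShape n x t e i) (hn : 1 ≤ n) (hdot : x ⬝ᵥ x = n) :
    (t = 2 ∨ t = 3) ∧ (e = -1 ∨ e = 1) ∧ n = t + 2 * i.length ∧ i = steps (t + 2) i.length := by
  have hsize : (n : ℤ) = t - 1 + e ^ 2 + 2 * i.length := by
    exact_mod_cast hdot.symm.trans h.dotProduct_self
  have hhead := h.isHead
  have he : e ≠ 0 := fun he => by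
    have hone := h.isTernary.coord_ne_zero hdot le_rfl (by omega)
    rw [h.coord_eq 1 le_rfl (by omega), shapeCoord, if_pos rfl, he, Int.cast_zero] at hone
    exact hone rfl
  have he' : e = -1 ∨ e = 1 := by unfold IsHead at hhead; omega
  have hsq : e ^ 2 = 1 := by rcases he' with rfl | rfl <;> norm_num
  exact ⟨by unfold IsHead at hhead; omega, he', by omega, h.sparse.eq_steps (by omega)⟩

theorem unique_of_dotProduct_self (hn : 1 ≤ n) (h : HasShape n x t e i) (hx : x ⬝ᵥ x = n)
    {y : Fin n → ℝ} {t' e' : ℤ} {i' : List ℤ} (h' : HasShape n y t' e' i') (hy : y ⬝ᵥ y = n)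
    (hpar : Even (i.length + if e = -1 then 1 else 0) ↔
      Even (i'.length + if e' = -1 then 1 else 0)) : x = y := by
  obtain ⟨ht, he, hsize, hi⟩ := h.eq_of_dotProduct_self hn hx
  obtain ⟨ht', he', hsize', hi'⟩ := h'.eq_of_dotProduct_self hn hy
  obtain rfl : t = t' := by omega
  have hlen : i.length = i'.length := by omega
  obtain rfl : i = i' := by rw [hi, hi', hlen]
  obtain rfl : e = e' := by
    rcases he with rfl | rfl <;> rcases he' with rfl | rfl <;> grind
  exact h.ext h'

theorem exists_mem_minReps_of_dotProduct_self (hn : 2 ≤ n) (h : HasShape n x t e i)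
    (hdot : x ⬝ᵥ x = n) {r : ℤ} (hr : r = 1 ∨ r = 2)
    (hpar : r = 1 ↔ Even (i.length + if e = -1 then 1 else 0)) :
    ∃ v ∈ minReps n r, act n v ((2 : ℝ) • fundWeight n r) = x := by
  obtain ⟨s, hs, v, hv, hvx⟩ :
      ∃ s : ℤ, (s = 1 ∨ s = 2) ∧ ∃ v ∈ minReps n s, act n v ((2 : ℝ) • fundWeight n s) = x := by
    rcases h.isTernary.exists_mem_minReps_spin hn fun k h₁ h₂ =>
      h.isTernary.coord_ne_zero hdot h₁ h₂ with hex | hex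
    · exact ⟨1, Or.inl rfl, hex⟩
    · exact ⟨2, Or.inr rfl, hex⟩
  have hs' := (hvx.symm ▸ h).eq_one_iff_even hn hs hv
  obtain rfl : s = r := by
    have := hpar.trans hs'.symm
    omega
  exact ⟨v, hv, hvx⟩

theorem exists_maximalSet_eq_singleton (hn : 3 ≤ n) (h : HasShape n x t e i)
    (hdot : x ⬝ᵥ x = n) {r : ℤ} (hr : r = 1 ∨ r = 2)
    (hpar : r = 1 ↔ Even (i.length + if e = -1 then 1 else 0)) :
    ∃ v ∈ minReps n r, maximalSet n r = {v} ∧ act n v ((2 : ℝ) • fundWeight n r) = x := by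
  have hn₂ : 2 ≤ n := by omega
  have hr₁ : 1 ≤ r := by omega
  obtain ⟨v, hv, rfl⟩ := h.exists_mem_minReps_of_dotProduct_self hn₂ hdot hr hpar
  refine ⟨v, hv, Set.eq_singleton_iff_unique_mem.2 ⟨?_, fun u hu => ?_⟩, rfl⟩
  · have hmax := h.isReflMaximal hn₂
    rw [act_smul] at hmax
    exact mem_maximalSet_of_isReflMaximal hn₂ hr₁ hv (hmax.of_smul two_pos)
  · have hmax := (isSimpleMaximal_of_mem_maximalSet hn₂ hr₁ hu).smul two_pos
    rw [← act_smul] at hmax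
    obtain ⟨t', e', i', h'⟩ :=
      hmax.exists_hasShape hn ((isTernary_two_smul_fundWeight hr).act hn₂ hu.1.1)
    have hdot' := (act_dotProduct_act hn₂ hu.1.1 _ _).trans
      (two_smul_fundWeight_dotProduct_self (n := n) hr)
    have hweight := h'.unique_of_dotProduct_self (by omega) hdot' h hdot
      ((h'.eq_one_iff_even hn₂ hr hu.1).symm.trans hpar)
    rw [act_smul, act_smul] at hweight
    exact minReps_unique hn₂ hr₁ hu.1 hv (smul_right_injective _ two_ne_zero hweight)

end HasShape

theorem shapeList_steps {t e : ℤ} (he : e = -1 ∨ e = 1) {q : ℕ} (hsize : (n : ℤ) = t + 2 * q) :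
    shapeList t e (steps (t + 2) q) =
      steps (-((n : ℤ) - 1)) q ++ (e :: up (Finset.Icc 2 t)) ++ steps (t + 2) q := by
  rw [shapeList, headList, if_neg (by omega), negRev_primed_steps,
    show t + 2 + 2 * (q : ℤ) - 3 = n - 1 by omega, List.singleton_append]

section

variable {y : Fin n → ℝ} {t e : ℤ} {q : ℕ}

theorem HasShape.exists_maximal_of_steps (hn : 3 ≤ n)
    (h : HasShape n ((1 / 2 : ℝ) • y) t e (steps (t + 2) q)) (he : e = -1 ∨ e = 1)
    (hsize : (n : ℤ) = t + 2 * q) {r : ℤ} (hr : r = 1 ∨ r = 2)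
    (hpar : r = 1 ↔ Even (q + if e = -1 then 1 else 0)) :
    ∃ v ∈ minReps n r, maximalSet n r = {v} ∧ act n v ((4 : ℝ) • fundWeight n r) = y ∧
      HasShape n (act n v ((2 : ℝ) • fundWeight n r)) t e (steps (t + 2) q) := by
  have hdot : ((1 / 2 : ℝ) • y) ⬝ᵥ ((1 / 2 : ℝ) • y) = n := by
    have hsq : e ^ 2 = 1 := by rcases he with rfl | rfl <;> norm_num
    rw [h.dotProduct_self, hsq, length_steps, sub_add_cancel, ← hsize, Int.cast_natCast]
  obtain ⟨v, hv, hmax, hweight⟩ :=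
    h.exists_maximalSet_eq_singleton hn hdot hr (by rwa [length_steps])
  refine ⟨v, hv, hmax, ?_, hweight ▸ h⟩
  rw [show (4 : ℝ) = 2 * 2 by norm_num, mul_smul, act_smul, hweight, smul_smul]
  norm_num

theorem HasShape.exists_maximal_one (hn : 3 ≤ n)
    (h : HasShape n ((1 / 2 : ℝ) • y) t e (steps (t + 2) q)) (he : e = -1 ∨ e = 1)
    (hsize : (n : ℤ) = t + 2 * q) (hpar : Even (q + if e = -1 then 1 else 0)) :
    ∃ v, maximalSet n 1 = {v} ∧
      oneLine n v = steps (-((n : ℤ) - 1)) q ++ (e :: up (Finset.Icc 2 t)) ++ steps (t + 2) q ∧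
      act n v ((4 : ℝ) • fundWeight n 1) = y := by
  obtain ⟨v, hv, hmax, hweight, hv'⟩ :=
    h.exists_maximal_of_steps hn he hsize (Or.inl rfl) (iff_of_true rfl hpar)
  exact ⟨v, hmax, by rw [hv'.oneLine_of_minReps_one (by omega) hv, shapeList_steps he hsize],
    hweight⟩

theorem HasShape.exists_maximal_two (hn : 3 ≤ n)
    (h : HasShape n ((1 / 2 : ℝ) • y) t e (steps (t + 2) (q + 1))) (he : e = -1 ∨ e = 1)
    (hsize : (n : ℤ) = t + 2 * (q + 1)) (hpar : Odd (q + 1 + if e = -1 then 1 else 0)) :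
    ∃ v, maximalSet n 2 = {v} ∧
      oneLine n v = [(n : ℤ) - 1] ++ steps (-((n : ℤ) - 3)) q ++ (e :: up (Finset.Icc 2 t)) ++
        steps (t + 2) (q + 1) ∧
      act n v ((4 : ℝ) • fundWeight n 2) = y := by
  obtain ⟨v, hv, hmax, hweight, hv'⟩ := h.exists_maximal_of_steps hn he (by omega) (Or.inr rfl)
    (iff_of_false (by norm_num) (Nat.not_even_iff_odd.2 hpar))
  refine ⟨v, hmax, ?_, hweight⟩
  obtain ⟨a, l, hl, hone⟩ := hv'.oneLine_of_minReps_two (by omega) hv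
  rw [shapeList_steps he (by omega : (n : ℤ) = t + 2 * (q + 1 : ℕ)), steps_succ,
    show -((n : ℤ) - 1) + 2 = -(n - 3) by ring] at hl
  obtain ⟨rfl, rfl⟩ := List.cons.inj hl
  rw [hone, neg_neg, List.singleton_append]
  rfl

end

theorem hasShape_steps_four (hn : 2 ≤ n) {e : ℤ} (he : e = -1 ∨ e = 1) {q : ℕ}
    (hsize : n = 2 + 2 * q) :
    HasShape n ((1 / 2 : ℝ) • ((1 + e : ℝ) • simpleRoot n 1 + (1 - e : ℝ) • simpleRoot n 2 +
      (2 : ℝ) • ∑ i ∈ Finset.Icc 2 (q + 1), simpleRoot n (2 * (i : ℤ)))) 2 e (steps 4 q) := by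
  have h := hasShape_two hn (e := e) (by omega) (sparse_steps (k := q) (by omega))
  rw [rootSum_steps] at h
  convert h using 1
  simp only [sub_self, add_zero]
  module

theorem hasShape_steps_five (hn : 3 ≤ n) {e : ℤ} (he : e = -1 ∨ e = 1) {q : ℕ}
    (hsize : n = 3 + 2 * q) :
    HasShape n ((1 / 2 : ℝ) • ((2 + e : ℝ) • simpleRoot n 1 + (2 - e : ℝ) • simpleRoot n 2 +
      (2 : ℝ) • simpleRoot n 3 +
      (2 : ℝ) • ∑ i ∈ Finset.Icc 2 (q + 1), simpleRoot n (2 * (i : ℤ) + 1))) 3 e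
      (steps 5 q) := by
  have h := hasShape_three hn he (sparse_steps (k := q) (by omega))
  rw [rootSum_steps, show (5 - 4 : ℤ) = 1 by norm_num] at h
  convert h using 1
  module

theorem exists_maximal_one_of_even (hn : 4 ≤ n) {e : ℤ}
    (he : n % 4 = 0 ∧ e = -1 ∨ n % 4 = 2 ∧ e = 1) :
    ∃ v, maximalSet n 1 = {v} ∧
      oneLine n v = steps (-((n : ℤ) - 1)) (n / 2 - 1) ++ [e] ++ steps 2 (n / 2) ∧
      act n v ((4 : ℝ) • fundWeight n 1) = (1 + e : ℝ) • simpleRoot n 1 +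
        (1 - e : ℝ) • simpleRoot n 2 +
        (2 : ℝ) • ∑ i ∈ Finset.Icc 2 (n / 2), simpleRoot n (2 * (i : ℤ)) := by
  obtain ⟨q, hq⟩ : ∃ q, n / 2 = q + 1 := ⟨n / 2 - 1, by omega⟩
  have h := (hasShape_steps_four (n := n) (q := q) (e := e) (by omega) (by omega)
    (by omega)).exists_maximal_one (by omega) (by omega) (by omega) (by grind)
  simpa [hq, steps_succ, up] using h

theorem exists_maximal_one_of_odd (hn : 4 ≤ n) {e : ℤ}
    (he : n % 4 = 1 ∧ e = -1 ∨ n % 4 = 3 ∧ e = 1) :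
    ∃ v, maximalSet n 1 = {v} ∧
      oneLine n v = steps (-((n : ℤ) - 1)) ((n - 1) / 2 - 1) ++ [e, 2] ++
        steps 3 ((n - 1) / 2) ∧
      act n v ((4 : ℝ) • fundWeight n 1) = (2 + e : ℝ) • simpleRoot n 1 +
        (2 - e : ℝ) • simpleRoot n 2 + (2 : ℝ) • simpleRoot n 3 +
        (2 : ℝ) • ∑ i ∈ Finset.Icc 2 ((n - 1) / 2), simpleRoot n (2 * (i : ℤ) + 1) := by
  obtain ⟨q, hq⟩ : ∃ q, (n - 1) / 2 = q + 1 := ⟨(n - 1) / 2 - 1, by omega⟩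
  have h := (hasShape_steps_five (n := n) (q := q) (e := e) (by omega) (by omega)
    (by omega)).exists_maximal_one (by omega) (by omega) (by omega) (by grind)
  simpa [hq, steps_succ, up_Icc_two_three] using h

theorem exists_maximal_two_of_even (hn : 4 ≤ n) {e : ℤ}
    (he : n % 4 = 0 ∧ e = 1 ∨ n % 4 = 2 ∧ e = -1) :
    ∃ v, maximalSet n 2 = {v} ∧
      oneLine n v = [(n : ℤ) - 1] ++ steps (-((n : ℤ) - 3)) (n / 2 - 2) ++ [e] ++
        steps 2 (n / 2) ∧
      act n v ((4 : ℝ) • fundWeight n 2) = (1 + e : ℝ) • simpleRoot n 1 +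
        (1 - e : ℝ) • simpleRoot n 2 +
        (2 : ℝ) • ∑ i ∈ Finset.Icc 2 (n / 2), simpleRoot n (2 * (i : ℤ)) := by
  obtain ⟨q, hq⟩ : ∃ q, n / 2 = q + 2 := ⟨n / 2 - 2, by omega⟩
  have h := (hasShape_steps_four (n := n) (q := q + 1) (e := e) (by omega) (by omega)
    (by omega)).exists_maximal_two (by omega) (by omega) (by omega) (by grind)
  simpa [hq, steps_succ, up] using h

theorem exists_maximal_two_of_odd (hn : 4 ≤ n) {e : ℤ}
    (he : n % 4 = 1 ∧ e = 1 ∨ n % 4 = 3 ∧ e = -1) :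
    ∃ v, maximalSet n 2 = {v} ∧
      oneLine n v = [(n : ℤ) - 1] ++ steps (-((n : ℤ) - 3)) ((n - 1) / 2 - 2) ++ [e, 2] ++
        steps 3 ((n - 1) / 2) ∧
      act n v ((4 : ℝ) • fundWeight n 2) = (2 + e : ℝ) • simpleRoot n 1 +
        (2 - e : ℝ) • simpleRoot n 2 + (2 : ℝ) • simpleRoot n 3 +
        (2 : ℝ) • ∑ i ∈ Finset.Icc 2 ((n - 1) / 2), simpleRoot n (2 * (i : ℤ) + 1) := by
  obtain ⟨q, hq⟩ : ∃ q, (n - 1) / 2 = q + 2 := ⟨(n - 1) / 2 - 2, by omega⟩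
  have h := (hasShape_steps_five (n := n) (q := q + 1) (e := e) (by omega) (by omega)
    (by omega)).exists_maximal_two (by omega) (by omega) (by omega) (by grind)
  simpa [hq, steps_succ, up_Icc_two_three] using h

end TypeD

theorem proposition5p1 (n : ℕ) (hn : 4 ≤ n) :
    -- the case `r = 1`
    ((n % 4 = 0 → ∃ v, maximalSet n 1 = {v} ∧
        oneLine n v = steps (-((n : ℤ) - 1)) (n / 2 - 1) ++ [-1] ++ steps 2 (n / 2) ∧
        act n v ((4 : ℝ) • fundWeight n 1) = (2 : ℝ) • simpleRoot n 2 +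
          (2 : ℝ) • ∑ i ∈ Finset.Icc 2 (n / 2), simpleRoot n (2 * (i : ℤ))) ∧
      (n % 4 = 2 → ∃ v, maximalSet n 1 = {v} ∧
        oneLine n v = steps (-((n : ℤ) - 1)) (n / 2 - 1) ++ [1] ++ steps 2 (n / 2) ∧
        act n v ((4 : ℝ) • fundWeight n 1) = (2 : ℝ) • simpleRoot n 1 +
          (2 : ℝ) • ∑ i ∈ Finset.Icc 2 (n / 2), simpleRoot n (2 * (i : ℤ))) ∧
      (n % 4 = 1 → ∃ v, maximalSet n 1 = {v} ∧
        oneLine n v = steps (-((n : ℤ) - 1)) ((n - 1) / 2 - 1) ++ [-1, 2] ++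
          steps 3 ((n - 1) / 2) ∧
        act n v ((4 : ℝ) • fundWeight n 1) = simpleRoot n 1 + (3 : ℝ) • simpleRoot n 2 + (2 : ℝ) • simpleRoot n 3 +
          (2 : ℝ) • ∑ i ∈ Finset.Icc 2 ((n - 1) / 2), simpleRoot n (2 * (i : ℤ) + 1)) ∧
      (n % 4 = 3 → ∃ v, maximalSet n 1 = {v} ∧
        oneLine n v = steps (-((n : ℤ) - 1)) ((n - 1) / 2 - 1) ++ [1, 2] ++
          steps 3 ((n - 1) / 2) ∧
        act n v ((4 : ℝ) • fundWeight n 1) = (3 : ℝ) • simpleRoot n 1 + simpleRoot n 2 + (2 : ℝ) • simpleRoot n 3 +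
          (2 : ℝ) • ∑ i ∈ Finset.Icc 2 ((n - 1) / 2), simpleRoot n (2 * (i : ℤ) + 1))) ∧
    -- the case `r = 2`
    ((n % 4 = 0 → ∃ v, maximalSet n 2 = {v} ∧
        oneLine n v = [(n : ℤ) - 1] ++ steps (-((n : ℤ) - 3)) (n / 2 - 2) ++ [1] ++ steps 2 (n / 2) ∧
        act n v ((4 : ℝ) • fundWeight n 2) = (2 : ℝ) • simpleRoot n 1 +
          (2 : ℝ) • ∑ i ∈ Finset.Icc 2 (n / 2), simpleRoot n (2 * (i : ℤ))) ∧
      (n % 4 = 2 → ∃ v, maximalSet n 2 = {v} ∧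
        oneLine n v = [(n : ℤ) - 1] ++ steps (-((n : ℤ) - 3)) (n / 2 - 2) ++ [-1] ++ steps 2 (n / 2) ∧
        act n v ((4 : ℝ) • fundWeight n 2) = (2 : ℝ) • simpleRoot n 2 +
          (2 : ℝ) • ∑ i ∈ Finset.Icc 2 (n / 2), simpleRoot n (2 * (i : ℤ))) ∧
      (n % 4 = 1 → ∃ v, maximalSet n 2 = {v} ∧
        oneLine n v = [(n : ℤ) - 1] ++ steps (-((n : ℤ) - 3)) ((n - 1) / 2 - 2) ++ [1, 2] ++
          steps 3 ((n - 1) / 2) ∧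
        act n v ((4 : ℝ) • fundWeight n 2) = (3 : ℝ) • simpleRoot n 1 + simpleRoot n 2 + (2 : ℝ) • simpleRoot n 3 +
          (2 : ℝ) • ∑ i ∈ Finset.Icc 2 ((n - 1) / 2), simpleRoot n (2 * (i : ℤ) + 1)) ∧
      (n % 4 = 3 → ∃ v, maximalSet n 2 = {v} ∧
        oneLine n v = [(n : ℤ) - 1] ++ steps (-((n : ℤ) - 3)) ((n - 1) / 2 - 2) ++ [-1, 2] ++
          steps 3 ((n - 1) / 2) ∧
        act n v ((4 : ℝ) • fundWeight n 2) = simpleRoot n 1 + (3 : ℝ) • simpleRoot n 2 + (2 : ℝ) • simpleRoot n 3 +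
          (2 : ℝ) • ∑ i ∈ Finset.Icc 2 ((n - 1) / 2), simpleRoot n (2 * (i : ℤ) + 1))) ∧
    -- the case `3 ≤ r ≤ n - 1` with `n + 1 - r = 2 m`
    (∀ (r : ℤ) (m : ℕ), 3 ≤ r → r ≤ (n : ℤ) - 1 → (n : ℤ) + 1 - r = 2 * (m : ℤ) →
      (∀ i ∈ J m 1 n \ Z m n, ∃ v, IsUniqueOfWeight n r (rootSum n i) v ∧ v ∈ maximalSet n r) ∧
      (∀ i ∈ J m 3 n, ∃ v, IsUniqueOfWeight n r (rootSum n i) v ∧ v ∈ maximalSet n r ∧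
        oneLine n v = [if Odd m then -1 else 1] ++ up (gaps 2 n i) ++
          negRev (primed i) ++ i) ∧
      (∀ i ∈ J (m - 1) 4 n, ∃ v, IsUniqueOfWeight n r (simpleRoot n 1 + rootSum n i) v ∧ v ∈ maximalSet n r ∧
        oneLine n v = (if Odd m then up (gaps 3 n i) else upNeg (gaps 3 n i)) ++
          negRev (primed i) ++ [1, 2] ++ i) ∧
      (∀ i ∈ J (m - 1) 4 n, ∃ v, IsUniqueOfWeight n r (simpleRoot n 2 + rootSum n i) v ∧ v ∈ maximalSet n r ∧
        oneLine n v = (if Odd m then upNeg (gaps 3 n i) else up (gaps 3 n i)) ++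
          negRev (primed i) ++ [-1, 2] ++ i) ∧
      (∀ v, v ∈ maximalSet n r ↔ v ∈ minReps n r ∧ (
        (∃ i ∈ J m 3 n, act n v (fundWeight n r) =
          rootSum n i) ∨
        (∃ i ∈ J (m - 1) 4 n, act n v (fundWeight n r) =
          simpleRoot n 1 + rootSum n i) ∨
        (∃ i ∈ J (m - 1) 4 n, act n v (fundWeight n r) =
          simpleRoot n 2 + rootSum n i)))) ∧
    -- the case `3 ≤ r ≤ n - 1` with `n + 1 - r = 2 m + 1`
    (∀ (r : ℤ) (m : ℕ), 3 ≤ r → r ≤ (n : ℤ) - 1 → (n : ℤ) + 1 - r = 2 * (m : ℤ) + 1 →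
      (∀ i ∈ J m 4 n, ∃ v, IsUniqueOfWeight n r ((1 / 2 : ℝ) • simpleRoot n 1 + (1 / 2 : ℝ) • simpleRoot n 2 + rootSum n i) v ∧ v ∈ maximalSet n r ∧
        oneLine n v = [if Odd m then -1 else 1] ++ up (gaps 3 n i) ++
          negRev (primed i) ++ [2] ++ i) ∧
      (∀ i ∈ J (m - 1) 5 n, ∃ v, IsUniqueOfWeight n r ((3 / 2 : ℝ) • simpleRoot n 1 + (1 / 2 : ℝ) • simpleRoot n 2 +
          simpleRoot n 3 + rootSum n i) v ∧ v ∈ maximalSet n r ∧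
        oneLine n v = (if Odd m then up (gaps 4 n i) else upNeg (gaps 4 n i)) ++
          negRev (primed i) ++ [1, 2, 3] ++ i) ∧
      (∀ i ∈ J (m - 1) 5 n, ∃ v, IsUniqueOfWeight n r ((1 / 2 : ℝ) • simpleRoot n 1 + (3 / 2 : ℝ) • simpleRoot n 2 +
          simpleRoot n 3 + rootSum n i) v ∧ v ∈ maximalSet n r ∧
        oneLine n v = (if Odd m then upNeg (gaps 4 n i) else up (gaps 4 n i)) ++
          negRev (primed i) ++ [-1, 2, 3] ++ i) ∧
      (∀ v, v ∈ maximalSet n r ↔ v ∈ minReps n r ∧ (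
        (∃ i ∈ J m 4 n, act n v (fundWeight n r) =
          (1 / 2 : ℝ) • simpleRoot n 1 + (1 / 2 : ℝ) • simpleRoot n 2 + rootSum n i) ∨
        (∃ i ∈ J (m - 1) 5 n, act n v (fundWeight n r) =
          (3 / 2 : ℝ) • simpleRoot n 1 + (1 / 2 : ℝ) • simpleRoot n 2 +
          simpleRoot n 3 + rootSum n i) ∨
        (∃ i ∈ J (m - 1) 5 n, act n v (fundWeight n r) =
          (1 / 2 : ℝ) • simpleRoot n 1 + (3 / 2 : ℝ) • simpleRoot n 2 +
          simpleRoot n 3 + rootSum n i)))) ∧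
    -- the case `r = n`
    (∃ v, maximalSet n n = {v} ∧
      oneLine n v = [1] ++ up (Finset.Icc 3 (n : ℤ)) ++ [2] ∧
      act n v (fundWeight n n) =
        (1 / 2 : ℝ) • simpleRoot n 1 + (1 / 2 : ℝ) • simpleRoot n 2) := by
  have hn₃ : 3 ≤ n := by omega
  refine ⟨⟨fun h => ?_, fun h => ?_, fun h => ?_, fun h => ?_⟩,
    ⟨fun h => ?_, fun h => ?_, fun h => ?_, fun h => ?_⟩, fun r m hr hrn hm => ?_,
    fun r m hr hrn hm => ?_, exists_maximalSet_self_eq_singleton hn₃⟩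
  · simpa [one_add_one_eq_two] using exists_maximal_one_of_even hn (.inl ⟨h, rfl⟩)
  · simpa [one_add_one_eq_two] using exists_maximal_one_of_even hn (.inr ⟨h, rfl⟩)
  · convert exists_maximal_one_of_odd hn (.inl ⟨h, rfl⟩) using 8 <;> norm_num
  · convert exists_maximal_one_of_odd hn (.inr ⟨h, rfl⟩) using 8 <;> norm_num
  · simpa [one_add_one_eq_two] using exists_maximal_two_of_even hn (.inl ⟨h, rfl⟩)
  · simpa [one_add_one_eq_two] using exists_maximal_two_of_even hn (.inr ⟨h, rfl⟩)
  · convert exists_maximal_two_of_odd hn (.inl ⟨h, rfl⟩) using 8 <;> norm_num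
  · convert exists_maximal_two_of_odd hn (.inr ⟨h, rfl⟩) using 8 <;> norm_num
  · replace hrn : r ≤ n := by omega
    exact ⟨fun i => exists_maximal_of_mem_J_diff_Z hn₃ hr hrn hm,
      fun i => exists_maximal_rootSum hn₃ hr hrn hm,
      fun i => exists_maximal_simpleRoot_one_add hn₃ hr hrn hm,
      fun i => exists_maximal_simpleRoot_two_add hn₃ hr hrn hm,
      mem_maximalSet_iff_of_even hn₃ hr hrn hm⟩
  · have hpos : 1 ≤ m := by omega
    replace hrn : r ≤ n := by omega
    exact ⟨fun i => exists_maximal_half_half hn₃ hr hrn hm,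
      fun i => exists_maximal_threeHalves_half hn₃ hr hrn hm hpos,
      fun i => exists_maximal_half_threeHalves hn₃ hr hrn hm hpos,
      mem_maximalSet_iff_of_odd hn₃ hr hrn hm hpos⟩
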